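/- **Setting.** Fix finite sets $\mathcal P$ of atomic propositions and $\mathcal A$ of actions, and a countably infinite set of variables. HFL types are $\tau ::= \mathsf{Pr} \mid \tau^v\to\tau$ with variances $v\in\{-,0,+\}$; HFL formulas are $$\varphi ::= q \mid X \mid \neg\varphi \mid \varphi\vee\varphi \mid \langle a\rangle\varphi \mid \varphi\,\varphi \mid \lambda(X^v:\tau).\varphi \mid \mu(X:\tau).\varphi .$$ Typing judgements $\Gamma\vdash\varphi:\tau$, for contexts $\Gamma = X_1^{v_1}:\tau_1,\dots,X_j^{v_j}:\tau_j$ with distinct variables ($\Gamma^-$ exchanges the variances $+$ and $-$), are derived by the usual HFL rules: $\Gamma\vdash q:\mathsf{Pr}$; $\Gamma,X^v:\tau\vdash X:\tau$ if $v\in\{0,+\}$; $\Gamma\vdash\neg\varphi:\tau$ if $\Gamma^-\vdash\varphi:\tau$; $\vee$ and $\langle a\rangle$ act on type $\mathsf{Pr}$; $\Gamma\vdash\lambda(X^v:\sigma).\varphi:\sigma^v\to\tau$ if $\Gamma,X^v:\sigma\vdash\varphi:\tau$; $\Gamma\vdash\mu(X:\tau).\varphi:\tau$ if $\Gamma,X^+:\tau\vdash\varphi:\tau$;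 and $\Gamma\vdash\varphi\,\psi:\tau$ if $\Gamma\vdash\varphi:\sigma^v\to\tau$ and $\psi:\sigma$ is derivable in $\Gamma$ (for $v=+$), in $\Gamma^-$ (for $v=-$), in both (for $v=0$). For $\tau=\tau_1\to\dots\to\tau_j\to\mathsf{Pr}$ put $\mathrm{ord}(\tau)=\max_i(1+\mathrm{ord}(\tau_i))$ and $\mathrm{mar}(\tau)=\max(\{j\}\cup\{\mathrm{mar}(\tau_i)\}_i)$, where $\max\emptyset=0$. $\mathrm{HFL}(k,m)$ is the set of all formulas $\varphi$ for which $\vdash\varphi:\mathsf{Pr}$ is derivable using types of order at most $k$ and maximal arity at most $m$ only. The size $|\varphi|$ is the number of formulas in the Fischer–Ladner closure of $\varphi$, the least set that contains $\varphi$ and is closed under: $\psi_1\vee\psi_2\mapsto\psi_1,\psi_2$; $\neg(\psi_1\vee\psi_2)\mapsto\neg\psi_1,\neg\psi_2$; $\langle a\rangle\psi\mapsto\psi$; $\neg\langle a\rangle\psi\mapsto\neg\psi$; $\psi\,\chi\mapsto\psi,\chi,\neg\chi$; $\neg(\psi\,\chi)\mapsto\neg\psi,\chi,\neg\chi$; $\lambda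 X.\psi\mapsto\psi$; $\neg\lambda X.\psi\mapsto\neg\psi$; $\mu X.\psi\mapsto\psi$; $\neg\mu X.\psi\mapsto\neg\psi[\neg X/X]$; $\neg\neg\psi\mapsto\psi$; $\neg X\mapsto X$; $\neg q\mapsto q$. A transition system $\mathcal T$ has a finite non-empty set $\mathcal S$ of states, a relation $\xrightarrow{a}$ on $\mathcal S$ for every $a\in\mathcal A$, and a labelling $L:\mathcal S\to 2^{\mathcal P}$. Over $\mathcal T$, $\mathsf{Pr}$ denotes $2^{\mathcal S}$ ordered by inclusion, and $\sigma^v\to\tau$ denotes the pointwise ordered set of functions $[\![\sigma]\!]\to[\![\tau]\!]$ that are monotone ($v=+$), antitone ($v=-$), arbitrary ($v=0$). Formulas denote elements of their types in the usual way: $\mu(X:\tau).\varphi$ is the greatest lower bound in $[\![\tau]\!]$ of the $x$ with $[\![\varphi]\!]_{X\mapsto x}\sqsubseteq x$, and $\neg\varphi$ of type $\tau$ is the (at function types, pointwise) complement of $[\![\varphi]\!]$. The semantics $[\![\varphi]\!]^{\mathcal T}$ is defined if all the complements that it asks for, at function types, lie in the respective $[\![\tau]\!]$; this holds, for example, whenever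 negation is only applied at types $\sigma_1^0\to\dots\to\sigma_j^0\to\mathsf{Pr}$, $j\ge 0$. The input $\mathcal T,s,\varphi$ with $\mathcal S=\{0,\dots,n-1\}$ is given as a word over a fixed finite alphabet: the adjacency matrix and the labels of $\mathcal T$, the number $s$ in unary, and $\varphi$ with its type annotations in prefix notation, its variables being numbered consecutively (in unary). Let $\mathrm{tower}_0(x)=x$ and $\mathrm{tower}_{k+1}(x)=2^{\mathrm{tower}_k(x)}$. **Theorem.** There is a deterministic multi-stack (equivalently, multi-tape) Turing machine $M$ such that for all $k,m\ge 1$ there is a constant $C$ such that, for every transition system $\mathcal T$ with $n$ states, every state $s$ of $\mathcal T$ and every $\varphi\in\mathrm{HFL}(k,m)$ whose semantics over $\mathcal T$ is defined, $M$ decides whether $s\in[\![\varphi]\!]^{\mathcal T}$ in at most $$2^{C\cdot|\varphi|^k\cdot\log_2(n\cdot|\varphi|)}\cdot\bigl(\mathrm{tower}_k(n(m+k-1)^{k-1})\bigr)^{C\cdot|\varphi|^2}$$ steps. Moreover, for formulas with $k\le|\varphi|$ and $m\le|\varphi|$ this holds with one constant $C$ that does not depend on $k$ and $m$. ($M$ and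 $C$ may depend on $\mathcal P$ and $\mathcal A$.) That is, $\mathrm{HFL}(k,m)$ model checking is solvable in time $2^{O(|\varphi|^k\log(n|\varphi|))}\cdot(\mathrm{tower}_k(n(m+k-1)^{k-1}))^{O(|\varphi|^2)}$. -/

import Mathlib

namespace HFL

/-! ### Types -/

/-- Variances `-`, `0`, `+`. -/
inductive Variance
  | neg
  | zero
  | pos

/-- The complement `v⁻` of a variance. -/
def Variance.compl : Variance → Variance
  | .neg => .pos
  | .zero => .zero
  | .pos => .neg

/-- HFL types: the ground type `Pr` and the function types `σ^v → τ`. -/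
inductive Ty
  | pr
  | arr (σ : Ty) (v : Variance) (τ : Ty)

/-- The order of `τ₁ → … → τ_m → Pr` is the maximum of the `1 + ord τᵢ` (and `0` for `Pr`). -/
def Ty.ord : Ty → ℕ
  | .pr => 0
  | .arr σ _ τ => max (1 + σ.ord) τ.ord

/-- The number `m` of arguments of `τ₁ → … → τ_m → Pr`. -/
def Ty.arity : Ty → ℕ
  | .pr => 0
  | .arr _ _ τ => τ.arity + 1

/-- The maximal arity of `τ₁ → … → τ_m → Pr` is the maximum of `m` and the maximal arities
of the `τᵢ`. -/
def Ty.mar : Ty → ℕ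
  | .pr => 0
  | .arr σ _ τ => max (τ.arity + 1) (max σ.mar τ.mar)

/-! ### Formulas -/

/-- HFL formulas over atomic propositions `P` and actions `A`; the variables are the natural
numbers. -/
inductive Form (P A : Type)
  | prop (q : P)
  | var (X : ℕ)
  | neg (φ : Form P A)
  | or (φ ψ : Form P A)
  | dia (a : A) (φ : Form P A)
  | app (φ ψ : Form P A)
  | lam (X : ℕ) (v : Variance) (σ : Ty) (φ : Form P A)
  | mu (X : ℕ) (τ : Ty) (φ : Form P A)

variable {P A S : Type}

/-- Typing contexts: the listed variables (each at most once) with their variances and types. -/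
abbrev Ctx := ℕ → Option (Variance × Ty)

/-- The complement `Γ⁻` of a context. -/
def Ctx.compl (Γ : Ctx) : Ctx := fun X => (Γ X).map fun p => (p.1.compl, p.2)

/-- The context `Γ, X^v : τ`. -/
def Ctx.extend (Γ : Ctx) (X : ℕ) (v : Variance) (τ : Ty) : Ctx :=
  Function.update Γ X (some (v, τ))

/-- `HasType U Γ φ τ`: the statement `Γ ⊢ φ : τ` is derivable using types that satisfy `U` only.
In the rules without an explicit `U`, the type of the conclusion already is the type of a premise.
The variables of a context are distinct, so a binder only extends a context by a new variable. -/
inductive HasType (U : Ty → Prop) : Ctx → Form P A → Ty → Prop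
  | prop (Γ : Ctx) (q : P) : U .pr → HasType U Γ (.prop q) .pr
  | var (Γ : Ctx) (X : ℕ) (v : Variance) (τ : Ty) :
      Γ X = some (v, τ) → v = .zero ∨ v = .pos → U τ → HasType U Γ (.var X) τ
  | neg (Γ : Ctx) (φ : Form P A) (τ : Ty) :
      HasType U Γ.compl φ τ → HasType U Γ (.neg φ) τ
  | or (Γ : Ctx) (φ ψ : Form P A) :
      HasType U Γ φ .pr → HasType U Γ ψ .pr → HasType U Γ (.or φ ψ) .pr
  | dia (Γ : Ctx) (a : A) (φ : Form P A) :
      HasType U Γ φ .pr → HasType U Γ (.dia a φ) .pr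
  | lam (Γ : Ctx) (X : ℕ) (v : Variance) (σ τ : Ty) (φ : Form P A) :
      Γ X = none → HasType U (Γ.extend X v σ) φ τ → U σ → U (.arr σ v τ) →
      HasType U Γ (.lam X v σ φ) (.arr σ v τ)
  | app_pos (Γ : Ctx) (φ ψ : Form P A) (σ τ : Ty) :
      HasType U Γ φ (.arr σ .pos τ) → HasType U Γ ψ σ → U τ → HasType U Γ (.app φ ψ) τ
  | app_neg (Γ : Ctx) (φ ψ : Form P A) (σ τ : Ty) :
      HasType U Γ φ (.arr σ .neg τ) → HasType U Γ.compl ψ σ → U τ → HasType U Γ (.app φ ψ) τ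
  | app_zero (Γ : Ctx) (φ ψ : Form P A) (σ τ : Ty) :
      HasType U Γ φ (.arr σ .zero τ) → HasType U Γ ψ σ → HasType U Γ.compl ψ σ → U τ →
      HasType U Γ (.app φ ψ) τ
  | mu (Γ : Ctx) (X : ℕ) (τ : Ty) (φ : Form P A) :
      Γ X = none → HasType U (Γ.extend X .pos τ) φ τ → HasType U Γ (.mu X τ φ) τ

/-- The fragment `HFL(k,m)`: closed formulas of type `Pr` that can be typed using types of order
at most `k` and maximal arity at most `m` only. -/
def Fragment (P A : Type) (k m : ℕ) : Set (Form P A) :=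
  {φ | HasType (fun τ => τ.ord ≤ k ∧ τ.mar ≤ m) (fun _ => none) φ .pr}

/-- The formula `φ[¬X / X]`: every (free) occurrence of `X` is replaced by `¬X`. -/
def Form.substNeg (X : ℕ) : Form P A → Form P A
  | .prop q => .prop q
  | .var Y => if Y = X then .neg (.var X) else .var Y
  | .neg φ => .neg (φ.substNeg X)
  | .or φ ψ => .or (φ.substNeg X) (ψ.substNeg X)
  | .dia a φ => .dia a (φ.substNeg X)
  | .app φ ψ => .app (φ.substNeg X) (ψ.substNeg X)
  | .lam Y v σ φ => .lam Y v σ (if Y = X then φ else φ.substNeg X)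
  | .mu Y τ φ => .mu Y τ (if Y = X then φ else φ.substNeg X)

/-- Membership in the Fischer-Ladner closure of `φ₀`. -/
inductive FL (φ₀ : Form P A) : Form P A → Prop
  | base : FL φ₀ φ₀
  | or_left (φ ψ : Form P A) : FL φ₀ (.or φ ψ) → FL φ₀ φ
  | or_right (φ ψ : Form P A) : FL φ₀ (.or φ ψ) → FL φ₀ ψ
  | neg_or_left (φ ψ : Form P A) : FL φ₀ (.neg (.or φ ψ)) → FL φ₀ (.neg φ)
  | neg_or_right (φ ψ : Form P A) : FL φ₀ (.neg (.or φ ψ)) → FL φ₀ (.neg ψ)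
  | dia (a : A) (φ : Form P A) : FL φ₀ (.dia a φ) → FL φ₀ φ
  | neg_dia (a : A) (φ : Form P A) : FL φ₀ (.neg (.dia a φ)) → FL φ₀ (.neg φ)
  | app_fun (φ ψ : Form P A) : FL φ₀ (.app φ ψ) → FL φ₀ φ
  | app_arg (φ ψ : Form P A) : FL φ₀ (.app φ ψ) → FL φ₀ ψ
  | app_neg_arg (φ ψ : Form P A) : FL φ₀ (.app φ ψ) → FL φ₀ (.neg ψ)
  | neg_app_fun (φ ψ : Form P A) : FL φ₀ (.neg (.app φ ψ)) → FL φ₀ (.neg φ)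
  | neg_app_arg (φ ψ : Form P A) : FL φ₀ (.neg (.app φ ψ)) → FL φ₀ ψ
  | neg_app_neg_arg (φ ψ : Form P A) : FL φ₀ (.neg (.app φ ψ)) → FL φ₀ (.neg ψ)
  | lam (X : ℕ) (v : Variance) (σ : Ty) (φ : Form P A) : FL φ₀ (.lam X v σ φ) → FL φ₀ φ
  | neg_lam (X : ℕ) (v : Variance) (σ : Ty) (φ : Form P A) :
      FL φ₀ (.neg (.lam X v σ φ)) → FL φ₀ (.neg φ)
  | mu (X : ℕ) (τ : Ty) (φ : Form P A) : FL φ₀ (.mu X τ φ) → FL φ₀ φ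
  | neg_mu (X : ℕ) (τ : Ty) (φ : Form P A) :
      FL φ₀ (.neg (.mu X τ φ)) → FL φ₀ (.neg (φ.substNeg X))
  | neg_neg (φ : Form P A) : FL φ₀ (.neg (.neg φ)) → FL φ₀ φ
  | neg_var (X : ℕ) : FL φ₀ (.neg (.var X)) → FL φ₀ (.var X)
  | neg_prop (q : P) : FL φ₀ (.neg (.prop q)) → FL φ₀ (.prop q)

/-- The size `|φ|` of a formula: the number of elements of its Fischer-Ladner closure. -/
noncomputable def Form.size (φ : Form P A) : ℕ := Set.ncard {ψ | FL φ ψ}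

/-! ### Transition systems and semantics -/

/-- Labelled transition systems with state set `S`. -/
structure TS (P A S : Type) where
  /-- `rel a s t` is the transition `s -a→ t`. -/
  rel : A → S → S → Prop
  /-- The atomic propositions that are true in a state. -/
  label : S → Set P

/-- The order of a partial order with a variance attached: unchanged for `+`, reversed for `-`,
flattened to equality for `0`. -/
def Variance.Rel {α : Type} [PartialOrder α] : Variance → α → α → Prop
  | .pos, x, y => x ≤ y
  | .neg, x, y => y ≤ x
  | .zero, x, y => x ≤ y ∧ y ≤ x

/-- The semantics of types over a state set `S`: `Pr` denotes the power set of `S` ordered by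
inclusion, and `σ^v → τ` the functions that are monotone from `⟦σ⟧^v` to `⟦τ⟧`, ordered
pointwise. -/
def dom (S : Type) : Ty → PartOrd.{0}
  | .pr => PartOrd.of (Set S)
  | .arr σ v τ => PartOrd.of
      {f : dom S σ → dom S τ // ∀ x y : dom S σ, v.Rel x y → f x ≤ f y}

/-- `IsComplement τ f g`: `f` is the complement of `g`, that is, the set complement at type `Pr`
and the pointwise complement at function types. -/
def IsComplement : (τ : Ty) → dom S τ → dom S τ → Prop
  | .pr, (f : Set S), (g : Set S) => f = gᶜ
  | .arr σ _ τ, f, g => ∀ x : dom S σ, IsComplement τ (f.1 x) (g.1 x)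

/-- Environments: partial maps from variables to (typed) semantic values. -/
abbrev Env (S : Type) := ℕ → Option ((τ : Ty) × dom S τ)

/-- The environment `η[X ↦ x]`. -/
def Env.update (η : Env S) (X : ℕ) (τ : Ty) (x : dom S τ) : Env S :=
  Function.update η X (some ⟨τ, x⟩)

/-- `Den T φ η τ x`: the formula `φ` has type `τ` in the environment `η`, and `x ∈ ⟦τ⟧` is its
semantics `⟦φ⟧_η` over `T`. There is at most one such `x`; there is none if one of the clauses
asks for an element of `⟦σ^v → τ⟧` that does not exist. -/
def Den (T : TS P A S) : Form P A → Env S → (τ : Ty) → dom S τ → Prop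
  | .prop q, _, .pr, (x : Set S) => x = {s | q ∈ T.label s}
  | .prop _, _, .arr _ _ _, _ => False
  | .var X, η, τ, x => η X = some ⟨τ, x⟩
  | .neg φ, η, τ, x => ∃ y : dom S τ, Den T φ η τ y ∧ IsComplement τ x y
  | .or φ ψ, η, .pr, (x : Set S) =>
      ∃ y z : Set S, Den T φ η .pr y ∧ Den T ψ η .pr z ∧ x = y ∪ z
  | .or _ _, _, .arr _ _ _, _ => False
  | .dia a φ, η, .pr, (x : Set S) =>
      ∃ y : Set S, Den T φ η .pr y ∧ x = {s | ∃ t ∈ y, T.rel a s t}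
  | .dia _ _, _, .arr _ _ _, _ => False
  | .app φ ψ, η, τ, y => ∃ (σ : Ty) (v : Variance) (f : dom S (.arr σ v τ)) (x : dom S σ),
      Den T φ η (.arr σ v τ) f ∧ Den T ψ η σ x ∧ y = f.1 x
  | .lam _ _ _ _, _, .pr, _ => False
  | .lam X v' σ' φ, η, .arr σ v τ, f =>
      σ' = σ ∧ v' = v ∧ ∀ x : dom S σ, Den T φ (η.update X σ x) τ (f.1 x)
  | .mu X τ' φ, η, τ, x =>
      τ' = τ ∧ (∀ z : dom S τ, ∃ y, Den T φ (η.update X τ z) τ y) ∧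
        IsGLB {z : dom S τ | ∃ y, Den T φ (η.update X τ z) τ y ∧ y ≤ z} x

/-- The semantics `⟦φ⟧^T` of the sentence `φ` is the set `x` of states. -/
def SentenceDen (T : TS P A S) (φ : Form P A) (x : Set S) : Prop :=
  Den T φ (fun _ => none) .pr x

/-! ### Inputs of the model checking problem as words over a finite alphabet -/

/-- The input alphabet (finite, as `P` and `A` are). -/
inductive Symb (P A : Type)
  | tick
  | fin
  | state (L : Set P)
  | edge (E : Set A)
  | pr
  | arr (v : Variance)
  | prop (q : P)
  | var
  | neg
  | or
  | dia (a : A)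
  | app
  | lam (v : Variance)
  | mu

/-- Numbers are written in unary, with an end marker. -/
def encodeNum (i : ℕ) : List (Symb P A) := List.replicate i .tick ++ [.fin]

/-- Types in prefix notation. -/
def encodeTy : Ty → List (Symb P A)
  | .pr => [.pr]
  | .arr σ v τ => .arr v :: (encodeTy σ ++ encodeTy τ)

/-- The variables of a formula, in the order of their occurrence. -/
def Form.vars : Form P A → List ℕ
  | .prop _ => []
  | .var X => [X]
  | .neg φ => φ.vars
  | .or φ ψ => φ.vars ++ ψ.vars
  | .dia _ φ => φ.vars
  | .app φ ψ => φ.vars ++ ψ.vars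
  | .lam X _ _ φ => X :: φ.vars
  | .mu X _ φ => X :: φ.vars

/-- Formulas in prefix notation, where the variable `X` is written as the number `num X`. -/
def encodeFormWith (num : ℕ → ℕ) : Form P A → List (Symb P A)
  | .prop q => [.prop q]
  | .var X => .var :: encodeNum (num X)
  | .neg φ => .neg :: encodeFormWith num φ
  | .or φ ψ => .or :: (encodeFormWith num φ ++ encodeFormWith num ψ)
  | .dia a φ => .dia a :: encodeFormWith num φ
  | .app φ ψ => .app :: (encodeFormWith num φ ++ encodeFormWith num ψ)
  | .lam X v σ φ => .lam v :: (encodeNum (num X) ++ encodeTy σ ++ encodeFormWith num φ)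
  | .mu X τ φ => .mu :: (encodeNum (num X) ++ encodeTy τ ++ encodeFormWith num φ)

/-- A formula is written with its variables numbered consecutively, so that the names of the
variables do not contribute to the length of the input. -/
def encodeForm (φ : Form P A) : List (Symb P A) :=
  encodeFormWith (fun X => φ.vars.dedup.idxOf X) φ

/-- A transition system is written as its adjacency matrix: for every state its label, followed
by the set of actions that lead to each of the states. -/
def encodeTS {n : ℕ} (T : TS P A (Fin n)) : List (Symb P A) :=
  (List.finRange n).flatMap fun i =>
    .state (T.label i) :: (List.finRange n).map fun j => .edge {a | T.rel a i j}

/-- The word for the input `T, s, φ`. -/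
def encodeInput {n : ℕ} (T : TS P A (Fin n)) (s : Fin n) (φ : Form P A) : List (Symb P A) :=
  encodeTS T ++ (encodeNum s ++ encodeForm φ)

/-! ### Time -/

/-- `tower x 0 = x` and `tower x (k + 1) = 2 ^ tower x k`. -/
def tower (x : ℕ) : ℕ → ℕ
  | 0 => x
  | k + 1 => 2 ^ tower x k

/-- The bound `2 ^ (C·N^k·log₂(n·N)) · tower_k(n·(m+k-1)^(k-1)) ^ (C·N²)`. -/
noncomputable def timeBound (C k m n N : ℕ) : ℝ :=
  (2 : ℝ) ^ ((C : ℝ) * (N : ℝ) ^ k * Real.logb 2 ((n : ℝ) * (N : ℝ))) *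
    (tower (n * (m + k - 1) ^ (k - 1)) k : ℝ) ^ (C * N ^ 2)

open Classical in
/-- On input `T, s, φ`, the deterministic Turing machine `M` (with finitely many stacks) halts
after at most `b` steps and answers correctly whether `s ∈ ⟦φ⟧^T`, whenever `⟦φ⟧^T` is defined. -/
def DecidesWithin {n : ℕ} (M : Turing.TM2ComputableAux (Symb P A) Bool)
    (T : TS P A (Fin n)) (s : Fin n) (φ : Form P A) (b : ℝ) : Prop :=
  ∀ x : Set (Fin n), SentenceDen T φ x →
    ∃ t : ℕ, (t : ℝ) ≤ b ∧
      Nonempty (Turing.TM2OutputsInTime M.tm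
        ((encodeInput T s φ).map M.inputAlphabet.symm)
        (some ([decide (s ∈ x)].map M.outputAlphabet.symm)) t)

end HFL

/-! The algorithm is plain bottom-up evaluation with explicit function tables. A value of type `τ`
over `n` states is written as a word of `width n τ` bits: `n` bits at `Pr`, and for `σ^v → τ` one
slice of length `width n τ` for each of the `2 ^ width n σ` words that could be an argument, whether
or not they represent anything. An abstraction counts through all argument words and concatenates
the results, an application selects a slice, negation is bitwise, and a fixpoint is iterated from
the word of zeros a fixed number of times. Correctness (`ev_correct`) rests on the logical relation
`Rep` between values and words: a table represents `f` if its slice at every word representing `x`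
represents `f x`; slices at other words do not matter. For fixpoints, `Den.mono` derives
monotonicity of the body from the variances, and `rank` shows that strict chains in `⟦τ⟧` have at
most `width n τ` steps, so that many iterations from the least element reach the least prefixed
point (`iterate_eq_of_isGLB`). Iterations under meaningless argument words may compute nonsense, but
since their number is fixed they end as well. The machine comes from a structured stack program
(`Prog`, `Run`), compiled once and for all (`Run.within`). Its main loop walks along the written
formula with a control stack and an environment of words; `run_mainLoop` shows that it computes `ev`
within `iterTime * iterations` steps. For the time put `D = tower_k(n(m+k-1)^(k-1))` and `N = |φ|`.
All widths are at most `b = D^m * n` (`width_le_pow`), and the number of iterations is at most `3 *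
2^h * (b+1)^d`, where `h` is the height of the syntax tree and `d` the height without negations. The
closure contains formulas of every depth up to `d`, so `d < N`; it strips negations in pairs, so
chains of negations have length at most `2N` and `h ≤ N(2N+1)`. The whole time is then at most
`D^(40N² + 4mN)`, and the factor `2^(C N^k log(nN))` of the claimed bound is only needed to be at
least `1`. -/

namespace HFL

/-! ### Stack programs -/

/-- Structured programs over stacks `K` with symbols `G`. The command `loop k go body` pops the
top `o` of stack `k` (if there is one), executes `body o`, and starts again if `go o` holds. -/
inductive Prog (K G : Type) : Type
  | skip
  | push (k : K) (a : G)
  | seq (p q : Prog K G)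
  | loop (k : K) (go : Option G → Bool) (body : Option G → Prog K G)

/-- The contents of the stacks. -/
abbrev Store (K G : Type) := K → List G

section Run
variable {K G : Type} [DecidableEq K]

/-- `Run p S S' t`: the program `p` transforms `S` into `S'` in at most `t` steps. -/
inductive Run : Prog K G → Store K G → Store K G → ℕ → Prop
  | skip (S) : Run .skip S S 0
  | push (k a S) : Run (.push k a) S (Function.update S k (a :: S k)) 1
  | seq {p q S S₁ S₂ t₁ t₂} : Run p S S₁ t₁ → Run q S₁ S₂ t₂ → Run (.seq p q) S S₂ (t₁ + t₂)
  | loop_exit {k go body S S' t} : go (S k).head? = false →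
      Run (body (S k).head?) (Function.update S k (S k).tail) S' t →
      Run (.loop k go body) S S' (t + 1)
  | loop_next {k go body S S₁ S₂ t₁ t₂} : go (S k).head? = true →
      Run (body (S k).head?) (Function.update S k (S k).tail) S₁ t₁ →
      Run (.loop k go body) S₁ S₂ t₂ → Run (.loop k go body) S S₂ (t₁ + t₂ + 1)
  | mono {p S S' t t'} : Run p S S' t → t ≤ t' → Run p S S' t'

end Run

/-! ### Compilation to Turing machines with stacks -/

/-- The program positions. -/
def Lab {K G : Type} : Prog K G → Type
  | .skip => Empty
  | .push _ _ => Unit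
  | .seq p q => Lab p ⊕ Lab q
  | .loop _ _ body => Unit ⊕ (Σ o : Option G, Lab (body o))

instance Lab.finite {K G : Type} [Finite G] : (p : Prog K G) → Finite (Lab p)
  | .skip => inferInstanceAs (Finite Empty)
  | .push _ _ => inferInstanceAs (Finite Unit)
  | .seq p q =>
    have := Lab.finite p
    have := Lab.finite q
    inferInstanceAs (Finite (Lab p ⊕ Lab q))
  | .loop _ _ body =>
    have := fun o => Lab.finite (body o)
    inferInstanceAs (Finite (Unit ⊕ (Σ o : Option G, Lab (body o))))

section Compile
variable {K G Λ : Type}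

/-- The stack alphabets: the stack `none` for the output holds truth values. -/
def Alph (K G : Type) : Option K → Type
  | none => Bool
  | some _ => G

/-- The label where the execution of a program starts. -/
def entry : (p : Prog K G) → (Lab p → Λ) → Λ → Λ
  | .skip, _, ex => ex
  | .push _ _, emb, _ => emb ()
  | .seq p q, emb, ex =>
    entry p (fun l => emb (.inl l)) (entry q (fun l => emb (.inr l)) ex)
  | .loop _ _ _, emb, _ => emb (.inl ())

/-- The statements at the positions of a program, where positions are translated to labels by
`emb`, and `ex` is the label to continue with. -/
def code : (p : Prog K G) → (Lab p → Λ) → Λ → Lab p → Turing.TM2.Stmt (Alph K G) Λ (Option G)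
  | .skip, _, _, l => nomatch l
  | .push k a, _, ex, _ => .push (some k) (fun _ => a) (.goto fun _ => ex)
  | .seq p q, emb, ex, .inl l =>
    code p (fun l => emb (.inl l)) (entry q (fun l => emb (.inr l)) ex) l
  | .seq _ q, emb, ex, .inr l => code q (fun l => emb (.inr l)) ex l
  | .loop k go body, emb, ex, .inl _ =>
    .pop (some k) (fun _ o => o) (.goto fun o =>
      entry (body o) (fun l => emb (.inr ⟨o, l⟩)) (bif go o then emb (.inl ()) else ex))
  | .loop _ go body, emb, ex, .inr ⟨o, l⟩ =>
    code (body o) (fun l => emb (.inr ⟨o, l⟩)) (bif go o then emb (.inl ()) else ex) l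

/-- The stacks of the machine: those of the program, and the output. -/
def contents (S : Store K G) (out : List Bool) : (k : Option K) → List (Alph K G k)
  | none => out
  | some k => S k

variable [DecidableEq K]

theorem update_contents (S : Store K G) (out : List Bool) (k : K) (l : List G) :
    Function.update (β := fun k => List (Alph K G k)) (contents S out) (some k) l =
      contents (Function.update S k l) out := by
  funext k'
  cases k' with
  | none => exact Function.update_of_ne (by simp) _ _
  | some k' =>
    by_cases h : k' = k
    · subst h
      refine (Function.update_self _ _ _).trans ?_
      exact (Function.update_self (β := fun _ => List G) _ _ _).symm
    · refine (Function.update_of_ne (by simpa using h) _ _).trans ?_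
      exact (Function.update_of_ne (β := fun _ => List G) h _ _).symm

/-- `Within f t a b`: iterating the partial function `f` leads from `a` to `b` in at most `t`
steps. -/
def Within {α : Type} (f : α → Option α) (t : ℕ) (a b : α) : Prop :=
  ∃ s ≤ t, (flip bind f)^[s] (some a) = some b

theorem Within.refl {α : Type} (f : α → Option α) (a : α) : Within f 0 a a := ⟨0, le_rfl, rfl⟩

theorem Within.trans {α : Type} {f : α → Option α} {t₁ t₂ : ℕ} {a b c : α}
    (h₁ : Within f t₁ a b) (h₂ : Within f t₂ b c) : Within f (t₁ + t₂) a c := by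
  obtain ⟨s₁, hs₁, h₁⟩ := h₁
  obtain ⟨s₂, hs₂, h₂⟩ := h₂
  refine ⟨s₂ + s₁, by omega, ?_⟩
  rw [Function.iterate_add_apply, h₁, h₂]

theorem Within.mono {α : Type} {f : α → Option α} {t t' : ℕ} {a b : α}
    (h : Within f t a b) (ht : t ≤ t') : Within f t' a b := by
  obtain ⟨s, hs, h⟩ := h
  exact ⟨s, hs.trans ht, h⟩

theorem Within.single {α : Type} {f : α → Option α} {a b : α} (h : f a = some b) :
    Within f 1 a b := ⟨1, le_rfl, h⟩

theorem within_step {M : Λ → Turing.TM2.Stmt (Alph K G) Λ (Option G)} {l : Λ}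
    {q : Turing.TM2.Stmt (Alph K G) Λ (Option G)} {v : Option G}
    {S : (k : Option K) → List (Alph K G k)} {c : Turing.TM2.Cfg (Alph K G) Λ (Option G)}
    (hM : M l = q) (hc : Turing.TM2.stepAux q v S = c) :
    Within (Turing.TM2.step M) 1 ⟨some l, v, S⟩ c :=
  Within.single (by rw [Turing.TM2.step, hM, hc])

/-- The machine code of a program simulates the program. -/
theorem Run.within {p : Prog K G} {S S' : Store K G} {t : ℕ} (h : Run p S S' t)
    (M : Λ → Turing.TM2.Stmt (Alph K G) Λ (Option G)) (out : List Bool) :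
    ∀ (emb : Lab p → Λ) (ex : Λ), (∀ l, M (emb l) = code p emb ex l) → ∀ v, ∃ v',
      Within (Turing.TM2.step M) t ⟨some (entry p emb ex), v, contents S out⟩
        ⟨some ex, v', contents S' out⟩ := by
  induction h with
  | skip S =>
    intro emb ex _ v
    exact ⟨v, Within.refl _ _⟩
  | push k a S =>
    intro emb ex hM v
    refine ⟨v, within_step (hM ()) ?_⟩
    rw [← update_contents]
    rfl
  | @seq p q S S₁ S₂ t₁ t₂ _ _ ih₁ ih₂ =>
    intro emb ex hM v
    obtain ⟨v₁, h₁⟩ := ih₁ (fun l => emb (.inl l)) (entry q (fun l => emb (.inr l)) ex)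
      (fun l => hM (.inl l)) v
    obtain ⟨v₂, h₂⟩ := ih₂ (fun l => emb (.inr l)) ex (fun l => hM (.inr l)) v₁
    exact ⟨v₂, h₁.trans h₂⟩
  | @loop_exit k go body S S' t hgo _ ih =>
    intro emb ex hM v
    -- The return label compiled into a loop body already depends on the popped symbol; since `go`
    -- is false here, it is the exit `ex`.
    obtain ⟨v₁, h₁⟩ := ih (fun l => emb (.inr ⟨_, l⟩)) ex
      (fun l => (hM (.inr ⟨_, l⟩)).trans (by simp only [code, hgo, cond_false])) (S k).head?
    refine ⟨v₁, ((within_step (hM (.inl ())) ?_).trans h₁).mono (by omega)⟩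
    rw [← update_contents]
    refine Eq.trans (b := ⟨some (entry (body (S k).head?) (fun l => emb (.inr ⟨_, l⟩))
      (bif go (S k).head? then emb (.inl ()) else ex)), (S k).head?, _⟩) rfl ?_
    rw [hgo]
    rfl
  | @loop_next k go body S S₁ S₂ t₁ t₂ hgo _ _ ih₁ ih₂ =>
    intro emb ex hM v
    obtain ⟨v₁, h₁⟩ := ih₁ (fun l => emb (.inr ⟨_, l⟩)) (emb (.inl ()))
      (fun l => (hM (.inr ⟨_, l⟩)).trans (by simp only [code, hgo, cond_true])) (S k).head?
    obtain ⟨v₂, h₂⟩ := ih₂ emb ex hM v₁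
    refine ⟨v₂, (((within_step (hM (.inl ())) ?_).trans h₁).trans h₂).mono (by omega)⟩
    rw [← update_contents]
    refine Eq.trans (b := ⟨some (entry (body (S k).head?) (fun l => emb (.inr ⟨_, l⟩))
      (bif go (S k).head? then emb (.inl ()) else ex)), (S k).head?, _⟩) rfl ?_
    rw [hgo]
    rfl
  | mono _ ht ih =>
    intro emb ex hM v
    obtain ⟨v₁, h₁⟩ := ih emb ex hM v
    exact ⟨v₁, h₁.mono ht⟩

open Classical in
/-- The machine that executes the program `p`, starting with its input on the stack `k`, and then
outputs whether stack `k` has a top that satisfies `acc`. -/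
noncomputable def machine [Fintype K] [Fintype G] (p : Prog K G) (k : K) (acc : G → Bool) :
    Turing.FinTM2 where
  K := Option K
  k₀ := some k
  k₁ := none
  Γ := Alph K G
  Λ := Option (Lab p)
  main := entry p some none
  ΛFin := Fintype.ofFinite _
  σ := Option G
  initialState := none
  Γk₀Fin := inferInstanceAs (Fintype G)
  m
    | some l => code p some none l
    | none => .pop (some k) (fun _ o => o) (.push none (fun o => o.any acc)
        (.load (fun _ => none) .halt))

/-- The machine as a machine with input alphabet `G`. -/
noncomputable def machineAux [Fintype K] [Fintype G] (p : Prog K G) (k : K) (acc : G → Bool) :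
    Turing.TM2ComputableAux G Bool where
  tm := machine p k acc
  inputAlphabet := Equiv.refl G
  outputAlphabet := Equiv.refl Bool

/-- If `p` reduces the stacks to a single symbol, then the machine outputs whether this symbol
is accepted. -/
theorem machineAux_outputs [Fintype K] [Fintype G] {p : Prog K G} {k : K} (acc : G → Bool)
    {w : List G} {a : G} {t : ℕ}
    (h : Run p (Function.update (fun _ => []) k w) (Function.update (fun _ => []) k [a]) t) :
    Nonempty (Turing.TM2OutputsInTime (machineAux p k acc).tm
      (w.map (machineAux p k acc).inputAlphabet.symm)
      (some ([acc a].map (machineAux p k acc).outputAlphabet.symm)) (t + 1)) := by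
  obtain ⟨v, s, hs, hv⟩ := h.within (machine p k acc).m [] some none (fun l => rfl) none
  have h₀ : Turing.initList (machineAux p k acc).tm
      (w.map (machineAux p k acc).inputAlphabet.symm) =
      ⟨some (entry p some none), none, contents (Function.update (fun _ => []) k w) []⟩ := by
    unfold Turing.initList
    congr 1
    funext k'
    cases k' with
    | none => rfl
    | some k' =>
      by_cases hk : k' = k
      · subst hk
        simp [contents, machineAux, machine]
        exact List.map_id w
      · simp [contents, machineAux, machine, hk]
        rfl
  -- A halting configuration must have empty stacks apart from the output and the initial register,
  -- which is why the final statement pops the symbol and loads `none`.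
  have h₁ : Turing.haltList (machineAux p k acc).tm
      ([acc a].map (machineAux p k acc).outputAlphabet.symm) =
      ⟨none, none, contents (fun _ => []) [acc a]⟩ := by
    unfold Turing.haltList
    congr 1
    funext k'
    cases k' with
    | none => rfl
    | some k' => rfl
  have h₂ : Turing.TM2.stepAux ((machine p k acc).m none) v
      (contents (Function.update (fun _ => []) k [a]) []) =
      ⟨none, none, contents (fun _ => []) [acc a]⟩ := by
    refine Eq.trans (b := ⟨none, none, Function.update (β := fun k => List (Alph K G k))
      (Function.update (β := fun k => List (Alph K G k))
        (contents (Function.update (fun _ => []) k [a]) []) (some k)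
        (Function.update (fun _ => []) k [a] k).tail) none
        [(Function.update (fun _ => []) k [a] k).head?.any acc]⟩) rfl ?_
    rw [update_contents]
    simp only [Function.update_self, Function.update_idem, List.tail_cons, List.head?_cons,
      Option.any_some]
    congr 1
    funext k'
    cases k' with
    | none => rfl
    | some k' =>
      refine (Function.update_of_ne (by simp) _ _).trans ?_
      by_cases hk : k' = k
      · subst hk
        simp [contents]
        rfl
      · simp [contents, hk]
        rfl
  obtain ⟨s', hs', hv'⟩ := Within.trans ⟨s, hs, hv⟩ (within_step rfl h₂)
  refine ⟨⟨⟨s', ?_⟩, hs'⟩⟩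
  rw [h₀]
  simp only [Option.map_some, h₁]
  exact hv'

end Compile

/-! ### Derived commands -/

section Derived
variable {K G : Type}

/-- Pop the symbols of stack `k` until it is empty, executing `f a` for every symbol `a`. -/
def whileNE (k : K) (f : G → Prog K G) : Prog K G :=
  .loop k Option.isSome fun o => match o with
    | none => .skip
    | some a => f a

/-- Pop the symbols of stack `k` up to the first one with `isEnd`, executing `f a` for every
symbol `a` before that. -/
def untl (k : K) (isEnd : G → Bool) (f : G → Prog K G) : Prog K G :=
  .loop k (fun o => o.any fun a => !isEnd a) fun o => match o with
    | none => .skip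
    | some a => if isEnd a then .skip else f a

/-- Pop a symbol `a` of stack `k` and execute `f a`. -/
def popc (k : K) (f : G → Prog K G) : Prog K G :=
  .loop k (fun _ => false) fun o => match o with
    | none => .skip
    | some a => f a

/-- Remove all symbols from stack `k`. -/
def clear (k : K) : Prog K G := whileNE k fun _ => .skip

variable [DecidableEq K]

theorem Run.to {p : Prog K G} {S S' S'' : Store K G} {t t' : ℕ} (h : Run p S S' t)
    (hS : S' = S'') (ht : t ≤ t') : Run p S S'' t' := hS ▸ h.mono ht

theorem Run.cast {p : Prog K G} {S S₀ S' S₁ : Store K G} {t t' : ℕ} (h : Run p S S' t)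
    (h₀ : S₀ = S) (h₁ : S' = S₁) (ht : t ≤ t') : Run p S₀ S₁ t' := by
  subst h₀
  exact h.to h₁ ht

theorem run_whileNE_nil {k : K} {f : G → Prog K G} {S : Store K G} (hS : S k = []) :
    Run (whileNE k f) S S 1 := by
  have h : Function.update S k [] = S := by rw [← hS, Function.update_eq_self]
  refine (Run.loop_exit (S' := S) (t := 0) (by simp [hS]) ?_).to rfl (by simp)
  rw [hS]
  simp only [List.head?_nil, List.tail_nil, h]
  exact .skip _

theorem run_whileNE_cons {k : K} {f : G → Prog K G} {S S₁ S₂ : Store K G} {a : G} {l : List G}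
    {t₁ t₂ : ℕ} (hS : S k = a :: l) (h₁ : Run (f a) (Function.update S k l) S₁ t₁)
    (h₂ : Run (whileNE k f) S₁ S₂ t₂) : Run (whileNE k f) S S₂ (t₁ + t₂ + 1) := by
  refine Run.loop_next (by simp [hS]) ?_ h₂
  rw [hS]
  exact h₁

/-- The loop rule: `I d t` is the store when the items `d` have been processed, the latest one
first, and `t` remain. Items live in an arbitrary type `α`, so that they can carry more than the
symbol `g a`, such as a second bit or a length bound. The final `1` pays for the attempt to pop the
empty stack. -/
theorem run_whileNE {α : Type} {k : K} {f : G → Prog K G} (g : α → G)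
    (I : List α → List α → Store K G) (c : ℕ) (hI : ∀ d t, I d t k = t.map g)
    (hf : ∀ d a t, Run (f (g a)) (Function.update (I d (a :: t)) k (t.map g)) (I (a :: d) t) c)
    (l : List α) : Run (whileNE k f) (I [] l) (I l.reverse []) (l.length * (c + 1) + 1) := by
  suffices ∀ d, Run (whileNE k f) (I d l) (I (l.reverse ++ d) []) (l.length * (c + 1) + 1) by
    simpa using this []
  induction l with
  | nil => exact fun d => (run_whileNE_nil (by simp [hI])).to (by simp) (by simp)
  | cons a l ih =>
    intro d
    exact (run_whileNE_cons (by rw [hI, List.map_cons]) (hf d a l) (ih _)).to (by simp)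
      (by simp only [List.length_cons]; ring_nf; omega)

/-- The same rule for a block with end marker `z`; the marker is consumed, so `rest` is left on the
stack. -/
theorem run_untl {α : Type} {k : K} {isEnd : G → Bool} {f : G → Prog K G} (g : α → G)
    (I : List α → List α → Store K G) (c : ℕ) {z : G} {rest : List G}
    (hI : ∀ d t, I d t k = t.map g ++ z :: rest) (hz : isEnd z = true)
    (hf : ∀ d a t, isEnd (g a) = false → Run (f (g a))
      (Function.update (I d (a :: t)) k (t.map g ++ z :: rest)) (I (a :: d) t) c)
    (l : List α) (hl : ∀ a ∈ l, isEnd (g a) = false) :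
    Run (untl k isEnd f) (I [] l) (Function.update (I l.reverse []) k rest)
      (l.length * (c + 1) + 1) := by
  suffices ∀ d, Run (untl k isEnd f) (I d l) (Function.update (I (l.reverse ++ d) []) k rest)
      (l.length * (c + 1) + 1) by
    simpa using this []
  induction l with
  | nil =>
    intro d
    refine (Run.loop_exit (S' := Function.update (I d []) k rest) (t := 0)
      (by simp [hI, hz]) ?_).to (by simp) (by simp)
    rw [hI]
    simp only [List.map_nil, List.nil_append, List.head?_cons, List.tail_cons, hz, if_true]
    exact .skip _
  | cons a l ih =>
    intro d
    have ha := hl a (by simp)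
    refine (Run.loop_next (S₁ := I (a :: d) l) (t₁ := c) (by simp [hI, ha]) ?_
      (ih (fun b hb => hl b (by simp [hb])) _)).to (by simp)
      (by simp only [List.length_cons]; ring_nf; omega)
    have := hf d a l ha
    rw [hI]
    simpa [ha] using this

theorem run_popc {k : K} {f : G → Prog K G} {S S' : Store K G} {a : G} {l : List G} {t : ℕ}
    (hS : S k = a :: l) (h : Run (f a) (Function.update S k l) S' t) :
    Run (popc k f) S S' (t + 1) := by
  refine Run.loop_exit rfl ?_
  rw [hS]
  exact h

theorem Run.pushSeq {k : K} {a : G} {q : Prog K G} {S S' : Store K G} {t : ℕ}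
    (h : Run q (Function.update S k (a :: S k)) S' t) : Run (.seq (.push k a) q) S S' (t + 1) :=
  ((Run.push k a S).seq h).mono (by omega)

/-- Moving a word between stacks reverses it, hence the reversals in all later specifications, and
the double moves where the order has to be kept. -/
theorem run_mv {α : Type} {k k' : K} (hk : k ≠ k') {h : G → G} {S : Store K G} (g : α → G)
    (l : List α) (hS : S k = l.map g) :
    Run (whileNE k fun a => .push k' (h a)) S
      (Function.update (Function.update S k []) k' ((l.map fun a => h (g a)).reverse ++ S k'))
      (2 * l.length + 1) := by
  have key := run_whileNE (k := k) (f := fun a => Prog.push k' (h a)) g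
    (fun d t => Function.update (Function.update S k (t.map g)) k'
      (d.map (fun a => h (g a)) ++ S k')) 1 (fun d t => by simp [hk]) (fun d a t => by
    convert Run.push (G := G) k' (h (g a)) _ using 1
    funext i
    by_cases h1 : i = k'
    · subst h1
      simp [hk.symm]
    · by_cases h2 : i = k
      · subst h2; simp [hk, hk.symm]
      · simp [h1, h2, hk.symm]) l
  have h0 : Function.update (Function.update S k (l.map g)) k'
      (([] : List α).map (fun a => h (g a)) ++ S k') = S := by
    simp [← hS]
  rw [h0] at key
  exact key.to (by simp) (by omega)

theorem run_mvUntil {α : Type} {k k' : K} (hk : k ≠ k') {isEnd : G → Bool} {h : G → G}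
    {S : Store K G} (g : α → G) (l : List α) {z : G} {rest : List G}
    (hS : S k = l.map g ++ z :: rest) (hz : isEnd z = true) (hl : ∀ a ∈ l, isEnd (g a) = false) :
    Run (untl k isEnd fun a => .push k' (h a)) S
      (Function.update (Function.update S k rest) k' ((l.map fun a => h (g a)).reverse ++ S k'))
      (2 * l.length + 1) := by
  have key := run_untl (k := k) (isEnd := isEnd) (rest := rest) (f := fun a => Prog.push k' (h a)) g
    (fun d t => Function.update (Function.update S k (t.map g ++ z :: rest)) k'
      (d.map (fun a => h (g a)) ++ S k')) 1 (fun d t => by simp [hk]) hz (fun d a t _ => by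
    convert Run.push (G := G) k' (h (g a)) _ using 1
    funext i
    by_cases h1 : i = k'
    · subst h1
      simp [hk.symm]
    · by_cases h2 : i = k
      · subst h2; simp [hk, hk.symm]
      · simp [h1, h2, hk.symm]) l hl
  have h0 : Function.update (Function.update S k (l.map g ++ z :: rest)) k'
      (([] : List α).map (fun a => h (g a)) ++ S k') = S := by
    simp [← hS]
  rw [h0] at key
  refine key.to ?_ (by omega)
  funext i
  by_cases h1 : i = k'
  · subst h1
    simp [hk.symm]
  · by_cases h2 : i = k <;> simp [h1, h2, hk]

theorem run_clear {k : K} (S : Store K G) :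
    Run (clear k) S (Function.update S k []) ((S k).length + 1) := by
  have key := run_whileNE (k := k) (f := fun _ => Prog.skip) id
    (fun _ t => Function.update S k t) 0 (fun d t => by simp)
    (fun d a t => by simpa using Run.skip _) (S k)
  rw [Function.update_eq_self] at key
  exact key.to rfl (by omega)

end Derived

/-! ### The stacks of the model checker -/

/-- The stacks: the formula to the right (`R`) and to the left (`L`) of the current position,
values (`V`), environment (`E`), control (`C`), transition system (`S`), and auxiliary ones. -/
inductive Stk
  | R | L | V | E | C | S | T | U | W | X
  deriving DecidableEq

instance : Fintype Stk :=
  ⟨{.R, .L, .V, .E, .C, .S, .T, .U, .W, .X}, fun k => by cases k <;> decide⟩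

variable {P A : Type}

/-- The store with the given stacks. -/
def st (r l v e c s t u w x : List (Symb P A)) : Store Stk (Symb P A)
  | .R => r
  | .L => l
  | .V => v
  | .E => e
  | .C => c
  | .S => s
  | .T => t
  | .U => u
  | .W => w
  | .X => x

section Update
variable (r l v e c s t u w x y : List (Symb P A))

@[simp] theorem st_R : st r l v e c s t u w x .R = r := rfl
@[simp] theorem st_L : st r l v e c s t u w x .L = l := rfl
@[simp] theorem st_V : st r l v e c s t u w x .V = v := rfl
@[simp] theorem st_E : st r l v e c s t u w x .E = e := rfl
@[simp] theorem st_C : st r l v e c s t u w x .C = c := rfl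
@[simp] theorem st_S : st r l v e c s t u w x .S = s := rfl
@[simp] theorem st_T : st r l v e c s t u w x .T = t := rfl
@[simp] theorem st_U : st r l v e c s t u w x .U = u := rfl
@[simp] theorem st_W : st r l v e c s t u w x .W = w := rfl
@[simp] theorem st_X : st r l v e c s t u w x .X = x := rfl

@[simp] theorem update_R :
    Function.update (st r l v e c s t u w x) .R y = st y l v e c s t u w x := by
  funext k; cases k <;> simp
@[simp] theorem update_L :
    Function.update (st r l v e c s t u w x) .L y = st r y v e c s t u w x := by
  funext k; cases k <;> simp
@[simp] theorem update_V :
    Function.update (st r l v e c s t u w x) .V y = st r l y e c s t u w x := by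
  funext k; cases k <;> simp
@[simp] theorem update_E :
    Function.update (st r l v e c s t u w x) .E y = st r l v y c s t u w x := by
  funext k; cases k <;> simp
@[simp] theorem update_C :
    Function.update (st r l v e c s t u w x) .C y = st r l v e y s t u w x := by
  funext k; cases k <;> simp
@[simp] theorem update_S :
    Function.update (st r l v e c s t u w x) .S y = st r l v e c y t u w x := by
  funext k; cases k <;> simp
@[simp] theorem update_T :
    Function.update (st r l v e c s t u w x) .T y = st r l v e c s y u w x := by
  funext k; cases k <;> simp
@[simp] theorem update_U :
    Function.update (st r l v e c s t u w x) .U y = st r l v e c s t y w x := by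
  funext k; cases k <;> simp
@[simp] theorem update_W :
    Function.update (st r l v e c s t u w x) .W y = st r l v e c s t u y x := by
  funext k; cases k <;> simp
@[simp] theorem update_X :
    Function.update (st r l v e c s t u w x) .X y = st r l v e c s t u w y := by
  funext k; cases k <;> simp

end Update

/-! ### Symbols -/

/-- Truth values as symbols. -/
def bit : Bool → Symb P A
  | true => .var
  | false => .pr

/-- The symbols for numbers in stacks that end a block. -/
def isFin : Symb P A → Bool
  | .fin => true
  | _ => false

/-- The symbols that mark the beginning of a repeated part of the formula. -/
def isState : Symb P A → Bool
  | .state _ => true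
  | _ => false

/-- The symbols that mark the end of a repeated part of the formula. -/
def isEdge : Symb P A → Bool
  | .edge _ => true
  | _ => false

/-- The truth value that a symbol stands for. -/
def isTrue : Symb P A → Bool
  | .var => true
  | _ => false

@[simp] theorem isFin_bit (b : Bool) : isFin (bit b : Symb P A) = false := by cases b <;> rfl
@[simp] theorem isFin_fin : isFin (.fin : Symb P A) = true := rfl
@[simp] theorem isFin_tick : isFin (.tick : Symb P A) = false := rfl
@[simp] theorem isTrue_bit (b : Bool) : isTrue (bit b : Symb P A) = b := by cases b <;> rfl

/-- A word of bits on a stack. -/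
def bits (x : List Bool) : List (Symb P A) := x.map bit

@[simp] theorem bits_append (x y : List Bool) :
    (bits (x ++ y) : List (Symb P A)) = bits x ++ bits y := List.map_append
@[simp] theorem bits_length (x : List Bool) : (bits x : List (Symb P A)).length = x.length :=
  List.length_map _
@[simp] theorem bits_nil : (bits [] : List (Symb P A)) = [] := rfl
@[simp] theorem bits_cons (b : Bool) (x : List Bool) :
    (bits (b :: x) : List (Symb P A)) = bit b :: bits x := rfl
theorem bits_reverse (x : List Bool) : (bits x.reverse : List (Symb P A)) = (bits x).reverse :=
  List.map_reverse

/-- The words of an environment as the contents of a stack. -/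
def encEnv (η : List (List Bool)) : List (Symb P A) := η.flatMap fun x => bits x ++ [.fin]

@[simp] theorem encEnv_nil : (encEnv [] : List (Symb P A)) = [] := rfl
@[simp] theorem encEnv_cons (x : List Bool) (η : List (List Bool)) :
    (encEnv (x :: η) : List (Symb P A)) = bits x ++ .fin :: encEnv η := by simp [encEnv]
@[simp] theorem encEnv_append (η θ : List (List Bool)) :
    (encEnv (η ++ θ) : List (Symb P A)) = encEnv η ++ encEnv θ := by simp [encEnv]

theorem encEnv_length_le (η : List (List Bool)) (b : ℕ) (h : ∀ x ∈ η, x.length ≤ b) :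
    (encEnv η : List (Symb P A)).length ≤ η.length * (b + 1) := by
  induction η with
  | nil => simp
  | cons x η ih =>
    have h1 := ih fun y hy => h y (by simp [hy])
    have h2 := h x (by simp)
    simp only [encEnv_cons, List.length_append, bits_length, List.length_cons]
    nlinarith

infixr:60 " ;; " => Prog.seq

/-- Programs of the model checker. -/
abbrev Pg (P A : Type) := Prog Stk (Symb P A)

/-! ### Moving words of bits -/

section Move
variable {k k' : Stk}

theorem run_mvBits (hk : k ≠ k') {S : Store Stk (Symb P A)} (x : List Bool)
    {rest : List (Symb P A)} (hS : S k = bits x ++ .fin :: rest) :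
    Run (untl k isFin fun a => .push k' a) S
      (Function.update (Function.update S k rest) k' (bits x.reverse ++ S k'))
      (2 * x.length + 1) := by
  have := run_mvUntil hk (isEnd := isFin) (h := id) bit x hS rfl (by simp)
  simpa [bits] using this

theorem run_mvAllBits (hk : k ≠ k') {S : Store Stk (Symb P A)} (x : List Bool)
    (hS : S k = bits x) :
    Run (whileNE k fun a => .push k' a) S
      (Function.update (Function.update S k []) k' (bits x.reverse ++ S k'))
      (2 * x.length + 1) := by
  have := run_mv hk (h := id) bit x hS
  simpa [bits] using this

theorem run_mvAll (hk : k ≠ k') {S : Store Stk (Symb P A)} :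
    Run (whileNE k fun a => .push k' a) S
      (Function.update (Function.update S k []) k' ((S k).reverse ++ S k'))
      (2 * (S k).length + 1) := by
  have := run_mv hk (S := S) (h := id) id (S k) (by simp)
  simpa using this

theorem run_dropBits {S : Store Stk (Symb P A)} (x : List Bool)
    {rest : List (Symb P A)} (hS : S k = bits x ++ .fin :: rest) :
    Run (untl k isFin fun _ => .skip) S (Function.update S k rest) (x.length + 1) := by
  have key := run_untl (k := k) (isEnd := isFin) (rest := rest) (z := .fin) (f := fun _ => Prog.skip) bit
    (fun _ t => Function.update S k (t.map bit ++ .fin :: rest)) 0 (fun d t => by simp) rfl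
    (fun d a t _ => by simpa using Run.skip _) x (by simp)
  have h0 : Function.update S k (x.map bit ++ .fin :: rest) = S := by
    conv_rhs => rw [← Function.update_eq_self k S]
    rw [hS]
    rfl
  rw [h0] at key
  exact key.to (by simp) (by omega)

end Move

/-! ### The environment -/

/-- Read a number `i` on `R`, and move the first `i` words of the environment to `T`. -/
def access : Pg P A :=
  (untl .R isFin fun a => .push .L a ;; (untl .E isFin fun b => .push .T b) ;; .push .T .fin) ;;
    .push .L .fin

/-- Move the words of the environment back from `T`. -/
def restoreEnv : Pg P A := whileNE .T fun b => .push .E b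

/-- The words in front of the wanted one arrive on `T` in reverse, end markers included; moving them
back in `restoreEnv` reverses them again. -/
theorem run_access (η θ : List (List Bool)) (b : ℕ) (h : ∀ x ∈ η, x.length ≤ b)
    (r l v c s u w x : List (Symb P A)) :
    Run access (st (encodeNum η.length ++ r) l v (encEnv (η ++ θ)) c s [] u w x)
      (st r ((encodeNum η.length).reverse ++ l) v (encEnv θ) c s (encEnv η).reverse u w x)
      (η.length * (2 * b + 5) + 2) := by
  have key := run_untl (k := Stk.R) (isEnd := isFin) (rest := r) (z := .fin)
    (f := fun a : Symb P A => .push .L a ;; (untl .E isFin fun b => .push .T b) ;;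
      -- The items of the loop are the words passed over, one for each unit of the number; the
      -- subtype makes the cost of a round uniform.
      .push .T .fin) (fun _ : {x : List Bool // x.length ≤ b} => .tick)
    (fun d t => st (List.replicate t.length .tick ++ .fin :: r)
      (List.replicate d.length .tick ++ l) v (encEnv (t.map (·.1) ++ θ)) c s
      (encEnv (d.reverse.map (·.1))).reverse u w x) (2 * b + 3) (fun d t => by simp) rfl
    (fun d a t _ => ?_) (η.attachWith _ h) (by simp)
  · refine Run.cast (Run.seq (key.to rfl le_rfl) (.push _ _ _)) ?_ ?_ ?_
    · simp [encodeNum]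
    · simp [encodeNum]
    · simp only [List.length_attachWith]
      linarith
  · have h1 := run_mvBits (P := P) (A := A) (k := .E) (k' := .T) (by decide) a.1
      (S := st (List.replicate t.length .tick ++ .fin :: r)
      (List.replicate (d.length + 1) .tick ++ l) v (encEnv ((a :: t).map (·.1) ++ θ)) c s
      (encEnv (d.reverse.map (·.1))).reverse u w x) (rest := encEnv (t.map (·.1) ++ θ))
      (by simp)
    have h0 := Run.push (K := Stk) .L (.tick : Symb P A)
      (st (List.replicate t.length .tick ++ .fin :: r)
      (List.replicate d.length .tick ++ l) v (encEnv ((a :: t).map (·.1) ++ θ)) c s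
      (encEnv (d.reverse.map (·.1))).reverse u w x)
    simp only [update_L, st_L, ← List.cons_append, ← List.replicate_succ] at h0
    refine (Run.seq (by simpa using h0) (h1.seq (.push _ _ _))).to ?_ ?_
    · simp [bits_reverse]
    · have := a.2
      omega

theorem run_restoreEnv (η θ : List (List Bool)) (b : ℕ) (h : ∀ x ∈ η, x.length ≤ b)
    (r l v c s u w x : List (Symb P A)) :
    Run restoreEnv (st r l v (encEnv θ) c s (encEnv η).reverse u w x)
      (st r l v (encEnv (η ++ θ)) c s [] u w x) (2 * (η.length * (b + 1)) + 1) := by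
  refine (run_mvAll (by decide)).to (by simp) ?_
  have := encEnv_length_le (P := P) (A := A) η b h
  simp only [st_T, List.length_reverse]
  omega

/-- Push the value of the variable whose number is read. -/
def varV : Pg P A :=
  access ;; .push .V .fin ;; (untl .E isFin fun b => .push .U b) ;; .push .E .fin ;;
    (whileNE .U fun b => .push .V b ;; .push .E b) ;; restoreEnv

theorem run_varV (η θ : List (List Bool)) (y : List Bool) (b : ℕ)
    (h : ∀ x ∈ η, x.length ≤ b) (hy : y.length ≤ b) (r l v c s w x : List (Symb P A)) :
    Run varV (st (encodeNum η.length ++ r) l v (encEnv (η ++ y :: θ)) c s [] [] w x)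
      (st r ((encodeNum η.length).reverse ++ l) (bits y ++ .fin :: v) (encEnv (η ++ y :: θ))
        c s [] [] w x) (η.length * (4 * b + 7) + 5 * b + 10) := by
  have h1 := run_access (P := P) (A := A) η (y :: θ) b h r l v c s [] w x
  have h2 := run_mvBits (P := P) (A := A) (k := .E) (k' := .U) (by decide) y
    (S := st r ((encodeNum η.length).reverse ++ l) (.fin :: v) (encEnv (y :: θ)) c s
      (encEnv η).reverse [] w x) (rest := encEnv θ) (by simp)
  have h3 := run_whileNE (k := Stk.U) (f := fun b : Symb P A => .push .V b ;; .push .E b) bit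
    (fun d t => st r ((encodeNum η.length).reverse ++ l) (bits d ++ .fin :: v)
      (bits d ++ .fin :: encEnv θ) c s (encEnv η).reverse (bits t) w x) 2 (fun d t => rfl)
    (fun d a t => ((Run.push _ _ _).seq (.push _ _ _)).to (by simp [bits]) (by omega)) y.reverse
  have h4 := run_restoreEnv (P := P) (A := A) η (y :: θ) b h r
    ((encodeNum η.length).reverse ++ l) (bits y ++ .fin :: v) c s [] w x
  refine (h1.seq ((Run.push _ _ _).seq (Run.seq (by simpa using h2) ((Run.push _ _ _).seq
    (Run.seq (by simpa using h3) (by simpa using h4)))))).to rfl ?_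
  linarith

/-! ### Boolean operations and function application -/

/-- Complement the topmost value. -/
def negV : Pg P A :=
  (untl .V isFin fun a => .push .U (bit !isTrue a)) ;; .push .V .fin ;;
    whileNE .U fun a => .push .V a

theorem run_negV (y : List Bool) (r l v e c s t w x : List (Symb P A)) :
    Run negV (st r l (bits y ++ .fin :: v) e c s t [] w x)
      (st r l (bits (y.map not) ++ .fin :: v) e c s t [] w x) (4 * y.length + 3) := by
  have h1 := run_mvUntil (k := Stk.V) (k' := .U) (by decide) (isEnd := isFin)
    (h := fun a => bit !isTrue a) (S := st r l (bits y ++ .fin :: v) e c s t [] w x) bit y rfl rfl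
    (by simp)
  have h2 := run_mvAllBits (k := Stk.U) (k' := .V) (by decide) (y.map not).reverse
    (S := st r l (.fin :: v) e c s t (bits (y.map not).reverse) w x) rfl
  refine (h1.seq (Run.seq (.push _ _ _) (Run.cast h2 ?_ rfl le_rfl))).to ?_ ?_
  · simp [bits, Function.comp_def]
  · simp
  · simp only [List.length_reverse, List.length_map]
    omega

/-- Form the union of the two topmost values. -/
def orV : Pg P A :=
  (untl .V isFin fun a => .push .T a) ;; (untl .V isFin fun a => .push .U a) ;;
    .push .V .fin ;; whileNE .T fun a => popc .U fun b => .push .V (bit (isTrue a || isTrue b))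

theorem run_orV (y z : List Bool) (hyz : y.length = z.length)
    (r l v e c s w x : List (Symb P A)) :
    Run orV (st r l (bits z ++ .fin :: (bits y ++ .fin :: v)) e c s [] [] w x)
      (st r l (bits (List.zipWith or y z) ++ .fin :: v) e c s [] [] w x)
      (7 * y.length + 4) := by
  have h1 := run_mvBits (k := Stk.V) (k' := .T) (by decide) z
    (S := st r l (bits z ++ .fin :: (bits y ++ .fin :: v)) e c s [] [] w x) rfl
  have h2 := run_mvBits (k := Stk.V) (k' := .U) (by decide) y
    (S := st r l (bits y ++ .fin :: v) e c s (bits z.reverse) [] w x) rfl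
  have key := run_whileNE (k := Stk.T)
    (f := fun a : Symb P A => popc .U fun b => .push .V (bit (isTrue a || isTrue b)))
    (fun p : Bool × Bool => bit p.2)
    (fun d t => st r l (bits (d.map fun p => p.1 || p.2) ++ .fin :: v) e c s
      (t.map fun p => bit p.2) (bits (t.map (·.1))) w x) 2 (fun d t => rfl)
    (fun d a t => by
      refine Run.to (run_popc (a := bit a.1) (l := bits (t.map (·.1))) rfl (.push _ _ _))
        ?_ le_rfl
      simp [Bool.or_comm]) (y.zip z).reverse
  refine (h1.seq (Run.seq (Run.cast h2 ?_ rfl le_rfl) (Run.seq (.push _ _ _)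
    (Run.cast key ?_ rfl le_rfl)))).to ?_ ?_
  · simp
  · have e1 : (y.zip z).map Prod.fst = y := List.map_fst_zip hyz.le
    have e2 : (y.zip z).map (fun p => (bit p.2 : Symb P A)) = bits z := by
      rw [bits, ← List.map_snd_zip (l₁ := y) (l₂ := z) hyz.ge, List.map_map]
      rw [List.map_snd_zip hyz.ge]
      rfl
    simp [e1, e2, bits_reverse, List.map_reverse]
  · simp [List.zip, List.map_zipWith]
  · simp only [List.length_reverse, List.length_zip]
    omega

/-- Keep one half of the word on `U`. -/
def halve (b : Bool) : Pg P A :=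
  (whileNE .U fun a => .push .W a ;; popc .U fun a => .push .W a ;; .push .X .tick) ;;
    (whileNE .X fun _ => popc .W fun a => .push .U a) ;; (bif b then clear .W else clear .U) ;;
    whileNE .W fun a => .push .U a

/-- One half of a word. -/
def half (g : List Bool) (b : Bool) : List Bool :=
  bif b then g.drop (g.length / 2) else g.take (g.length / 2)

/-- The symbols are moved in pairs with one tick per pair, so `X` ends up holding half the length in
unary. -/
theorem run_halve_split (y : List Bool) (h : ℕ) (hy : y.length = 2 * h)
    (r l v e c s t w x : List (Symb P A)) :
    Run (whileNE .U fun a => .push .W a ;; popc .U fun a => .push .W a ;; .push .X .tick)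
      (st r l v e c s t (bits y) w x)
      (st r l v e c s t [] (bits y.reverse ++ w) (List.replicate h .tick ++ x))
      (5 * h + 1) := by
  induction h generalizing y w x with
  | zero =>
    obtain rfl : y = [] := by simpa using hy
    exact (Run.loop_exit rfl (.skip _)).to (by simp) le_rfl
  | succ h ih =>
    obtain ⟨a, b, y, rfl⟩ : ∃ a b z, y = a :: b :: z := by
      match y, hy with
      | a :: b :: z, _ => exact ⟨a, b, z, rfl⟩
    have h1 := ih y (by simp at hy; omega) (bit b :: bit a :: w) (.tick :: x)
    refine (Run.loop_next (by rfl) (Run.seq (.push _ _ _) (run_popc (a := bit b) (l := bits y)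
      (by simp) (Run.seq (.push _ _ _) (.push _ _ _)))) (Run.cast h1 ?_ rfl le_rfl)).to ?_ ?_
    · simp
    · simp [bits_reverse, List.replicate_succ']
    · omega

/-- The ticks on `X` bring exactly the second half back to `U` and leave the first half on `W`; one
of the two is erased. -/
theorem run_halve (b : Bool) (y : List Bool) (h : ℕ) (hy : y.length = 2 * h)
    (r l v e c s t : List (Symb P A)) :
    Run (halve b) (st r l v e c s t (bits y) [] [])
      (st r l v e c s t (bits (half y b)) [] []) (12 * h + 5) := by
  have h1 := run_halve_split y h hy r l v e c s t [] []
  have h2 := run_whileNE (k := Stk.X) (f := fun _ : Symb P A => popc .W fun a => .push .U a)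
    (fun _ : Bool => .tick)
    (fun d z => st r l v e c s t (bits d) (bits z ++ bits (y.take h).reverse)
      (z.map fun _ => .tick)) 2 (fun d t => rfl)
    (fun d a z => (run_popc (a := bit a) (l := bits z ++ bits (y.take h).reverse) (by simp)
      (.push _ _ _)).to (by simp) le_rfl) (y.drop h).reverse
  have hl : (y.drop h).length = h := by simp [hy]; omega
  have ht : (y.take h).length = h := by simp [hy]; omega
  have hh : y.length / 2 = h := by omega
  rw [show y.reverse = (y.drop h).reverse ++ (y.take h).reverse by
    rw [← List.reverse_append, List.take_append_drop]] at h1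
  have hk : y.length - h = h := by omega
  cases b with
  | true =>
    have h3 := run_clear (k := Stk.W) (st r l v e c s t (bits (y.drop h))
      (bits (y.take h).reverse) [])
    have h4 := run_mvAllBits (P := P) (A := A) (k := Stk.W) (k' := .U) (by decide) []
      (S := st r l v e c s t (bits (y.drop h)) [] []) rfl
    refine (Run.seq h1 (Run.seq (Run.cast h2 ?_ rfl le_rfl) (Run.seq (Run.cast h3 ?_ rfl le_rfl)
      (Run.cast h4 ?_ rfl le_rfl)))).to ?_ ?_
    · simp [hk]
    · simp
    · simp
    · simp [half, hh]
    · simp [ht, hl]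
      omega
  | false =>
    have h3 := run_clear (k := Stk.U) (st r l v e c s t (bits (y.drop h))
      (bits (y.take h).reverse) [])
    have h4 := run_mvAllBits (P := P) (A := A) (k := Stk.W) (k' := .U) (by decide)
      (y.take h).reverse (S := st r l v e c s t [] (bits (y.take h).reverse) []) rfl
    refine (Run.seq h1 (Run.seq (Run.cast h2 ?_ rfl le_rfl) (Run.seq (Run.cast h3 ?_ rfl le_rfl)
      (Run.cast h4 ?_ rfl le_rfl)))).to ?_ ?_
    · simp [hk]
    · simp
    · simp
    · simp [half, hh]
    · simp [ht, hl]
      omega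

/-- The slice of the function table `f` for the argument `x`. -/
def sel (f x : List Bool) : List Bool := (x.reverse.foldl half f.reverse).reverse

/-- Apply the second topmost value to the topmost one. -/
def appV : Pg P A :=
  (untl .V isFin fun a => .push .T a) ;; (untl .V isFin fun a => .push .U a) ;;
    (whileNE .T fun a => bif isTrue a then halve true else halve false) ;; .push .V .fin ;;
      whileNE .U fun a => .push .V a

theorem half_length (g : List Bool) (b : Bool) (m : ℕ) (h : g.length = 2 * m) :
    (half g b).length = m := by
  cases b <;> simp [half, h] <;> omega

theorem foldl_half_length (x g : List Bool) (m : ℕ) (h : g.length = 2 ^ x.length * m) :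
    (x.foldl half g).length = m := by
  induction x generalizing g with
  | nil => simpa using h
  | cons b x ih => exact ih _ (half_length _ _ _ (by rw [h, List.length_cons]; ring))

theorem sel_length (x f : List Bool) (m : ℕ) (h : f.length = 2 ^ x.length * m) :
    (sel f x).length = m := by
  rw [sel, List.length_reverse, foldl_half_length _ _ m (by simpa using h)]

/-- A table for arguments of length `w` has `2 ^ w` slices, so `w` halvings isolate one of them.
Charging the full length for each halving is good enough. -/
theorem run_halves (y g : List Bool) (m : ℕ) (hg : g.length = 2 ^ y.length * m)
    (r l v e c s : List (Symb P A)) :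
    Run (whileNE .T fun a => bif isTrue a then halve true else halve false)
      (st r l v e c s (bits y) (bits g) [] [])
      (st r l v e c s [] (bits (y.foldl half g)) [] [])
      (y.length * (6 * g.length + 6) + 1) := by
  induction y generalizing g with
  | nil => exact (run_whileNE_nil rfl).to (by simp) (by simp)
  | cons b y ih =>
    have hg' : g.length = 2 * (2 ^ y.length * m) := by rw [hg, List.length_cons]; ring
    have hh := half_length g b _ hg'
    have h1 := run_halve b g _ hg' r l v e c s (bits y)
    have h2 : Run (bif isTrue (bit b : Symb P A) then halve true else halve false)
        (st r l v e c s (bits y) (bits g) [] []) (st r l v e c s (bits y) (bits (half g b)) [] [])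
        (6 * g.length + 5) := by
      cases b
      · exact h1.mono (by omega)
      · exact h1.mono (by omega)
    refine Run.to (run_whileNE_cons rfl (Run.cast h2 ?_ rfl le_rfl) (ih _ hh)) rfl ?_
    · simp [bits]
    rw [hh, List.length_cons, hg']
    nlinarith [Nat.zero_le (2 ^ y.length * m), Nat.zero_le (y.length * (2 ^ y.length * m))]

theorem run_appV (f y : List Bool) (m : ℕ) (hf : f.length = 2 ^ y.length * m)
    (r l v e c s : List (Symb P A)) :
    Run appV (st r l (bits y ++ .fin :: (bits f ++ .fin :: v)) e c s [] [] [] [])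
      (st r l (bits (sel f y) ++ .fin :: v) e c s [] [] [] [])
      (y.length * (6 * f.length + 8) + 4 * f.length + 5) := by
  have h1 := run_mvBits (k := Stk.V) (k' := .T) (by decide) y
    (S := st r l (bits y ++ .fin :: (bits f ++ .fin :: v)) e c s [] [] [] []) rfl
  have h2 := run_mvBits (k := Stk.V) (k' := .U) (by decide) f
    (S := st r l (bits f ++ .fin :: v) e c s (bits y.reverse) [] [] []) rfl
  have h3 := run_halves y.reverse f.reverse m (by simpa using hf) r l v e c s
  have h4 := run_mvAllBits (k := Stk.U) (k' := .V) (by decide) (y.reverse.foldl half f.reverse)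
    (S := st r l (.fin :: v) e c s [] (bits (y.reverse.foldl half f.reverse)) [] []) rfl
  refine (h1.seq (Run.seq (Run.cast h2 ?_ rfl le_rfl) (Run.seq (Run.cast h3 ?_ rfl le_rfl)
    (Run.seq (.push _ _ _) (Run.cast h4 ?_ rfl le_rfl))))).to ?_ ?_
  · simp
  · simp
  · simp
  · simp [sel]
  · have e1 := foldl_half_length y.reverse f.reverse m (by simpa using hf)
    have e2 : m ≤ f.length := by
      rw [hf]
      exact Nat.le_mul_of_pos_left _ (by positivity)
    simp only [List.length_reverse, e1]
    linarith

/-! ### Reading the transition system -/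

/-- The label that a symbol stands for. -/
def labelOf : Symb P A → Option (Set P)
  | .state Q => some Q
  | _ => none

/-- Push the bit `f Q` for every state with label `Q`. -/
def scan (f : Set P → Bool) : Pg P A :=
  (whileNE .S fun a => .push .W a ;;
    match labelOf a with
    | some Q => .push .V (bit (f Q))
    | none => .skip) ;;
  whileNE .W fun a => .push .S a

theorem run_scan (f : Set P → Bool) (r l v e c s t u x : List (Symb P A)) :
    Run (scan f) (st r l v e c s t u [] x)
      (st r l (bits ((s.filterMap labelOf).map f).reverse ++ v) e c s t u [] x)
      (5 * s.length + 2) := by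
  have h1 := run_whileNE (k := Stk.S) (f := fun a : Symb P A => .push .W a ;;
      match labelOf a with
      | some Q => .push .V (bit (f Q))
      | none => .skip) id
    (fun d s => st r l (bits ((d.filterMap labelOf).map f) ++ v) e c s t u d x) 2
    (fun d t => by simp)
    (fun d a s => by
      simp only [id, List.map_id, update_S]
      have h := Run.push (K := Stk) .W a
        (st r l (bits ((d.filterMap labelOf).map f) ++ v) e c s t u d x)
      simp only [update_W, st_W] at h
      cases hl : labelOf a with
      | none => exact (h.seq (.skip _)).to (by simp [hl]) (by omega)
      | some Q => exact (h.seq (.push _ _ _)).to (by simp [hl]) (by omega)) s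
  have h2 := run_mvAll (k := Stk.W) (k' := .S) (by decide)
    (S := st r l (bits ((s.reverse.filterMap labelOf).map f) ++ v) e c [] t u s.reverse x)
  refine (h1.seq h2).to ?_ ?_
  · simp [List.filterMap_reverse, List.map_reverse]
  · simp only [st_W, List.length_reverse]
    omega

open Classical in
/-- Push the value of the proposition `q`. -/
noncomputable def propV (q : P) : Pg P A := .push .V .fin ;; scan fun Q => decide (q ∈ Q)

theorem filterMap_labelOf_encodeTS {n : ℕ} (T : TS P A (Fin n)) :
    (encodeTS T).filterMap labelOf = (List.finRange n).map T.label := by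
  have h : ∀ l : List (Fin n), (l.flatMap fun i => Symb.state (T.label i) ::
      (List.finRange n).map fun j => Symb.edge {a | T.rel a i j}).filterMap labelOf =
      l.map T.label := by
    intro l
    induction l with
    | nil => rfl
    | cons i l ih =>
      have h1 : ((List.finRange n).map fun j => (Symb.edge {a | T.rel a i j} : Symb P A)).filterMap
          labelOf = [] := by
        rw [List.filterMap_eq_nil_iff]
        simp [labelOf]
      simp [List.filterMap_append, h1, ih, labelOf]
  exact h _

theorem encodeTS_length {n : ℕ} (T : TS P A (Fin n)) :
    (encodeTS T).length = n * (n + 1) := by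
  simp [encodeTS, List.length_flatMap]

open Classical in
/-- Whether `a` belongs to a set of actions. -/
noncomputable def actBit (a : A) (Q : Set A) : Bool := decide (a ∈ Q)

/-- The loop of `diaV`. -/
noncomputable def diaLoop (a : A) : Pg P A :=
  whileNE .S fun z => .push .W z ;;
    match z with
    | .state _ => (whileNE .U fun b => .push .T b) ;; .push .V (bit false)
    | .edge Q => popc .T fun b => .push .U b ;;
        (bif isTrue b && actBit a Q then popc .V fun _ => .push .V (bit true) else .skip)
    | _ => .skip

/-- Replace the topmost value by the set of its `a`-predecessors. -/
noncomputable def diaV (a : A) : Pg P A :=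
  (untl .V isFin fun b => .push .T b) ;; .push .V .fin ;; diaLoop a ;;
  (whileNE .W fun z => .push .S z) ;; clear .T ;; clear .U

/-- Whether one of the edges of a row leads to a state in the set given by `y`. -/
noncomputable def rowBit (a : A) (row : List (Set A)) (y : List Bool) : Bool :=
  (row.zip y).any fun p => p.2 && actBit a p.1

/-- Stated in continuation form, since the loop does not end with a row: a run of the loop on what
follows is extended to the left by the row. -/
theorem run_diaLoop_row (a : A) (row : List (Set A)) (y : List Bool)
    (hy : y.length = row.length) (b : Bool) (r l v e c s w x : List (Symb P A)) (u : List Bool)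
    {S' : Store Stk (Symb P A)} {t' : ℕ}
    (h : Run (diaLoop a) (st r l (bit (b || rowBit a row y) :: v) e c s [] (bits (y.reverse ++ u))
      ((row.map .edge).reverse ++ w) x) S' t') :
    Run (diaLoop a) (st r l (bit b :: v) e c (row.map .edge ++ s) (bits y) (bits u) w x) S'
      (6 * row.length + t') := by
  induction row generalizing y b u w with
  | nil =>
    obtain rfl : y = [] := by simpa using hy
    simpa [rowBit] using h
  | cons Q row ih =>
    obtain ⟨d, y, rfl⟩ : ∃ d z, y = d :: z := by
      cases y with
      | nil => simp at hy
      | cons d z => exact ⟨d, z, rfl⟩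
    have h1 := ih y (by simpa using hy) (b || (d && actBit a Q))
      (.edge Q :: w) (d :: u) (by simpa [rowBit, Bool.or_assoc] using h)
    refine Run.to (run_whileNE_cons (t₁ := 5) (l := row.map .edge ++ s) rfl ?_ h1) rfl
      (by rw [List.length_cons]; omega)
    refine Run.pushSeq (t := 4) ?_
    refine run_popc (t := 3) (a := bit d) (l := bits y) (by simp) ?_
    refine Run.pushSeq (t := 2) ?_
    simp only [update_S, update_W, update_U, update_T, st_W, st_U, isTrue_bit]
    cases d && actBit a Q
    · exact Run.to (.skip _) (by simp) (by omega)
    · exact Run.to (run_popc rfl (.push _ _ _)) (by simp) le_rfl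

/-- `U` and `T` hold the argument `y` split at the current column; a new row rewinds it to `T`. The
final split is left open because both stacks are cleared afterwards. -/
theorem run_diaLoop (a : A) (rows : List (Set P × List (Set A))) (y : List Bool)
    (hy : ∀ p ∈ rows, p.2.length = y.length) (r l v e c w x : List (Symb P A)) (t u : List Bool)
    (htu : u.reverse ++ t = y) :
    ∃ t' u' : List Bool, u'.reverse ++ t' = y ∧
    Run (diaLoop a)
      (st r l v e c (rows.flatMap fun p => .state p.1 :: p.2.map .edge) (bits t) (bits u) w x)
      (st r l (bits (rows.map fun p => rowBit a p.2 y).reverse ++ v) e c [] (bits t') (bits u')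
        ((rows.flatMap fun p => .state p.1 :: p.2.map .edge).reverse ++ w) x)
      (rows.length * (8 * y.length + 5) + 1) := by
  induction rows generalizing v w t u with
  | nil => exact ⟨t, u, htu, (run_whileNE_nil rfl).to (by simp) (by simp)⟩
  | cons p rows ih =>
    have hp := hy p (by simp)
    obtain ⟨t', u', hy', h1⟩ := ih (fun q hq => hy q (by simp [hq]))
      (bit (rowBit a p.2 y) :: v) ((p.2.map .edge).reverse ++ .state p.1 :: w) [] y.reverse
      (by simp)
    have h2 := run_diaLoop_row a p.2 y hp.symm false r l v e c
      (rows.flatMap fun p => .state p.1 :: p.2.map .edge) (.state p.1 :: w) x []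
      (by simpa using h1)
    have h3 := run_mvAllBits (k := Stk.U) (k' := .T) (by decide) u
      (S := st r l v e c (p.2.map .edge ++ rows.flatMap fun p => .state p.1 :: p.2.map .edge)
        (bits t) (bits u) (.state p.1 :: w) x) rfl
    refine ⟨t', u', hy', Run.to (run_whileNE_cons rfl (Run.seq (.push _ _ _)
      (Run.seq (Run.cast h3 ?_ rfl le_rfl) (.push _ _ _))) (Run.cast h2 ?_ rfl le_rfl)) ?_ ?_⟩
    · simp [List.flatMap_def]
    · simp [← htu]
    · simp
    · have : u.length ≤ y.length := by rw [← htu]; simp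
      rw [List.length_cons, hp]
      linarith

/-- The rows of the adjacency matrix. -/
def rowsOf {n : ℕ} (T : TS P A (Fin n)) : List (Set P × List (Set A)) :=
  (List.finRange n).map fun i => (T.label i, (List.finRange n).map fun j => {a | T.rel a i j})

theorem encodeTS_eq {n : ℕ} (T : TS P A (Fin n)) :
    encodeTS T = (rowsOf T).flatMap fun p => .state p.1 :: p.2.map .edge := by
  simp [encodeTS, rowsOf, List.flatMap_map, Function.comp_def]

theorem run_diaV (a : A) {n : ℕ} (T : TS P A (Fin n)) (y : List Bool) (hy : y.length = n)
    (r l v e c x : List (Symb P A)) :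
    Run (diaV a) (st r l (bits y ++ .fin :: v) e c (encodeTS T) [] [] [] x)
      (st r l (bits ((rowsOf T).map fun p => rowBit a p.2 y.reverse).reverse ++ .fin :: v) e c
        (encodeTS T) [] [] [] x) (10 * n * n + 15 * n + 10) := by
  have h1 := run_mvBits (k := Stk.V) (k' := .T) (by decide) y
    (S := st r l (bits y ++ .fin :: v) e c (encodeTS T) [] [] [] x) rfl
  obtain ⟨t', u', hy', h2⟩ := run_diaLoop a (rowsOf T) y.reverse (by simp [rowsOf, hy]) r l
    (.fin :: v) e c [] x y.reverse [] (by simp)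
  rw [← encodeTS_eq] at h2
  set z := (bits ((rowsOf T).map fun p => rowBit a p.2 y.reverse).reverse : List (Symb P A))
  have h3 := run_mvAll (k := Stk.W) (k' := .S) (by decide)
    (S := st r l (z ++ .fin :: v) e c [] (bits t') (bits u') (encodeTS T).reverse x)
  have h4 := run_clear (k := Stk.T)
    (st r l (z ++ .fin :: v) e c (encodeTS T) (bits t') (bits u') [] x)
  have h5 := run_clear (k := Stk.U)
    (st r l (z ++ .fin :: v) e c (encodeTS T) [] (bits u') [] x)
  refine Run.to (h1.seq (Run.seq (.push _ _ _) (Run.seq (Run.cast h2 ?_ rfl le_rfl)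
    (Run.seq (Run.cast h3 ?_ rfl le_rfl) (Run.seq (Run.cast h4 ?_ rfl le_rfl)
      (Run.cast h5 ?_ rfl le_rfl)))))) ?_ ?_
  · simp
  · simp
  · simp
  · simp
  · simp
  · have e1 : t'.length + u'.length = n := by
      rw [← hy, ← List.length_reverse (as := y), ← hy', List.length_append, List.length_reverse,
        add_comm]
    have e2 : (rowsOf T).length = n := by simp [rowsOf]
    simp only [st_W, st_T, st_U, List.length_reverse, encodeTS_length, bits_length, hy, e2]
    nlinarith

/-! ### Words of zeros -/

/-- The length of the words for values of a type. -/
def width (n : ℕ) : Ty → ℕ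
  | .pr => n
  | .arr σ _ τ => 2 ^ width n σ * width n τ

/-- Read a type on `R`, and copy it to `X` in reverse order. -/
def readTy : Pg P A :=
  .push .U .tick ;; whileNE .U fun _ => popc .R fun a => .push .L a ;; .push .X a ;;
    match a with
    | .arr _ => .push .U .tick ;; .push .U .tick
    | _ => .skip

/-- The ticks on `U` count the types still to be read: every symbol uses up one, and an arrow
demands two more. At zero the prefix notation is complete. -/
theorem run_readTy_aux (τ : Ty) (r l v e c s t u w x : List (Symb P A))
    {S' : Store Stk (Symb P A)} {k : ℕ}
    (h : Run (whileNE .U fun _ => popc .R fun a => .push .L a ;; .push .X a ;;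
      match a with
      | .arr _ => .push .U .tick ;; .push .U .tick
      | _ => .skip) (st r ((encodeTy τ).reverse ++ l) v e c s t u w ((encodeTy τ).reverse ++ x))
        S' k) :
    Run (whileNE .U fun _ => popc .R fun a => .push .L a ;; .push .X a ;;
      match a with
      | .arr _ => .push .U .tick ;; .push .U .tick
      | _ => .skip) (st (encodeTy τ ++ r) l v e c s t (.tick :: u) w x)
        S' (6 * (encodeTy τ : List (Symb P A)).length + k) := by
  induction τ generalizing r l u x k with
  | pr =>
    refine Run.to (run_whileNE_cons (t₁ := 3) rfl ?_ h) rfl (by simp [encodeTy])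
    refine run_popc (a := .pr) (l := r) (by simp [encodeTy]) ?_
    exact Run.pushSeq (Run.pushSeq (Run.to (.skip _) (by simp [encodeTy]) le_rfl))
  | arr σ v' τ ihσ ihτ =>
    have h1 := ihτ r ((encodeTy σ).reverse ++ .arr v' :: l) u ((encodeTy σ).reverse ++ .arr v' :: x)
      (by simpa [encodeTy] using h)
    have h2 := ihσ (encodeTy τ ++ r) (.arr v' :: l) (.tick :: u) (.arr v' :: x) h1
    refine Run.to (run_whileNE_cons (t₁ := 5) rfl ?_ h2) rfl (by simp [encodeTy]; omega)
    refine run_popc (a := .arr v') (l := encodeTy σ ++ (encodeTy τ ++ r)) (by simp [encodeTy]) ?_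
    exact Run.pushSeq (Run.pushSeq (Run.pushSeq (Run.to (.push _ _ _) (by simp) le_rfl)))

theorem run_readTy (τ : Ty) (r l v e c s t w x : List (Symb P A)) :
    Run readTy (st (encodeTy τ ++ r) l v e c s t [] w x)
      (st r ((encodeTy τ).reverse ++ l) v e c s t [] w ((encodeTy τ).reverse ++ x))
      (6 * (encodeTy τ : List (Symb P A)).length + 2) := by
  have h := run_readTy_aux τ r l v e c s t [] w x (run_whileNE_nil rfl)
  exact (Run.seq (.push _ _ _) (Run.cast h (by simp) rfl le_rfl)).to rfl (by omega)

/-- Replace words of length `a` and `b` by a word of length `2 ^ a * b`. -/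
def expV : Pg P A :=
  (untl .V isFin fun a => .push .W a) ;; whileNE .W fun _ =>
    (untl .V isFin fun a => .push .U a) ;; .push .V .fin ;;
      whileNE .U fun a => .push .V a ;; .push .V a

/-- A word of length `b` is doubled once for each of the `a` bits on `W`; the costs form a geometric
sum. -/
theorem run_expV_loop (a b : ℕ) (r l v e c s t x : List (Symb P A)) :
    Run (whileNE .W fun _ => (untl .V isFin fun a => .push .U a) ;; .push .V .fin ;;
      whileNE .U fun a => .push .V a ;; .push .V a)
      (st r l (bits (List.replicate b false) ++ .fin :: v) e c s t []
        (bits (List.replicate a false)) x)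
      (st r l (bits (List.replicate (2 ^ a * b) false) ++ .fin :: v) e c s t [] [] x)
      (5 * ((2 ^ a - 1) * b) + 4 * a + 1) := by
  induction a generalizing b with
  | zero => exact (run_whileNE_nil rfl).to (by simp) (by omega)
  | succ a ih =>
    have h1 := run_mvBits (k := Stk.V) (k' := .U) (by decide) (List.replicate b false)
      (S := st r l (bits (List.replicate b false) ++ .fin :: v) e c s t []
        (bits (List.replicate a false)) x) rfl
    have h2 := run_whileNE (k := Stk.U) (f := fun a : Symb P A => .push .V a ;; .push .V a) bit
      (fun d y => st r l (bits (d.flatMap fun b => [b, b]) ++ .fin :: v) e c s t (bits y)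
        (bits (List.replicate a false)) x) 2 (fun d t => rfl)
      (fun d b y => Run.to (Run.seq (.push _ _ _) (.push _ _ _)) (by simp [bits]) le_rfl)
      (List.replicate b false)
    have e1 : ∀ b : ℕ, (List.replicate b false).flatMap (fun b => [b, b]) =
        List.replicate (2 * b) false := by
      intro b
      induction b with
      | zero => rfl
      | succ b ih => simp [List.replicate_succ, ih, Nat.mul_succ]
    refine Run.to (run_whileNE_cons rfl (Run.seq (Run.cast h1 ?_ rfl le_rfl)
      (Run.seq (.push _ _ _) (Run.cast h2 ?_ rfl le_rfl))) (Run.cast (ih (2 * b)) ?_ rfl le_rfl))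
      ?_ ?_
    · simp [List.replicate_succ, bits]
    · simp
    · simp [e1]
    · simp [pow_succ, mul_assoc]
    · obtain ⟨k, hk⟩ : ∃ k, 2 ^ a = k + 1 := Nat.exists_eq_succ_of_ne_zero (by positivity)
      have hk' : 2 ^ (a + 1) - 1 = 2 * k + 1 := by rw [pow_succ, hk]; omega
      rw [hk', hk, Nat.add_sub_cancel, List.length_replicate]
      linarith

theorem run_expV (a b : ℕ) (r l v e c s t x : List (Symb P A)) :
    Run expV (st r l (bits (List.replicate a false) ++ .fin ::
        (bits (List.replicate b false) ++ .fin :: v)) e c s t [] [] x)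
      (st r l (bits (List.replicate (2 ^ a * b) false) ++ .fin :: v) e c s t [] [] x)
      (5 * (2 ^ a * b) + 6 * a + 2) := by
  have h1 := run_mvBits (k := Stk.V) (k' := .W) (by decide) (List.replicate a false)
    (S := st r l (bits (List.replicate a false) ++ .fin ::
        (bits (List.replicate b false) ++ .fin :: v)) e c s t [] [] x) rfl
  refine (h1.seq (Run.cast (run_expV_loop a b r l v e c s t x) ?_ rfl le_rfl)).to rfl ?_
  · simp
  · have : (2 ^ a - 1) * b ≤ 2 ^ a * b := Nat.mul_le_mul_right _ (Nat.sub_le _ _)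
    simp only [List.length_replicate]
    omega

/-- Replace the type on `X` by a word of zeros on `V`. -/
def zerosV : Pg P A :=
  whileNE .X fun a =>
    match a with
    | .arr _ => expV
    | _ => .push .V .fin ;; scan fun _ => false

theorem width_pos {n : ℕ} (hn : 0 < n) (τ : Ty) : 0 < width n τ := by
  induction τ with
  | pr => exact hn
  | arr σ v τ _ ih => exact Nat.mul_pos (by positivity) ih

/-- Reversed prefix notation is evaluated like postfix notation: when the arrow is met, the words
for `τ` and, above it, for `σ` are already on `V`. -/
theorem run_zerosV_aux {n : ℕ} (hn : 0 < n) (T : TS P A (Fin n)) (τ : Ty) (b : ℕ)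
    (hb : width n τ ≤ b) (r l v e c t x : List (Symb P A))
    {S' : Store Stk (Symb P A)} {k : ℕ}
    (h : Run zerosV (st r l (bits (List.replicate (width n τ) false) ++ .fin :: v) e c
      (encodeTS T) t [] [] x) S' k) :
    Run zerosV (st r l v e c (encodeTS T) t [] [] ((encodeTy τ).reverse ++ x)) S'
      ((encodeTy τ : List (Symb P A)).length * (11 * b + 5 * n * n + 5 * n + 4) + k) := by
  induction τ generalizing v x k with
  | pr =>
    refine Run.to (run_whileNE_cons (t₁ := 5 * (n * (n + 1)) + 3) (a := .pr) (l := x)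
      (by simp [encodeTy]) ?_ h) rfl ?_
    · refine Run.pushSeq (Run.cast (run_scan (fun _ => false) r l (.fin :: v) e c (encodeTS T) t
        [] x) (by simp) ?_ (by rw [encodeTS_length]))
      rw [filterMap_labelOf_encodeTS]
      simp [width, bits, List.map_const']
    · simp [encodeTy]
      nlinarith
  | arr σ v' τ ihσ ihτ =>
    have hτ : width n τ ≤ b :=
      (Nat.le_mul_of_pos_left _ (by positivity)).trans hb
    have hσ : width n σ ≤ b :=
      (Nat.lt_two_pow_self.le.trans (Nat.le_mul_of_pos_right _ (width_pos hn τ))).trans hb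
    have h1 : Run zerosV (st r l (bits (List.replicate (width n σ) false) ++ .fin ::
        (bits (List.replicate (width n τ) false) ++ .fin :: v)) e c (encodeTS T) t [] []
        (.arr v' :: x)) S' (5 * width n (.arr σ v' τ) + 6 * width n σ + 2 + k + 1) :=
      run_whileNE_cons rfl
        (Run.cast (run_expV (width n σ) (width n τ) r l v e c (encodeTS T) t x)
          (by simp) rfl le_rfl) h
    have h2 := ihσ hσ _ _ h1
    have h3 := ihτ hτ _ _ h2
    refine Run.cast h3 (by simp [encodeTy]) rfl ?_
    simp only [encodeTy, List.length_cons, List.length_append]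
    nlinarith

theorem run_zerosV {n : ℕ} (hn : 0 < n) (T : TS P A (Fin n)) (τ : Ty) (b : ℕ)
    (hb : width n τ ≤ b) (r l v e c t : List (Symb P A)) :
    Run zerosV (st r l v e c (encodeTS T) t [] [] (encodeTy τ).reverse)
      (st r l (bits (List.replicate (width n τ) false) ++ .fin :: v) e c
        (encodeTS T) t [] [] [])
      ((encodeTy τ : List (Symb P A)).length * (11 * b + 5 * n * n + 5 * n + 4) + 1) := by
  have := run_zerosV_aux hn T τ b hb r l v e c t [] (run_whileNE_nil rfl)
  simpa using this

/-! ### Binary counting -/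

/-- The `w` lowest binary digits of `i`, starting with the lowest one. -/
def digits (w i : ℕ) : List Bool := (List.range w).map i.testBit

@[simp] theorem digits_length (w i : ℕ) : (digits w i).length = w := by simp [digits]

theorem digits_zero (w : ℕ) : digits w 0 = List.replicate w false := by
  have h : Nat.testBit 0 = fun _ => false := funext fun i => Nat.zero_testBit i
  rw [digits, h, List.map_const', List.length_range]

theorem digits_succ (w i : ℕ) : digits (w + 1) i = i.testBit 0 :: digits w (i / 2) := by
  simp [digits, List.range_succ_eq_map, Function.comp_def, Nat.testBit_succ]

/-- Increment a binary number, unless all its digits are ones. -/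
def incr : List Bool → Option (List Bool)
  | [] => none
  | false :: x => some (true :: x)
  | true :: x => (incr x).map (false :: ·)

theorem incr_digits (w i : ℕ) (hi : i < 2 ^ w) :
    incr (digits w i) = if i + 1 < 2 ^ w then some (digits w (i + 1)) else none := by
  induction w generalizing i with
  | zero =>
    obtain rfl : i = 0 := by simpa using hi
    simp [digits, incr]
  | succ w ih =>
    rw [digits_succ, digits_succ]
    rw [pow_succ] at hi ⊢
    rcases Nat.even_or_odd' i with ⟨j, rfl | rfl⟩
    · have h1 : (2 * j).testBit 0 = false := by simp
      have h2 : (2 * j + 1).testBit 0 = true := by simp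
      have h3 : (2 * j + 1) / 2 = 2 * j / 2 := by omega
      rw [h1, h2, h3, incr, if_pos (by omega)]
    · have h1 : (2 * j + 1).testBit 0 = true := by simp
      have h2 : (2 * j + 1 + 1).testBit 0 = false := by simp; omega
      have h3 : (2 * j + 1) / 2 = j := by omega
      have h4 : (2 * j + 1 + 1) / 2 = j + 1 := by omega
      rw [h1, h2, h3, h4, incr, ih j (by omega)]
      by_cases h : j + 1 < 2 ^ w
      · rw [if_pos h, if_pos (by omega), Option.map_some]
      · rw [if_neg h, if_neg (by omega), Option.map_none]

/-- Increment the topmost word of the environment and continue with `p₁`, or remove it if there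
is an overflow, and continue with `p₂`. -/
def incrE (p₁ p₂ : Pg P A) : Pg P A :=
  .loop .E (fun o => o.any isTrue) fun o => match o with
    | some .var => .push .U (bit false)
    | some .fin => clear .U ;; p₂
    | _ => .push .E (bit true) ;; (whileNE .U fun b => .push .E b) ;; p₁

/-- The `m` leading ones already passed wait on `U` as zeros, until the carry is absorbed and they
are put back. -/
theorem run_incrE_some (p₁ p₂ : Pg P A) (x x' : List Bool) (m : ℕ) (hx : incr x = some x')
    (r l v e c s t w z : List (Symb P A)) {S' : Store Stk (Symb P A)} {k : ℕ}
    (h : Run p₁ (st r l v (bits (List.replicate m false ++ x') ++ e) c s t [] w z) S' k) :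
    Run (incrE p₁ p₂) (st r l v (bits x ++ e) c s t (bits (List.replicate m false)) w z) S'
      (4 * x.length + 2 * m + 3 + k) := by
  induction x generalizing m x' with
  | nil => simp [incr] at hx
  | cons b x ih =>
    cases b with
    | false =>
      obtain rfl : true :: x = x' := by simpa [incr] using hx
      have h1 := run_mvAllBits (k := Stk.U) (k' := .E) (by decide) (List.replicate m false)
        (S := st r l v (bits (true :: x) ++ e) c s t (bits (List.replicate m false)) w z) rfl
      refine Run.to (Run.loop_exit (t := 2 * m + 2 + k) rfl (Run.mono (Run.pushSeq
        (Run.cast (Run.seq h1 (Run.cast h ?_ rfl le_rfl)) ?_ rfl le_rfl)) ?_)) rfl ?_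
      · simp [bits]
      · simp [bits]
      · simp only [List.length_replicate]
        omega
      · simp only [List.length_cons]
        omega
    | true =>
      obtain ⟨x'', hx'', rfl⟩ : ∃ x'', incr x = some x'' ∧ false :: x'' = x' := by
        simpa [incr] using hx
      have h1 := ih x'' (m + 1) hx'' (by
        convert h using 3
        simp [List.replicate_succ'])
      refine Run.to (Run.loop_next rfl (.push _ _ _) (Run.cast h1 ?_ rfl le_rfl)) rfl ?_
      · simp [List.replicate_succ, bits]
      · simp only [List.length_cons]
        omega

theorem run_incrE_none (p₁ p₂ : Pg P A) (x : List Bool) (u : List (Symb P A)) (hx : incr x = none)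
    (r l v e c s t w z : List (Symb P A)) {S' : Store Stk (Symb P A)} {k : ℕ}
    (h : Run p₂ (st r l v e c s t [] w z) S' k) :
    Run (incrE p₁ p₂) (st r l v (bits x ++ .fin :: e) c s t u w z) S'
      (3 * x.length + u.length + 2 + k) := by
  induction x generalizing u with
  | nil =>
    refine Run.to (Run.loop_exit rfl (Run.seq (run_clear _) (Run.cast h ?_ rfl le_rfl))) rfl ?_
    · simp
    · simp
  | cons b x ih =>
    cases b with
    | false => simp [incr] at hx
    | true =>
      have h1 := ih (bit false :: u) (by simpa [incr] using hx)
      refine Run.to (Run.loop_next rfl (.push _ _ _) (Run.cast h1 ?_ rfl le_rfl)) rfl ?_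
      · simp [bits]
      · simp only [List.length_cons]
        omega

/-! ### The main loop -/

/-- Enter the scope of a binder: mark the position, and read the variable and its type. -/
def enter : Pg P A := .push .L (.state ∅) ;; access ;; readTy ;; zerosV

/-- Move back to the beginning of the scope of a binder. -/
def reenter : Pg P A :=
  (untl .L isState fun a => .push .R a) ;; .push .L (.state ∅) ;; access ;; readTy ;; clear .X

/-- Leave the scope of a binder. -/
def leave : Pg P A :=
  .push .E .fin ;; restoreEnv ;; (untl .L isState fun a => .push .R a) ;;
    untl .R isEdge fun a => .push .L a

/-- Begin to evaluate an abstraction. -/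
def lamEnter : Pg P A :=
  enter ;; (untl .V isFin fun b => .push .E b) ;; restoreEnv ;; .push .V .fin ;;
    .push .C (.lam .zero) ;; .push .C .pr ;; .push .C .var

/-- Continue to evaluate an abstraction, after the evaluation of its body. -/
def lamReturn : Pg P A :=
  (untl .V isFin fun b => .push .U b) ;; (whileNE .U fun b => .push .V b) ;; reenter ;;
    incrE (restoreEnv ;; .push .C (.lam .zero) ;; .push .C .var) leave

/-- Begin to evaluate a fixpoint. -/
def muEnter : Pg P A :=
  enter ;; .push .C .fin ;; (untl .V isFin fun b => .push .E b ;; .push .C .tick) ;;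
    restoreEnv ;; .push .C .mu ;; .push .C .pr ;; .push .C .var

/-- Continue to evaluate a fixpoint, after the evaluation of its body. -/
def muReturn : Pg P A :=
  reenter ;; (untl .E isFin fun _ => .skip) ;; popc .C fun a =>
    match a with
    | .tick => .push .E .fin ;; (untl .V isFin fun b => .push .U b) ;;
        (whileNE .U fun b => .push .E b) ;; restoreEnv ;; .push .C .mu ;; .push .C .var
    | _ => leave

/-- Begin to evaluate a formula whose first symbol has been read. -/
noncomputable def dispatch : Symb P A → Pg P A
  | .prop q => propV q
  | .var => varV
  | .neg => .push .C .neg ;; .push .C .var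
  | .or => .push .C .or ;; .push .C .var ;; .push .C .var
  | .dia a => .push .C (.dia a) ;; .push .C .var
  | .app => .push .C .app ;; .push .C .var ;; .push .C .var
  | .lam _ => lamEnter
  | .mu => muEnter
  | _ => .skip

/-- Begin to evaluate a formula. -/
noncomputable def evalStep : Pg P A := popc .R fun a => .push .L a ;; dispatch a

/-- What to do for a symbol on the control stack. -/
noncomputable def handle : Symb P A → Pg P A
  | .var => evalStep
  | .neg => negV
  | .or => orV
  | .dia a => diaV a
  | .app => appV
  | .pr => .push .R (.edge ∅)
  | .lam _ => lamReturn
  | .mu => muReturn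
  | _ => .skip

/-- The main loop of the model checker. -/
noncomputable def mainLoop : Pg P A := whileNE .C handle

theorem not_mark_encodeNum (i : ℕ) :
    ∀ a ∈ (encodeNum i : List (Symb P A)), isState a = false ∧ isEdge a = false := by
  intro a ha
  simp only [encodeNum, List.mem_append, List.mem_replicate, List.mem_singleton] at ha
  rcases ha with ⟨_, rfl⟩ | rfl <;> exact ⟨rfl, rfl⟩

theorem not_mark_encodeTy (τ : Ty) :
    ∀ a ∈ (encodeTy τ : List (Symb P A)), isState a = false ∧ isEdge a = false := by
  induction τ with
  | pr => simp [encodeTy, isState, isEdge]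
  | arr σ v τ ihσ ihτ =>
    simp only [encodeTy, List.mem_cons, List.mem_append]
    rintro a (rfl | h | h)
    · exact ⟨rfl, rfl⟩
    · exact ihσ a h
    · exact ihτ a h

/-- State and edge symbols occur only in the part of the input for the transition system. They can
therefore mark, on `L` and `R`, the start and the end of a body that is evaluated repeatedly, and a
search for a mark cannot stop inside the formula. -/
theorem not_mark_encodeFormWith (num : ℕ → ℕ) (φ : Form P A) :
    ∀ a ∈ encodeFormWith num φ, isState a = false ∧ isEdge a = false := by
  induction φ with
  | prop q => simp [encodeFormWith, isState, isEdge]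
  | var X =>
    simp only [encodeFormWith, List.mem_cons]
    rintro a (rfl | h)
    · exact ⟨rfl, rfl⟩
    · exact not_mark_encodeNum _ a h
  | neg φ ih | dia _ φ ih =>
    simp only [encodeFormWith, List.mem_cons]
    rintro a (rfl | h)
    · exact ⟨rfl, rfl⟩
    · exact ih a h
  | or φ ψ ih₁ ih₂ | app φ ψ ih₁ ih₂ =>
    simp only [encodeFormWith, List.mem_cons, List.mem_append]
    rintro a (rfl | h | h)
    · exact ⟨rfl, rfl⟩
    · exact ih₁ a h
    · exact ih₂ a h
  | lam X v σ φ ih | mu X σ φ ih =>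
    simp only [encodeFormWith, List.mem_cons, List.mem_append]
    rintro a (rfl | (h | h) | h)
    · exact ⟨rfl, rfl⟩
    · exact not_mark_encodeNum _ a h
    · exact not_mark_encodeTy _ a h
    · exact ih a h

section Binder
variable {n : ℕ} (T : TS P A (Fin n)) (η θ : List (List Bool)) (b : ℕ) (τ : Ty)

theorem run_enter (hn : 0 < n) (h : ∀ x ∈ η, x.length ≤ b) (hτ : width n τ ≤ b)
    (r l v c : List (Symb P A)) :
    Run enter (st (encodeNum η.length ++ (encodeTy τ ++ r)) l v (encEnv (η ++ θ)) c
        (encodeTS T) [] [] [] [])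
      (st r ((encodeTy τ).reverse ++ ((encodeNum η.length).reverse ++ .state ∅ :: l))
        (bits (List.replicate (width n τ) false) ++ .fin :: v) (encEnv θ) c
        (encodeTS T) (encEnv η).reverse [] [] [])
      (η.length * (2 * b + 5) +
        (encodeTy τ : List (Symb P A)).length * (11 * b + 5 * n * n + 5 * n + 10) + 6) := by
  have h1 := run_access η θ b h (encodeTy τ ++ r) (.state ∅ :: l) v c (encodeTS T) [] [] []
  have h2 := run_readTy τ r ((encodeNum η.length).reverse ++ .state ∅ :: l) v (encEnv θ) c
    (encodeTS T) (encEnv η).reverse [] []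
  have h3 := run_zerosV hn T τ b hτ r
    ((encodeTy τ).reverse ++ ((encodeNum η.length).reverse ++ .state ∅ :: l)) v (encEnv θ) c
    (encEnv η).reverse
  refine Run.to (Run.pushSeq (Run.seq (Run.cast h1 ?_ rfl le_rfl) (Run.seq h2
    (Run.cast h3 ?_ rfl le_rfl)))) rfl ?_
  · simp
  · simp
  · linarith

theorem run_reenter (h : ∀ x ∈ η, x.length ≤ b) (num : ℕ → ℕ) (φ : Form P A)
    (r l v c s w : List (Symb P A)) :
    Run reenter (st r ((encodeFormWith num φ).reverse ++
        ((encodeTy τ).reverse ++ ((encodeNum η.length).reverse ++ .state ∅ :: l))) v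
        (encEnv (η ++ θ)) c s [] [] w [])
      (st (encodeFormWith num φ ++ r)
        ((encodeTy τ).reverse ++ ((encodeNum η.length).reverse ++ .state ∅ :: l)) v (encEnv θ) c s
        (encEnv η).reverse [] w [])
      (η.length * (2 * b + 7) + 9 * (encodeTy τ : List (Symb P A)).length +
        2 * (encodeFormWith num φ).length + 20) := by
  have h0 := run_mvUntil (k := Stk.L) (k' := .R) (by decide) (isEnd := isState) (h := id) id
    (z := .state ∅) (rest := l)
    ((encodeFormWith num φ).reverse ++ ((encodeTy τ).reverse ++ (encodeNum η.length).reverse))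
    (S := st r ((encodeFormWith num φ).reverse ++
        ((encodeTy τ).reverse ++ ((encodeNum η.length).reverse ++ .state ∅ :: l))) v
        (encEnv (η ++ θ)) c s [] [] w []) (by simp) rfl (by
      simp only [List.mem_append, List.mem_reverse]
      rintro a (ha | ha | ha)
      · exact (not_mark_encodeFormWith num φ a ha).1
      · exact (not_mark_encodeTy τ a ha).1
      · exact (not_mark_encodeNum _ a ha).1)
  have h1 := run_access η θ b h (encodeTy τ ++ (encodeFormWith num φ ++ r)) (.state ∅ :: l) v c s
    [] w []
  have h2 := run_readTy τ (encodeFormWith num φ ++ r)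
    ((encodeNum η.length).reverse ++ .state ∅ :: l) v (encEnv θ) c s (encEnv η).reverse w []
  refine Run.to (Run.seq h0 (Run.pushSeq (Run.seq (Run.cast h1 ?_ rfl le_rfl) (Run.seq h2
    (run_clear _))))) ?_ ?_
  · simp
  · simp
  · have : (encodeNum η.length : List (Symb P A)).length = η.length + 1 := by simp [encodeNum]
    simp only [List.length_append, List.length_reverse, this, st_X, List.length_nil]
    linarith

/-- The word of the bound variable is reset to the empty word, the state in which the binder found
it, and both marks are removed. -/
theorem run_leave (h : ∀ x ∈ η, x.length ≤ b) (num : ℕ → ℕ) (φ : Form P A)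
    (r l v c s w x : List (Symb P A)) :
    Run leave (st (encodeFormWith num φ ++ .edge ∅ :: r)
        ((encodeTy τ).reverse ++ ((encodeNum η.length).reverse ++ .state ∅ :: l)) v (encEnv θ) c s
        (encEnv η).reverse [] w x)
      (st r ((encodeFormWith num φ).reverse ++
        ((encodeTy τ).reverse ++ ((encodeNum η.length).reverse ++ l))) v
        (encEnv (η ++ [] :: θ)) c s [] [] w x)
      (η.length * (2 * b + 6) + 4 * (encodeTy τ : List (Symb P A)).length +
        2 * (encodeFormWith num φ).length + 10) := by
  have h0 := run_restoreEnv η ([] :: θ) b h (encodeFormWith num φ ++ .edge ∅ :: r)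
    ((encodeTy τ).reverse ++ ((encodeNum η.length).reverse ++ .state ∅ :: l)) v c s [] w x
  have h1 := run_mvUntil (k := Stk.L) (k' := .R) (by decide) (isEnd := isState) (h := id) id
    (z := .state ∅) (rest := l) ((encodeTy τ).reverse ++ (encodeNum η.length).reverse)
    (S := st (encodeFormWith num φ ++ .edge ∅ :: r)
      ((encodeTy τ).reverse ++ ((encodeNum η.length).reverse ++ .state ∅ :: l)) v
      (encEnv (η ++ [] :: θ)) c s [] [] w x) (by simp) rfl (by
      simp only [List.mem_append, List.mem_reverse]
      rintro a (ha | ha)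
      · exact (not_mark_encodeTy τ a ha).1
      · exact (not_mark_encodeNum _ a ha).1)
  have h2 := run_mvUntil (k := Stk.R) (k' := .L) (by decide) (isEnd := isEdge) (h := id) id
    (z := .edge ∅) (rest := r) (encodeNum η.length ++ (encodeTy τ ++ encodeFormWith num φ))
    (S := st (encodeNum η.length ++ (encodeTy τ ++ (encodeFormWith num φ ++ .edge ∅ :: r))) l v
      (encEnv (η ++ [] :: θ)) c s [] [] w x) (by simp) rfl (by
      simp only [List.mem_append]
      rintro a (ha | ha | ha)
      · exact (not_mark_encodeNum _ a ha).2
      · exact (not_mark_encodeTy τ a ha).2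
      · exact (not_mark_encodeFormWith num φ a ha).2)
  refine Run.to (Run.pushSeq (Run.seq (Run.cast h0 ?_ rfl le_rfl) (Run.seq h1
    (Run.cast h2 ?_ rfl le_rfl)))) ?_ ?_
  · simp
  · simp
  · simp
  · have : (encodeNum η.length : List (Symb P A)).length = η.length + 1 := by simp [encodeNum]
    simp only [List.length_append, List.length_reverse, this]
    linarith

end Binder

/-- A bound for the time that one iteration of the main loop takes, if the formula has length `q`
at most, and all words for values have length `b` at most. -/
def iterTime (q b : ℕ) : ℕ := 100 * (q + 1) * (b + 1) ^ 2

theorem le_iterTime {t q b : ℕ} (h : t ≤ q * (50 * b * b + 100 * b + 50) + 50 * b * b + 50 * b + 50) :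
    t ≤ iterTime q b := by
  have : q * (50 * b * b + 100 * b + 50) + 50 * b * b + 50 * b + 50 ≤ iterTime q b := by
    unfold iterTime
    nlinarith [Nat.zero_le (q * b), Nat.zero_le (q * b * b), Nat.zero_le (b * b)]
  omega

section Binder
variable {n : ℕ} (T : TS P A (Fin n)) (η θ : List (List Bool)) {b q : ℕ} (τ : Ty)

theorem run_lamEnter (hn : 0 < n) (hnb : n ≤ b) (h : ∀ x ∈ η, x.length ≤ b)
    (hτ : width n τ ≤ b) (hq : η.length ≤ q)
    (hq' : (encodeTy τ : List (Symb P A)).length ≤ q)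
    (r l v c : List (Symb P A)) :
    Run lamEnter (st (encodeNum η.length ++ (encodeTy τ ++ r)) l v (encEnv (η ++ [] :: θ)) c
        (encodeTS T) [] [] [] [])
      (st r ((encodeTy τ).reverse ++ ((encodeNum η.length).reverse ++ .state ∅ :: l))
        (.fin :: v) (encEnv (η ++ List.replicate (width n τ) false :: θ))
        (.var :: .pr :: .lam .zero :: c) (encodeTS T) [] [] [] []) (iterTime q b - 3) := by
  have h1 := run_enter T η ([] :: θ) b τ hn h hτ r l v c
  set l' := (encodeTy τ).reverse ++ ((encodeNum η.length).reverse ++ .state ∅ :: l)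
  have h2 := run_mvBits (k := Stk.V) (k' := .E) (by decide) (List.replicate (width n τ) false)
    (S := st r l' (bits (List.replicate (width n τ) false) ++ .fin :: v) (encEnv ([] :: θ)) c
      (encodeTS T) (encEnv η).reverse [] [] []) rfl
  have h3 := run_restoreEnv η (List.replicate (width n τ) false :: θ) b h r l' v c (encodeTS T)
    [] [] []
  refine Run.to (Run.seq h1 (Run.seq h2 (Run.seq (Run.cast h3 ?_ rfl le_rfl) (Run.pushSeq
    (Run.pushSeq (Run.pushSeq (.push _ _ _))))))) ?_ ?_
  · simp
  · simp
  · have e1 := Nat.mul_le_mul hq (le_refl (2 * b + 5))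
    have e2 := Nat.mul_le_mul hq (le_refl (b + 1))
    have e3 : 5 * n * n ≤ 5 * b * b := by gcongr
    have e4 := Nat.mul_le_mul hq'
      (show 11 * b + 5 * n * n + 5 * n + 10 ≤ 11 * b + 5 * b * b + 5 * b + 10 by omega)
    rw [List.length_replicate]
    refine Nat.le_sub_of_add_le (le_iterTime ?_)
    nlinarith [Nat.zero_le (q * b), Nat.zero_le (q * b * b), Nat.zero_le (b * b)]

theorem run_muEnter (hn : 0 < n) (hnb : n ≤ b) (h : ∀ x ∈ η, x.length ≤ b)
    (hτ : width n τ ≤ b) (hq : η.length ≤ q)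
    (hq' : (encodeTy τ : List (Symb P A)).length ≤ q)
    (r l v c : List (Symb P A)) :
    Run muEnter (st (encodeNum η.length ++ (encodeTy τ ++ r)) l v (encEnv (η ++ [] :: θ)) c
        (encodeTS T) [] [] [] [])
      (st r ((encodeTy τ).reverse ++ ((encodeNum η.length).reverse ++ .state ∅ :: l))
        v (encEnv (η ++ List.replicate (width n τ) false :: θ))
        (.var :: .pr :: .mu :: (List.replicate (width n τ) .tick ++ .fin :: c))
        (encodeTS T) [] [] [] []) (iterTime q b - 3) := by
  have h1 := run_enter T η ([] :: θ) b τ hn h hτ r l v c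
  set l' := (encodeTy τ).reverse ++ ((encodeNum η.length).reverse ++ .state ∅ :: l)
  have h2 := run_untl (k := Stk.V) (isEnd := isFin) (rest := v) (z := .fin)
    (f := fun b : Symb P A => .push .E b ;; .push .C .tick) bit
    (fun d z => st r l' (bits z ++ .fin :: v) (bits d ++ .fin :: encEnv θ)
      (d.map (fun _ => .tick) ++ .fin :: c) (encodeTS T) (encEnv η).reverse [] [] []) 2
    (fun d t => rfl) rfl
    (fun d a t _ => Run.to (Run.pushSeq (.push _ _ _)) (by simp [bits]) le_rfl)
    (List.replicate (width n τ) false) (by simp)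
  have h3 := run_restoreEnv η (List.replicate (width n τ) false :: θ) b h r l' v
    (List.replicate (width n τ) .tick ++ .fin :: c) (encodeTS T) [] [] []
  refine Run.to (Run.seq h1 (Run.pushSeq (Run.seq (Run.cast h2 ?_ rfl le_rfl)
    (Run.seq (Run.cast h3 ?_ rfl le_rfl) (Run.pushSeq
    (Run.pushSeq (.push _ _ _))))))) ?_ ?_
  · simp
  · simp
  · simp
  · have e1 := Nat.mul_le_mul hq (le_refl (2 * b + 5))
    have e2 := Nat.mul_le_mul hq (le_refl (b + 1))
    have e3 : 5 * n * n ≤ 5 * b * b := by gcongr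
    have e4 := Nat.mul_le_mul hq'
      (show 11 * b + 5 * n * n + 5 * n + 10 ≤ 11 * b + 5 * b * b + 5 * b + 10 by omega)
    rw [List.length_replicate]
    refine Nat.le_sub_of_add_le (le_iterTime ?_)
    nlinarith [Nat.zero_le (q * b), Nat.zero_le (q * b * b), Nat.zero_le (b * b)]

variable (num : ℕ → ℕ) (φ : Form P A)

/-- The common beginning of the two cases below: the new slice `y` is put in front of the slices `z`
of smaller indices, so a finished table lists the largest index first. -/
theorem run_lamReturn_start (h : ∀ x ∈ η, x.length ≤ b) (y z x : List Bool)
    (r l v c s w : List (Symb P A)) {S' : Store Stk (Symb P A)} {k : ℕ}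
    (hS : Run (incrE (restoreEnv ;; .push .C (.lam .zero) ;; .push .C .var) leave)
      (st (encodeFormWith num φ ++ r)
        ((encodeTy τ).reverse ++ ((encodeNum η.length).reverse ++ .state ∅ :: l))
        (bits (y ++ z) ++ .fin :: v) (encEnv (x :: θ)) c s (encEnv η).reverse [] w []) S' k) :
    Run lamReturn (st r ((encodeFormWith num φ).reverse ++
        ((encodeTy τ).reverse ++ ((encodeNum η.length).reverse ++ .state ∅ :: l)))
        (bits y ++ .fin :: (bits z ++ .fin :: v)) (encEnv (η ++ x :: θ)) c s [] [] w [])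
      S' (4 * y.length + 2 + (η.length * (2 * b + 7) + 9 * (encodeTy τ : List (Symb P A)).length +
        2 * (encodeFormWith num φ).length + 20) + k) := by
  set l' := (encodeFormWith num φ).reverse ++
        ((encodeTy τ).reverse ++ ((encodeNum η.length).reverse ++ .state ∅ :: l)) with hl'
  have h1 := run_mvBits (k := Stk.V) (k' := .U) (by decide) y
    (S := st r l' (bits y ++ .fin :: (bits z ++ .fin :: v)) (encEnv (η ++ x :: θ)) c s [] [] w [])
    rfl
  have h2 := run_mvAllBits (k := Stk.U) (k' := .V) (by decide) y.reverse
    (S := st r l' (bits z ++ .fin :: v) (encEnv (η ++ x :: θ)) c s [] (bits y.reverse) w [])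
    rfl
  have h3 := run_reenter η (x :: θ) b τ h num φ r l (bits (y ++ z) ++ .fin :: v) c s w
  refine Run.to (Run.seq h1 (Run.seq (Run.cast h2 ?_ rfl le_rfl) (Run.seq
    (Run.cast h3 ?_ rfl le_rfl) hS))) rfl ?_
  · simp
  · simp [hl']
  · rw [List.length_reverse]
    linarith

theorem run_lamReturn_next (h : ∀ x ∈ η, x.length ≤ b) (y z x x' : List Bool)
    (hx : incr x = some x') (hy : y.length ≤ b) (hxb : x.length ≤ b)
    (hq : η.length + (encodeTy τ : List (Symb P A)).length + (encodeFormWith num φ).length ≤ q)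
    (r l v c s w : List (Symb P A)) :
    Run lamReturn (st r ((encodeFormWith num φ).reverse ++
        ((encodeTy τ).reverse ++ ((encodeNum η.length).reverse ++ .state ∅ :: l)))
        (bits y ++ .fin :: (bits z ++ .fin :: v)) (encEnv (η ++ x :: θ)) c s [] [] w [])
      (st (encodeFormWith num φ ++ r)
        ((encodeTy τ).reverse ++ ((encodeNum η.length).reverse ++ .state ∅ :: l))
        (bits (y ++ z) ++ .fin :: v) (encEnv (η ++ x' :: θ)) (.var :: .lam .zero :: c) s [] [] w [])
      (iterTime q b - 1) := by
  have h1 := run_restoreEnv η (x' :: θ) b h (encodeFormWith num φ ++ r)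
    ((encodeTy τ).reverse ++ ((encodeNum η.length).reverse ++ .state ∅ :: l))
    (bits (y ++ z) ++ .fin :: v) c s [] w []
  have h2 := run_incrE_some (restoreEnv ;; .push .C (.lam .zero) ;; .push .C .var) leave x x' 0 hx
    (encodeFormWith num φ ++ r)
    ((encodeTy τ).reverse ++ ((encodeNum η.length).reverse ++ .state ∅ :: l))
    (bits (y ++ z) ++ .fin :: v) (.fin :: encEnv θ) c s (encEnv η).reverse w []
    (Run.seq (Run.cast h1 (by simp) rfl le_rfl) (Run.pushSeq (.push _ _ _)))
  refine Run.to (run_lamReturn_start η θ τ num φ h y z x r l v c s w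
    (Run.cast h2 (by simp) rfl le_rfl)) (by simp) ?_
  have e1 := Nat.mul_le_mul (show η.length ≤ q by omega) (le_refl (2 * b + 7))
  have e2 := Nat.mul_le_mul (show η.length ≤ q by omega) (le_refl (b + 1))
  refine Nat.le_sub_of_add_le (le_iterTime ?_)
  nlinarith [Nat.zero_le (q * b), Nat.zero_le (q * b * b), Nat.zero_le (b * b)]

theorem run_lamReturn_last (h : ∀ x ∈ η, x.length ≤ b) (y z x : List Bool)
    (hx : incr x = none) (hy : y.length ≤ b) (hxb : x.length ≤ b)
    (hq : η.length + (encodeTy τ : List (Symb P A)).length + (encodeFormWith num φ).length ≤ q)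
    (r l v c s w : List (Symb P A)) :
    Run lamReturn (st (.edge ∅ :: r) ((encodeFormWith num φ).reverse ++
        ((encodeTy τ).reverse ++ ((encodeNum η.length).reverse ++ .state ∅ :: l)))
        (bits y ++ .fin :: (bits z ++ .fin :: v)) (encEnv (η ++ x :: θ)) c s [] [] w [])
      (st r ((encodeFormWith num φ).reverse ++
        ((encodeTy τ).reverse ++ ((encodeNum η.length).reverse ++ l)))
        (bits (y ++ z) ++ .fin :: v) (encEnv (η ++ [] :: θ)) c s [] [] w [])
      (iterTime q b - 1) := by
  have h1 := run_leave η θ b τ h num φ r l (bits (y ++ z) ++ .fin :: v) c s w []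
  have h2 := run_incrE_none (restoreEnv ;; .push .C (.lam .zero) ;; .push .C .var) leave x [] hx
    (encodeFormWith num φ ++ .edge ∅ :: r)
    ((encodeTy τ).reverse ++ ((encodeNum η.length).reverse ++ .state ∅ :: l))
    (bits (y ++ z) ++ .fin :: v) (encEnv θ) c s (encEnv η).reverse w [] h1
  refine Run.to (run_lamReturn_start η θ τ num φ h y z x (.edge ∅ :: r) l v c s w
    (Run.cast h2 (by simp) rfl le_rfl)) rfl ?_
  have e1 := Nat.mul_le_mul (show η.length ≤ q by omega) (le_refl (2 * b + 7))
  have e2 := Nat.mul_le_mul (show η.length ≤ q by omega) (le_refl (2 * b + 6))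
  refine Nat.le_sub_of_add_le (le_iterTime ?_)
  rw [List.length_nil]
  nlinarith [Nat.zero_le (q * b), Nat.zero_le (q * b * b), Nat.zero_le (b * b)]

theorem run_muReturn_next (h : ∀ x ∈ η, x.length ≤ b) (y x : List Bool)
    (hy : y.length ≤ b) (hxb : x.length ≤ b)
    (hq : η.length + (encodeTy τ : List (Symb P A)).length + (encodeFormWith num φ).length ≤ q)
    (r l v c s w : List (Symb P A)) :
    Run muReturn (st r ((encodeFormWith num φ).reverse ++
        ((encodeTy τ).reverse ++ ((encodeNum η.length).reverse ++ .state ∅ :: l)))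
        (bits y ++ .fin :: v) (encEnv (η ++ x :: θ)) (.tick :: c) s [] [] w [])
      (st (encodeFormWith num φ ++ r)
        ((encodeTy τ).reverse ++ ((encodeNum η.length).reverse ++ .state ∅ :: l))
        v (encEnv (η ++ y :: θ)) (.var :: .mu :: c) s [] [] w [])
      (iterTime q b - 1) := by
  have h1 := run_reenter η (x :: θ) b τ h num φ r l (bits y ++ .fin :: v) (.tick :: c) s w
  set r' := encodeFormWith num φ ++ r
  set l' := (encodeTy τ).reverse ++ ((encodeNum η.length).reverse ++ .state ∅ :: l)
  have h2 := run_dropBits (k := Stk.E) x (rest := encEnv θ)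
    (S := st r' l' (bits y ++ .fin :: v) (encEnv (x :: θ)) (.tick :: c) s (encEnv η).reverse [] w [])
    (by simp)
  have h3 := run_mvBits (k := Stk.V) (k' := .U) (by decide) y
    (S := st r' l' (bits y ++ .fin :: v) (.fin :: encEnv θ) c s (encEnv η).reverse [] w []) rfl
  have h4 := run_mvAllBits (k := Stk.U) (k' := .E) (by decide) y.reverse
    (S := st r' l' v (.fin :: encEnv θ) c s (encEnv η).reverse (bits y.reverse) w []) rfl
  have h5 := run_restoreEnv η (y :: θ) b h r' l' v c s [] w []
  refine Run.to (Run.seq h1 (Run.seq h2 (run_popc (a := Symb.tick) (l := c) ?_ (Run.pushSeq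
    (Run.seq (Run.cast h3 ?_ rfl le_rfl) (Run.seq (Run.cast h4 ?_ rfl le_rfl)
      (Run.seq (Run.cast h5 ?_ rfl le_rfl) (Run.pushSeq (.push _ _ _))))))))) ?_ ?_
  · simp
  · simp
  · simp
  · simp
  · simp
  · have e1 := Nat.mul_le_mul (show η.length ≤ q by omega) (le_refl (2 * b + 7))
    have e2 := Nat.mul_le_mul (show η.length ≤ q by omega) (le_refl (b + 1))
    rw [List.length_reverse]
    refine Nat.le_sub_of_add_le (le_iterTime ?_)
    nlinarith [Nat.zero_le (q * b), Nat.zero_le (q * b * b), Nat.zero_le (b * b)]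

theorem run_muReturn_last (h : ∀ x ∈ η, x.length ≤ b) (y x : List Bool)
    (hxb : x.length ≤ b)
    (hq : η.length + (encodeTy τ : List (Symb P A)).length + (encodeFormWith num φ).length ≤ q)
    (r l v c s w : List (Symb P A)) :
    Run muReturn (st (.edge ∅ :: r) ((encodeFormWith num φ).reverse ++
        ((encodeTy τ).reverse ++ ((encodeNum η.length).reverse ++ .state ∅ :: l)))
        (bits y ++ .fin :: v) (encEnv (η ++ x :: θ)) (.fin :: c) s [] [] w [])
      (st r ((encodeFormWith num φ).reverse ++
        ((encodeTy τ).reverse ++ ((encodeNum η.length).reverse ++ l)))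
        (bits y ++ .fin :: v) (encEnv (η ++ [] :: θ)) c s [] [] w [])
      (iterTime q b - 1) := by
  have h1 := run_reenter η (x :: θ) b τ h num φ (.edge ∅ :: r) l (bits y ++ .fin :: v)
    (.fin :: c) s w
  have h2 := run_dropBits (k := Stk.E) x (rest := encEnv θ)
    (S := st (encodeFormWith num φ ++ .edge ∅ :: r)
      ((encodeTy τ).reverse ++ ((encodeNum η.length).reverse ++ .state ∅ :: l))
      (bits y ++ .fin :: v) (encEnv (x :: θ)) (.fin :: c) s (encEnv η).reverse [] w [])
    (by simp)
  have h3 := run_leave η θ b τ h num φ r l (bits y ++ .fin :: v) c s w []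
  refine Run.to (Run.seq h1 (Run.seq h2 (run_popc (a := Symb.fin) (l := c) ?_
    (Run.cast h3 ?_ rfl le_rfl)))) rfl ?_
  · simp
  · simp
  · have e1 := Nat.mul_le_mul (show η.length ≤ q by omega) (le_refl (2 * b + 7))
    have e2 := Nat.mul_le_mul (show η.length ≤ q by omega) (le_refl (2 * b + 6))
    refine Nat.le_sub_of_add_le (le_iterTime ?_)
    nlinarith [Nat.zero_le (q * b), Nat.zero_le (q * b * b), Nat.zero_le (b * b)]

end Binder

/-! ### Evaluation of formulas to words -/

open Classical in
/-- The value of a formula as a word, where the variable `i` has the value `η[i]`. -/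
noncomputable def ev {n : ℕ} (T : TS P A (Fin n)) : Form P A → List (List Bool) → List Bool
  | .prop q, _ => (((List.finRange n).map T.label).map fun Q => decide (q ∈ Q)).reverse
  | .var i, η => η.getD i []
  | .neg φ, η => (ev T φ η).map not
  | .or φ ψ, η => List.zipWith or (ev T φ η) (ev T ψ η)
  | .dia a φ, η => ((rowsOf T).map fun p => rowBit a p.2 (ev T φ η).reverse).reverse
  | .app φ ψ, η => sel (ev T φ η) (ev T ψ η)
  | .lam i _ σ φ, η => (List.range (2 ^ width n σ)).reverse.flatMap fun j =>
      ev T φ (η.set i (digits (width n σ) j))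
  | .mu i τ φ, η =>
      (fun x => ev T φ (η.set i x))^[width n τ + 1] (List.replicate (width n τ) false)

/-- Typing, without variances. -/
inductive WT (U : Ty → Prop) : (ℕ → Option Ty) → Form P A → Ty → Prop
  | prop (Δ q) : WT U Δ (.prop q) .pr
  | var (Δ i τ) : Δ i = some τ → WT U Δ (.var i) τ
  | neg (Δ φ τ) : WT U Δ φ τ → WT U Δ (.neg φ) τ
  | or (Δ φ ψ) : WT U Δ φ .pr → WT U Δ ψ .pr → WT U Δ (.or φ ψ) .pr
  | dia (Δ a φ) : WT U Δ φ .pr → WT U Δ (.dia a φ) .pr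
  | lam (Δ i v σ τ φ) : Δ i = none → WT U (Function.update Δ i (some σ)) φ τ →
      U (.arr σ v τ) → WT U Δ (.lam i v σ φ) (.arr σ v τ)
  | app (Δ φ ψ σ v τ) : WT U Δ φ (.arr σ v τ) → WT U Δ ψ σ → U (.arr σ v τ) →
      WT U Δ (.app φ ψ) τ
  | mu (Δ i τ φ) : Δ i = none → WT U (Function.update Δ i (some τ)) φ τ → U τ →
      WT U Δ (.mu i τ φ) τ

/-- The words of an environment have the lengths that the types of the variables require. -/
def Conf (n : ℕ) (Δ : ℕ → Option Ty) (η : List (List Bool)) : Prop :=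
  ∀ i, (η.getD i []).length = (Δ i).elim 0 (width n)

theorem getD_set {α : Type} (η : List α) (i j : ℕ) (x d : α) (hi : i < η.length) :
    (η.set i x).getD j d = if i = j then x else η.getD j d := by
  rw [List.getD_eq_getElem?_getD, List.getD_eq_getElem?_getD, List.getElem?_set]
  split_ifs <;> simp_all

theorem Conf.set {n : ℕ} {Δ : ℕ → Option Ty} {η : List (List Bool)} (h : Conf n Δ η) {i : ℕ}
    (hi : i < η.length) (x : List Bool) (σ : Ty) (hx : x.length = width n σ) :
    Conf n (Function.update Δ i (some σ)) (η.set i x) := by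
  intro j
  rw [getD_set _ _ _ _ _ hi]
  by_cases hij : i = j
  · subst hij
    simp [hx]
  · rw [if_neg hij, Function.update_of_ne (Ne.symm hij)]
    exact h j

/-- Lengths depend on typing only, not on whether the words represent anything. This keeps the
slices aligned also at argument words without meaning. -/
theorem ev_length {n : ℕ} (T : TS P A (Fin n)) {U : Ty → Prop} {Δ : ℕ → Option Ty}
    {φ : Form P A} {τ : Ty} (h : WT U Δ φ τ) :
    ∀ η, Conf n Δ η → (∀ i ∈ φ.vars, i < η.length) → (ev T φ η).length = width n τ := by
  induction h with
  | prop Δ q => intro η _ _; simp [ev, width]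
  | var Δ i τ hi => intro η hη _; rw [ev, hη, hi]; rfl
  | neg Δ φ τ _ ih => intro η hη hv; rw [ev, List.length_map, ih η hη hv]
  | or Δ φ ψ _ _ ih₁ ih₂ =>
    intro η hη hv
    rw [ev, List.length_zipWith, ih₁ η hη fun i hi => hv i (by simp [Form.vars, hi]),
      ih₂ η hη fun i hi => hv i (by simp [Form.vars, hi]), min_self]
  | dia Δ a φ _ ih => intro η _ _; simp [ev, width, rowsOf]
  | lam Δ i v σ τ φ _ _ _ ih =>
    intro η hη hv
    have h1 : ∀ j, (ev T φ (η.set i (digits (width n σ) j))).length = width n τ := fun j =>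
      ih _ (hη.set (hv i (by simp [Form.vars])) _ _ (by simp))
        fun k hk => by rw [List.length_set]; exact hv k (by simp [Form.vars, hk])
    simp [ev, List.length_flatMap, h1, width]
  | app Δ φ ψ σ v τ _ _ _ ih₁ ih₂ =>
    intro η hη hv
    refine sel_length _ _ _ ?_
    rw [ih₁ η hη fun i hi => hv i (by simp [Form.vars, hi]),
      ih₂ η hη fun i hi => hv i (by simp [Form.vars, hi])]
    rfl
  | mu Δ i τ φ _ _ _ ih =>
    intro η hη hv
    rw [ev, Function.iterate_succ_apply']
    have h1 : ∀ x : List Bool, x.length = width n τ →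
        (ev T φ (η.set i x)).length = width n τ := fun x hx =>
      ih _ (hη.set (hv i (by simp [Form.vars])) _ _ hx)
        fun k hk => by rw [List.length_set]; exact hv k (by simp [Form.vars, hk])
    refine h1 _ ?_
    generalize width n τ = w at h1
    clear ih
    suffices ∀ m, ((fun x => ev T φ (η.set i x))^[m] (List.replicate w false)).length = w from
      this w
    intro m
    induction m with
    | zero => simp
    | succ m ihm => rw [Function.iterate_succ_apply']; exact h1 _ ihm

/-- A bound for the number of iterations of the main loop. -/
def iterations (b : ℕ) : Form P A → ℕ
  | .prop _ | .var _ => 1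
  | .neg φ | .dia _ φ => iterations b φ + 2
  | .or φ ψ | .app φ ψ => iterations b φ + iterations b ψ + 2
  | .lam _ _ _ φ | .mu _ _ φ => (b + 1) * (iterations b φ + 1) + 2

/-- The three steps besides `dispatch` are popping the control symbol, popping the formula symbol
and pushing it on `L`. -/
theorem run_main_step {r l v e c s t u w x : List (Symb P A)} (a : Symb P A)
    {S₁ S' : Store Stk (Symb P A)} {m t₁ k : ℕ}
    (h₁ : Run (dispatch a) (st r (a :: l) v e c s t u w x) S₁ t₁) (ht : t₁ ≤ m - 3) (hm : 3 ≤ m)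
    (h₂ : Run mainLoop S₁ S' k) :
    Run mainLoop (st (a :: r) l v e (.var :: c) s t u w x) S' (m + k) := by
  refine Run.to (run_whileNE_cons (a := Symb.var) (l := c) rfl (run_popc (a := a) (l := r) ?_
    (Run.pushSeq (Run.cast h₁ ?_ rfl le_rfl))) h₂) rfl ?_
  · simp
  · simp
  · omega

theorem run_main_return {r l v e c s t u w x : List (Symb P A)} (a : Symb P A)
    {S₁ S' : Store Stk (Symb P A)} {m t₁ k : ℕ}
    (h₁ : Run (handle a) (st r l v e c s t u w x) S₁ t₁) (ht : t₁ ≤ m - 1) (hm : 1 ≤ m)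
    (h₂ : Run mainLoop S₁ S' k) :
    Run mainLoop (st r l v e (a :: c) s t u w x) S' (m + k) := by
  refine Run.to (run_whileNE_cons (a := a) (l := c) rfl (Run.cast h₁ ?_ rfl le_rfl) h₂) rfl ?_
  · simp
  · omega

/-- Binders only bind variables that are not yet in the context, so the slot of the variable is
empty: there is no old value to be saved. -/
theorem Conf.split {n : ℕ} {Δ : ℕ → Option Ty} {η : List (List Bool)} (h : Conf n Δ η) {i : ℕ}
    (hi : i < η.length) (hΔ : Δ i = none) :
    ∃ η₁ η₂, η = η₁ ++ [] :: η₂ ∧ η₁.length = i ∧ ∀ x, η.set i x = η₁ ++ x :: η₂ := by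
  refine ⟨η.take i, η.drop (i + 1), ?_, by simp; omega, fun x => List.set_eq_take_append_cons_drop
    ▸ by simp [hi]⟩
  have h1 := h i
  rw [hΔ, Option.elim_none, List.length_eq_zero_iff, List.getD_eq_getElem _ _ hi] at h1
  rw [← h1]
  simp

theorem iterTime_ge (q b : ℕ) : 100 ≤ iterTime q b := by
  unfold iterTime
  nlinarith [Nat.zero_le (q * (b + 1) ^ 2), Nat.one_le_pow 2 (b + 1) (by omega)]

theorem length_le_of_mem_set {η : List (List Bool)} {b i : ℕ} {x : List Bool}
    (hη : ∀ x ∈ η, x.length ≤ b) (hx : x.length ≤ b) : ∀ y ∈ η.set i x, y.length ≤ b := by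
  intro y hy
  rcases List.mem_or_eq_of_mem_set hy with h | rfl
  · exact hη y h
  · exact hx

/-- The rule of `WT` for variables does not mention `U`; there the bound comes from the word that
the environment holds. -/
theorem WT.width_le {n b : ℕ} {U : Ty → Prop} (hn : 0 < n) (hnb : n ≤ b)
    (hU : ∀ τ, U τ → width n τ ≤ b) {Δ : ℕ → Option Ty} {φ : Form P A} {τ : Ty}
    (h : WT U Δ φ τ) {η : List (List Bool)} (hη : Conf n Δ η) (hb : ∀ x ∈ η, x.length ≤ b) :
    width n τ ≤ b := by
  induction h with
  | prop | or | dia => exact hnb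
  | var Δ i τ hi =>
    have h1 := hη i
    rw [hi, Option.elim_some] at h1
    have h2 := width_pos hn τ
    have hlt : i < η.length := by
      by_contra hlt
      rw [List.getD_eq_default _ _ (by omega)] at h1
      simp at h1
      omega
    rw [← h1, List.getD_eq_getElem _ _ hlt]
    exact hb _ (List.getElem_mem _)
  | neg Δ φ τ _ ih => exact ih hη
  | lam Δ i v σ τ φ _ _ h' => exact hU _ h'
  | mu Δ i τ φ _ _ h' => exact hU _ h'
  | app Δ φ ψ σ v τ _ _ h' => exact (Nat.le_mul_of_pos_left _ (by positivity)).trans (hU _ h')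

/-- The simulation, again in continuation form: any run that starts with the formula passed and its
value on `V` extends to a run that starts in front of the formula with the request `.var` on the
control stack. In this form the induction hypotheses for subformulas chain from the last action back
to the first, which is the order in which the proofs build the runs. -/
theorem run_mainLoop {n : ℕ} (hn : 0 < n) (T : TS P A (Fin n)) {U : Ty → Prop} {b q : ℕ}
    (hnb : n ≤ b) (hU : ∀ τ, U τ → width n τ ≤ b) {Δ : ℕ → Option Ty} {φ : Form P A} {τ : Ty}
    (h : WT U Δ φ τ) :
    ∀ η, Conf n Δ η → (∀ x ∈ η, x.length ≤ b) → (∀ i ∈ φ.vars, i < η.length) →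
    (encodeFormWith id φ).length ≤ q →
    ∀ (r l v c : List (Symb P A)) (S' : Store Stk (Symb P A)) (k : ℕ),
    Run mainLoop (st r ((encodeFormWith id φ).reverse ++ l) (bits (ev T φ η) ++ .fin :: v)
      (encEnv η) c (encodeTS T) [] [] [] []) S' k →
    Run mainLoop (st (encodeFormWith id φ ++ r) l v (encEnv η) (.var :: c) (encodeTS T)
      [] [] [] []) S' (iterTime q b * iterations b φ + k) := by
  have h100 := iterTime_ge q b
  have hnn : n * n ≤ b * b := Nat.mul_le_mul hnb hnb
  induction h with
  | prop Δ p =>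
    intro η hη hb hv hq r l v c S' k hS
    have h1 : Run (dispatch (.prop p)) (st r (.prop p :: l) v (encEnv η) c (encodeTS T) [] [] [] [])
        (st r ((encodeFormWith id (.prop p)).reverse ++ l) (bits (ev T (.prop p) η) ++ .fin :: v)
          (encEnv η) c (encodeTS T) [] [] [] []) (5 * (n * (n + 1)) + 2 + 1) := by
      refine Run.pushSeq (Run.cast (run_scan _ r (.prop p :: l) (.fin :: v) (encEnv η) c
        (encodeTS T) [] [] []) (by simp) ?_ (by rw [encodeTS_length]))
      rw [filterMap_labelOf_encodeTS]
      rfl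
    refine Run.mono (run_main_step (m := iterTime q b) (.prop p) h1 ?_ (by omega) hS)
      (by simp [iterations])
    refine Nat.le_sub_of_add_le (le_iterTime ?_)
    nlinarith [Nat.zero_le (q * b), Nat.zero_le (q * b * b), Nat.zero_le (b * b)]
  | var Δ i τ hi =>
    intro η hη hb hv hq r l v c S' k hS
    have hlt : i < η.length := hv i (by simp [Form.vars])
    have hsp : η = η.take i ++ η.getD i [] :: η.drop (i + 1) := by
      rw [List.getD_eq_getElem _ _ hlt]
      simp
    have hli : (η.take i).length = i := by simp; omega
    have hy : (η.getD i []).length ≤ b := by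
      rw [List.getD_eq_getElem _ _ hlt]
      exact hb _ (List.getElem_mem _)
    have h1 := run_varV (P := P) (A := A) (η.take i) (η.drop (i + 1)) (η.getD i []) b
      (fun x hx => hb x (List.mem_of_mem_take hx)) hy r (.var :: l) v c (encodeTS T) [] []
    rw [← hsp, hli] at h1
    have hiq : i ≤ q := by
      refine le_trans ?_ hq
      simp [encodeFormWith, encodeNum]
      omega
    refine Run.mono (run_main_step (m := iterTime q b) (.var) h1 ?_ (by omega)
      (Run.cast hS ?_ rfl le_rfl)) (by simp [iterations])
    · have e1 := Nat.mul_le_mul hiq (le_refl (4 * b + 7))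
      refine Nat.le_sub_of_add_le (le_iterTime ?_)
      nlinarith [Nat.zero_le (q * b), Nat.zero_le (q * b * b), Nat.zero_le (b * b)]
    · simp [encodeFormWith, ev]
  | neg Δ φ τ hφ ih =>
    intro η hη hb hv hq r l v c S' k hS
    have hl := hφ.width_le hn hnb hU hη hb
    rw [← ev_length T hφ η hη hv] at hl
    have h2 := run_main_return (m := iterTime q b) .neg (run_negV (ev T φ η) r
      ((encodeFormWith id φ).reverse ++ .neg :: l) v (encEnv η) c (encodeTS T) [] [] [])
      (by
        refine Nat.le_sub_of_add_le (le_iterTime ?_)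
        nlinarith [Nat.zero_le (q * b), Nat.zero_le (q * b * b), Nat.zero_le (b * b)])
      (by omega) (Run.cast hS (by simp [encodeFormWith, ev]) rfl le_rfl)
    have h1 := ih η hη hb hv (by simp [encodeFormWith] at hq; omega) r (.neg :: l) v (.neg :: c) S' _
      h2
    refine Run.mono (run_main_step (m := iterTime q b) .neg (Run.pushSeq (.push _ _ _)) (by omega)
      (by omega) (Run.cast h1 ?_ rfl le_rfl)) ?_
    · simp
    · rw [iterations]
      linarith
  | or Δ φ ψ hφ hψ ih₁ ih₂ =>
    intro η hη hb hv hq r l v c S' k hS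
    simp only [encodeFormWith, List.length_cons, List.length_append] at hq
    have hv₁ : ∀ i ∈ φ.vars, i < η.length := fun i hi => hv i (by simp [Form.vars, hi])
    have hv₂ : ∀ i ∈ ψ.vars, i < η.length := fun i hi => hv i (by simp [Form.vars, hi])
    have hl₁ := ev_length T hφ η hη hv₁
    have hl₂ := ev_length T hψ η hη hv₂
    have h3 := run_main_return (m := iterTime q b) .or (run_orV (ev T φ η) (ev T ψ η)
      (by rw [hl₁, hl₂]) r ((encodeFormWith id ψ).reverse ++ ((encodeFormWith id φ).reverse ++
        .or :: l)) v (encEnv η) c (encodeTS T) [] [])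
      (by
        rw [hl₁]
        change 7 * n + 4 ≤ _
        refine Nat.le_sub_of_add_le (le_iterTime ?_)
        nlinarith [Nat.zero_le (q * b), Nat.zero_le (q * b * b), Nat.zero_le (b * b)])
      (by omega) (Run.cast hS (by simp [encodeFormWith, ev]) rfl le_rfl)
    have h2 := ih₂ η hη hb hv₂ (by omega) r _ _ (.or :: c) S' _ h3
    have h1 := ih₁ η hη hb hv₁ (by omega) (encodeFormWith id ψ ++ r) (.or :: l) v
      (.var :: .or :: c) S' _ h2
    refine Run.mono (run_main_step (m := iterTime q b) .or (Run.pushSeq (Run.pushSeq (.push _ _ _)))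
      (by omega) (by omega) (Run.cast h1 ?_ rfl le_rfl)) ?_
    · simp
    · rw [iterations]
      linarith
  | dia Δ a φ hφ ih =>
    intro η hη hb hv hq r l v c S' k hS
    have hl := ev_length T hφ η hη hv
    have h2 := run_main_return (m := iterTime q b) (.dia a) (run_diaV a T (ev T φ η) hl r
      ((encodeFormWith id φ).reverse ++ .dia a :: l) v (encEnv η) c [])
      (by
        refine Nat.le_sub_of_add_le (le_iterTime ?_)
        nlinarith [Nat.zero_le (q * b), Nat.zero_le (q * b * b), Nat.zero_le (b * b)])
      (by omega) (Run.cast hS (by simp [encodeFormWith, ev]) rfl le_rfl)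
    have h1 := ih η hη hb hv (by simp [encodeFormWith] at hq; omega) r (.dia a :: l) v
      (.dia a :: c) S' _ h2
    refine Run.mono (run_main_step (m := iterTime q b) (.dia a) (Run.pushSeq (.push _ _ _))
      (by omega) (by omega) (Run.cast h1 ?_ rfl le_rfl)) ?_
    · simp
    · rw [iterations]
      linarith
  | lam Δ i v σ τ φ hi hφ hUτ ih =>
    intro η hη hb hv hq r l v' c S' k hS
    have hilt : i < η.length := hv i (by simp [Form.vars])
    have hvφ : ∀ x, ∀ j ∈ φ.vars, j < (η.set i x).length := fun x j hj => by
      rw [List.length_set]; exact hv j (by simp [Form.vars, hj])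
    obtain ⟨η₁, η₂, rfl, rfl, hset⟩ := hη.split hilt hi
    have hb₁ : ∀ x ∈ η₁, x.length ≤ b := fun x hx => hb x (by simp [hx])
    have hw : 2 ^ width n σ ≤ b :=
      (Nat.le_mul_of_pos_right _ (width_pos hn τ)).trans (hU _ hUτ)
    have hw' : width n σ ≤ b := Nat.lt_two_pow_self.le.trans hw
    have hwτ : width n τ ≤ b := (Nat.le_mul_of_pos_left _ (by positivity)).trans (hU _ hUτ)
    simp only [encodeFormWith, List.length_cons, List.length_append, encodeNum, id,
      List.length_replicate, List.length_nil] at hq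
    have hconf := fun j => hη.set hilt (digits (width n σ) j) σ (by simp)
    have hlen := fun j => ev_length T hφ _ (hconf j) (hvφ _)
    have hbset := fun j => length_le_of_mem_set (i := η₁.length) hb
      (show (digits (width n σ) j).length ≤ b by simpa using hw')
    set l' := (encodeTy σ).reverse ++ ((encodeNum η₁.length).reverse ++
      .state ∅ :: .lam v :: l) with hl'
    set F := fun j => ev T φ (η₁ ++ digits (width n σ) j :: η₂) with hF
    have hFl : ∀ j, (F j).length ≤ b := fun j => by
      have := hlen j
      rw [hset] at this
      exact this.le.trans hwτ
    -- The state after the body has been evaluated for the argument word number `j`; `m` argument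
    -- words are left.
    have claim : ∀ m j, j + m + 1 = 2 ^ width n σ →
        Run mainLoop (st (.edge ∅ :: r) ((encodeFormWith id φ).reverse ++ l')
          (bits (F j) ++ .fin :: (bits ((List.range j).reverse.flatMap F) ++ .fin :: v'))
          (encEnv (η₁ ++ digits (width n σ) j :: η₂)) (.lam .zero :: c) (encodeTS T) [] [] [] []) S'
          (iterTime q b * (m * (iterations b φ + 1) + 1) + k) := by
      intro m
      induction m with
      | zero =>
        intro j hj
        have hin := incr_digits (width n σ) j (by omega)
        rw [if_neg (by omega)] at hin
        refine Run.mono (run_main_return (m := iterTime q b) (.lam .zero)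
          (run_lamReturn_last η₁ η₂ σ id φ hb₁ (F j) _ _ hin
            (hFl j) (by simpa using hw') (q := q) (by omega) r
            (.lam v :: l) v' c (encodeTS T) []) le_rfl (by omega) (Run.cast hS ?_ rfl le_rfl)) ?_
        · simp only [encodeFormWith, ev, ← hj, List.range_succ, hset]
          simp [hF]
        · simp
      | succ m ihm =>
        intro j hj
        have hin := incr_digits (width n σ) j (by omega)
        rw [if_pos (by omega)] at hin
        have h2 := ihm (j + 1) (by omega)
        rw [← hset] at h2
        have h1 := ih _ (hconf (j + 1)) (hbset (j + 1)) (hvφ _) (by omega) (.edge ∅ :: r) l'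
          (bits ((List.range (j + 1)).reverse.flatMap F) ++ .fin :: v') (.lam .zero :: c) S' _
          (Run.cast h2 (by simp only [hF, hset]) rfl le_rfl)
        refine Run.mono (run_main_return (m := iterTime q b) (.lam .zero)
          (run_lamReturn_next η₁ η₂ σ id φ hb₁ (F j) _ _ _ hin
            (hFl j) (by simpa using hw') (q := q) (by omega)
            (.edge ∅ :: r) (.lam v :: l) v' c (encodeTS T) []) le_rfl (by omega)
            (Run.cast h1 ?_ rfl le_rfl)) ?_
        · simp [List.range_succ, hset, hl']
        · linarith
    have h4 := claim (2 ^ width n σ - 1) 0 (by have := Nat.two_pow_pos (width n σ); omega)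
    -- After the first evaluation of the body its end is known and gets marked on `R`; later rounds
    -- find the mark there.
    have h3 := run_main_return (m := iterTime q b) (.pr) (.push _ _ _) (by omega) (by omega)
      (Run.cast h4 (S₀ := Function.update (st r ((encodeFormWith id φ).reverse ++ l')
          (bits (F 0) ++ .fin :: (bits ((List.range 0).reverse.flatMap F) ++ .fin :: v'))
          (encEnv (η₁ ++ digits (width n σ) 0 :: η₂)) (.lam .zero :: c) (encodeTS T) [] [] [] [])
          .R (.edge ∅ :: r)) (by simp) rfl le_rfl)
    have h2 := ih _ (hconf 0) (hbset 0) (hvφ _) (by omega) r l' (.fin :: v') (.pr :: .lam .zero :: c)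
      S' _ (Run.cast h3 (by simp [hF, hset]) rfl le_rfl)
    refine Run.mono (run_main_step (m := iterTime q b) (.lam v) (run_lamEnter T η₁ η₂ σ hn hnb hb₁
      hw' (q := q) (by omega) (by omega) (encodeFormWith id φ ++ r) (.lam v :: l) v' c) le_rfl
      (by omega) (Run.cast h2 ?_ rfl le_rfl)) ?_ |> fun h => Run.cast h ?_ rfl le_rfl
    · simp [encodeFormWith]
    · simp [hset, digits_zero, hl']
    · obtain ⟨d, hd⟩ : ∃ d, 2 ^ width n σ = d + 1 :=
        Nat.exists_eq_succ_of_ne_zero (by positivity)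
      rw [iterations, hd, Nat.add_sub_cancel]
      have : d + 1 ≤ b + 1 := by omega
      have := Nat.mul_le_mul (le_refl (iterTime q b))
        (Nat.mul_le_mul this (le_refl (iterations b φ + 1)))
      linarith
  | app Δ φ ψ σ v τ hφ hψ hUτ ih₁ ih₂ =>
    intro η hη hb hv hq r l v' c S' k hS
    simp only [encodeFormWith, List.length_cons, List.length_append] at hq
    have hv₁ : ∀ i ∈ φ.vars, i < η.length := fun i hi => hv i (by simp [Form.vars, hi])
    have hv₂ : ∀ i ∈ ψ.vars, i < η.length := fun i hi => hv i (by simp [Form.vars, hi])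
    have hl₁ := ev_length T hφ η hη hv₁
    have hl₂ := ev_length T hψ η hη hv₂
    have hb₁ : (ev T φ η).length ≤ b := by rw [hl₁]; exact hU _ hUτ
    have hb₂ : (ev T ψ η).length ≤ b := by rw [hl₂]; exact hψ.width_le hn hnb hU hη hb
    have h3 := run_main_return (m := iterTime q b) .app (run_appV (ev T φ η) (ev T ψ η)
      (width n τ) (by rw [hl₁, hl₂]; rfl) r ((encodeFormWith id ψ).reverse ++
        ((encodeFormWith id φ).reverse ++ .app :: l)) v' (encEnv η) c (encodeTS T))
      (by
        have := Nat.mul_le_mul hb₂ (show 6 * (ev T φ η).length + 8 ≤ 6 * b + 8 by omega)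
        refine Nat.le_sub_of_add_le (le_iterTime ?_)
        nlinarith [Nat.zero_le (q * b), Nat.zero_le (q * b * b), Nat.zero_le (b * b)])
      (by omega) (Run.cast hS (by simp [encodeFormWith, ev]) rfl le_rfl)
    have h2 := ih₂ η hη hb hv₂ (by omega) r _ _ (.app :: c) S' _ h3
    have h1 := ih₁ η hη hb hv₁ (by omega) (encodeFormWith id ψ ++ r) (.app :: l) v'
      (.var :: .app :: c) S' _ h2
    refine Run.mono (run_main_step (m := iterTime q b) .app
      (Run.pushSeq (Run.pushSeq (.push _ _ _))) (by omega) (by omega)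
      (Run.cast h1 ?_ rfl le_rfl)) ?_
    · simp
    · rw [iterations]
      linarith
  | mu Δ i τ φ hi hφ hUτ ih =>
    intro η hη hb hv hq r l v' c S' k hS
    have hilt : i < η.length := hv i (by simp [Form.vars])
    have hvφ : ∀ x, ∀ j ∈ φ.vars, j < (η.set i x).length := fun x j hj => by
      rw [List.length_set]; exact hv j (by simp [Form.vars, hj])
    obtain ⟨η₁, η₂, rfl, rfl, hset⟩ := hη.split hilt hi
    have hb₁ : ∀ x ∈ η₁, x.length ≤ b := fun x hx => hb x (by simp [hx])
    have hw : width n τ ≤ b := hU _ hUτ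
    simp only [encodeFormWith, List.length_cons, List.length_append, encodeNum, id,
      List.length_replicate, List.length_nil] at hq
    have hconf := fun (x : List Bool) (hx : x.length = width n τ) => hη.set hilt x τ hx
    have hlen := fun x hx => ev_length T hφ _ (hconf x hx) (hvφ _)
    have hbset := fun (x : List Bool) (hx : x.length = width n τ) =>
      length_le_of_mem_set (i := η₁.length) hb (show x.length ≤ b by omega)
    set l' := (encodeTy τ).reverse ++ ((encodeNum η₁.length).reverse ++
      .state ∅ :: .mu :: l) with hl'
    set F := fun x => ev T φ (η₁ ++ x :: η₂) with hF
    have hev : ev T (.mu η₁.length τ φ) (η₁ ++ [] :: η₂) =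
        F^[width n τ + 1] (List.replicate (width n τ) false) := by
      rw [ev]
      simp only [hset, hF]
    -- Here `x` is the current approximation, `F x` has just been computed, and `m` ticks are left
    -- on the counter. The counter is tested after an evaluation, so `width n τ` ticks give `width n
    -- τ + 1` evaluations, as in `ev`.
    have claim : ∀ m (x : List Bool), x.length = width n τ →
        F^[m + 1] x = F^[width n τ + 1] (List.replicate (width n τ) false) →
        Run mainLoop (st (.edge ∅ :: r) ((encodeFormWith id φ).reverse ++ l')
          (bits (F x) ++ .fin :: v') (encEnv (η₁ ++ x :: η₂))
          (.mu :: (List.replicate m .tick ++ .fin :: c)) (encodeTS T) [] [] [] []) S'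
          (iterTime q b * (m * (iterations b φ + 1) + 1) + k) := by
      intro m
      induction m with
      | zero =>
        intro x hx hFx
        refine Run.mono (run_main_return (m := iterTime q b) .mu
          (run_muReturn_last η₁ η₂ τ id φ hb₁ (F x) x (by omega) (q := q) (by omega) r
            (.mu :: l) v' c (encodeTS T) []) le_rfl (by omega) (Run.cast hS ?_ rfl le_rfl)) ?_
        · rw [hev, ← hFx, Function.iterate_one]
          simp only [encodeFormWith, id, List.reverse_cons, List.reverse_append, List.append_assoc, List.cons_append, List.nil_append]
        · simp
      | succ m ihm =>
        intro x hx hFx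
        have hFl : (F x).length = width n τ := by
          have := hlen x hx
          rw [hset] at this
          exact this
        rw [List.replicate_succ, List.cons_append]
        have h2 := ihm (F x) hFl (by rw [← hFx, ← Function.iterate_succ_apply])
        rw [← hset] at h2
        have h1 := ih _ (hconf _ hFl) (hbset _ hFl) (hvφ _) (by omega) (.edge ∅ :: r) l'
          v' (.mu :: (List.replicate m .tick ++ .fin :: c)) S' _
          (Run.cast h2 (by simp only [hF, hset]) rfl le_rfl)
        refine Run.mono (run_main_return (m := iterTime q b) .mu
          (run_muReturn_next η₁ η₂ τ id φ hb₁ (F x) x (by omega) (by omega) (q := q) (by omega)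
            (.edge ∅ :: r) (.mu :: l) v' (List.replicate m Symb.tick ++ .fin :: c) (encodeTS T) [])
            le_rfl (by omega) (Run.cast h1 ?_ rfl le_rfl)) ?_
        · simp [hset, hl']
        · linarith
    have h4 := claim (width n τ) (List.replicate (width n τ) false) (by simp) rfl
    have h3 := run_main_return (m := iterTime q b) (.pr) (.push _ _ _) (by omega) (by omega)
      (Run.cast h4 (S₀ := Function.update (st r ((encodeFormWith id φ).reverse ++ l')
          (bits (F (List.replicate (width n τ) false)) ++ .fin :: v')
          (encEnv (η₁ ++ List.replicate (width n τ) false :: η₂))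
          (.mu :: (List.replicate (width n τ) .tick ++ .fin :: c)) (encodeTS T) [] [] [] [])
          .R (.edge ∅ :: r)) (by simp) rfl le_rfl)
    have h2 := ih _ (hconf (List.replicate (width n τ) false) (by simp)) (hbset _ (by simp))
      (hvφ _) (by omega) r l' v'
      (.pr :: .mu :: (List.replicate (width n τ) .tick ++ .fin :: c)) S' _
      (Run.cast h3 (by simp [hF, hset]) rfl le_rfl)
    refine Run.mono (run_main_step (m := iterTime q b) .mu (run_muEnter T η₁ η₂ τ hn hnb hb₁
      hw (q := q) (by omega) (by omega) (encodeFormWith id φ ++ r) (.mu :: l) v' c) le_rfl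
      (by omega) (Run.cast h2 ?_ rfl le_rfl)) ?_ |> fun h => Run.cast h ?_ rfl le_rfl
    · simp [encodeFormWith]
    · simp [hset, hl']
    · rw [iterations]
      have := Nat.mul_le_mul (le_refl (iterTime q b))
        (Nat.mul_le_mul (show width n τ + 1 ≤ b + 1 by omega) (le_refl (iterations b φ + 1)))
      linarith

/-! ### The model checker -/

/-- The symbols for units of numbers. -/
def isTick : Symb P A → Bool
  | .tick => true
  | _ => false

/-- Distribute the input to the stacks: the transition system to `S`, the state to `V`, the formula
to `R`, and an environment of empty words to `E`. -/
def readInput : Pg P A :=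
  (untl .R isFin fun a => bif isTick a then .push .V a else .push .T a) ;;
    (whileNE .R fun a => .push .U a ;; .push .E .fin) ;; (whileNE .U fun a => .push .R a) ;;
      (whileNE .T fun a => .push .S a) ;; .push .C .var

/-- Look up the bit for the given state in the final value. -/
def writeOutput : Pg P A :=
  (untl .V isFin fun a => .push .T a) ;; (whileNE .V fun _ => popc .T fun _ => .skip) ;;
    popc .T fun b => clear .L ;; clear .E ;; clear .S ;; clear .T ;; .push .R b

/-- The model checker. -/
noncomputable def checker : Pg P A := readInput ;; mainLoop ;; writeOutput

theorem isTick_encodeTS {n : ℕ} (T : TS P A (Fin n)) :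
    ∀ a ∈ encodeTS T, isTick a = false ∧ isFin a = false := by
  intro a ha
  simp only [encodeTS, List.mem_flatMap, List.mem_cons, List.mem_map] at ha
  obtain ⟨i, -, rfl | ⟨j, -, rfl⟩⟩ := ha <;> exact ⟨rfl, rfl⟩

/-- One empty word is provided per symbol of the formula, which is more than there are variables; so
the variables need not be counted. -/
theorem run_readInput {n : ℕ} (T : TS P A (Fin n)) (s : ℕ) (F : List (Symb P A)) :
    Run readInput (st (encodeTS T ++ (encodeNum s ++ F)) [] [] [] [] [] [] [] [] [])
      (st F [] (List.replicate s .tick) (encEnv (List.replicate F.length [])) [.var] (encodeTS T)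
        [] [] [] [])
      (4 * (n * (n + 1)) + 2 * s + 5 * F.length + 5) := by
  have h1 := run_untl (k := Stk.R) (isEnd := isFin) (rest := F) (z := .fin)
    (f := fun a : Symb P A => bif isTick a then .push .V a else .push .T a) id
    (fun d t => st (t ++ .fin :: F) [] (d.filter isTick) [] [] [] (d.filter fun a => !isTick a)
      [] [] []) 1 (fun d t => by simp) rfl (fun d a t _ => by
        cases h : isTick a
        · simp only [id, h, cond_false]
          exact (Run.push _ _ _).to (by simp [h]) le_rfl
        · simp only [id, h, cond_true]
          exact (Run.push _ _ _).to (by simp [h]) le_rfl)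
    (encodeTS T ++ List.replicate s .tick) (fun a ha => by
      rcases List.mem_append.1 ha with h | h
      · exact (isTick_encodeTS T a h).2
      · rw [List.eq_of_mem_replicate h]; rfl)
  have e1 : (encodeTS T).filter isTick = [] :=
    List.filter_eq_nil_iff.2 fun a ha => by simp [(isTick_encodeTS T a ha).1]
  have e2 : (encodeTS T).filter (fun a => !isTick a) = encodeTS T :=
    List.filter_eq_self.2 fun a ha => by simp [(isTick_encodeTS T a ha).1]
  have e3 : (List.replicate s (.tick : Symb P A)).filter isTick = List.replicate s .tick :=
    List.filter_eq_self.2 fun a ha => by rw [List.eq_of_mem_replicate ha]; rfl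
  have e4 : (List.replicate s (.tick : Symb P A)).filter (fun a => !isTick a) = [] :=
    List.filter_eq_nil_iff.2 fun a ha => by rw [List.eq_of_mem_replicate ha]; simp [isTick]
  have h2 := run_whileNE (k := Stk.R) (f := fun a : Symb P A => .push .U a ;; .push .E .fin) id
    (fun d t => st t [] (List.replicate s .tick) (encEnv (List.replicate d.length [])) [] []
      (encodeTS T).reverse d [] []) 2 (fun d t => by simp)
      (fun d a t => ((Run.push _ _ _).seq (.push _ _ _)).to
        (by simp [List.replicate_succ]) (by omega)) F
  have h3 := run_mvAll (P := P) (A := A) (k := .U) (k' := .R) (by decide) (S := st [] []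
    (List.replicate s .tick) (encEnv (List.replicate F.length [])) [] []
      (encodeTS T).reverse F.reverse [] [])
  have h4 := run_mvAll (P := P) (A := A) (k := .T) (k' := .S) (by decide) (S := st F []
    (List.replicate s .tick) (encEnv (List.replicate F.length [])) [] []
      (encodeTS T).reverse [] [] [])
  simp only [List.reverse_append, List.filter_append, List.filter_reverse, e1, e2, e3, e4,
    update_R, List.reverse_replicate, List.reverse_nil, List.append_nil, List.nil_append,
    List.length_reverse, List.length_nil, List.replicate_zero, encEnv_nil, st_U, st_T, st_R, st_S,
    update_U, update_T, update_S, List.reverse_reverse] at h1 h2 h3 h4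
  refine (Run.seq (Run.cast h1 ?_ rfl le_rfl) (h2.seq (h3.seq (h4.seq (.push _ _ _))))).to ?_ ?_
  · simp [encodeNum]
  · simp
  · simp only [List.length_append, List.length_replicate, encodeTS_length]
    linarith

/-- Words of type `Pr` list the last state first. Moving the word to `T` turns it around, and the
ticks below it on `V` then count off `s` bits. -/
theorem run_writeOutput (l : List (Symb P A)) (y : List Bool) (s : ℕ) (hs : s < y.length)
    (e ts : List (Symb P A)) :
    Run writeOutput (st [] l (bits y ++ .fin :: List.replicate s .tick) e [] ts [] [] [] [])
      (st [bit (y.reverse.getD s false)] [] [] [] [] [] [] [] [] [])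
      (l.length + e.length + ts.length + 6 * y.length + 10) := by
  have h1 := run_mvBits (P := P) (A := A) (k := .V) (k' := .T) (by decide) y
    (S := st [] l (bits y ++ .fin :: List.replicate s .tick) e [] ts [] [] [] [])
    (rest := List.replicate s .tick) (by simp)
  have h2 : ∀ (z : List Bool) (s : ℕ), s < z.length →
      Run (whileNE .V fun _ => popc .T fun _ => .skip)
      (st [] l (List.replicate s .tick) e [] ts (bits z) [] [] [])
      (st [] l [] e [] ts (bits (z.drop s)) [] [] []) (2 * s + 1) := by
    intro z s
    induction s generalizing z with
    | zero => exact fun _ => (run_whileNE_nil rfl).to (by simp) (by omega)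
    | succ s ih =>
      intro hs
      obtain ⟨b, z, rfl⟩ := List.exists_cons_of_length_pos (show 0 < z.length by omega)
      refine (run_whileNE_cons (k := Stk.V) (a := Symb.tick) (l := List.replicate s .tick) rfl
        (run_popc (a := bit b) (l := bits z) ?_ (.skip _))
        (Run.cast (ih z (by simpa using hs)) ?_ rfl le_rfl)).to (by simp) (by omega)
      · simp
      · simp
  obtain ⟨z, hz⟩ : ∃ z, y.reverse.drop s = y.reverse.getD s false :: z := by
    refine ⟨y.reverse.drop (s + 1), ?_⟩
    rw [List.getD_eq_getElem _ _ (by simpa using hs), ← List.drop_eq_getElem_cons]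
  have h2' := h2 y.reverse s (by simpa using hs)
  rw [hz] at h2'
  have hzl := congrArg List.length hz
  simp only [List.length_drop, List.length_reverse, List.length_cons] at hzl
  generalize y.reverse.getD s false = b at *
  refine (Run.seq h1 (Run.seq (Run.cast h2' (by simp) rfl le_rfl) (run_popc (a := bit b)
    (l := bits z) (by simp) (Run.seq (run_clear _) (Run.seq (run_clear _) (Run.seq (run_clear _)
    (Run.seq (run_clear _) (.push _ _ _)))))))).to (by simp) ?_
  simp
  omega

theorem run_checker {n : ℕ} (T : TS P A (Fin n)) (s : Fin n) {U : Ty → Prop} {b : ℕ}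
    (hnb : n ≤ b) (hU : ∀ τ, U τ → width n τ ≤ b) {φ : Form P A}
    (h : WT U (fun _ => none) φ .pr) (hφ : ∀ i ∈ φ.vars, i < (encodeFormWith id φ).length) :
    Run checker
      (Function.update (fun _ => []) .R (encodeTS T ++ (encodeNum s ++ encodeFormWith id φ)))
      (Function.update (fun _ => []) .R [bit ((ev T φ (List.replicate
        (encodeFormWith id φ).length [])).reverse.getD s false)])
      (iterTime (encodeFormWith id φ).length b * (iterations b φ + 1)) := by
  have hn : 0 < n := s.pos
  set M := (encodeFormWith id φ).length with hM
  have hconf : Conf n (fun _ => none) (List.replicate M []) := by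
    intro i
    simp only [List.getD_eq_getElem?_getD, List.getElem?_replicate, Option.elim_none]
    split_ifs <;> rfl
  have hl := ev_length T h _ hconf (by simpa using hφ)
  have h1 := run_readInput T s (encodeFormWith id φ)
  have h3 := run_writeOutput ((encodeFormWith id φ).reverse) (ev T φ (List.replicate M [])) s
    (by rw [hl]; exact s.2) (encEnv (List.replicate M [])) (encodeTS T)
  have h2 := run_mainLoop hn T hnb hU h (List.replicate M []) hconf
    (by intro x hx; rw [List.eq_of_mem_replicate hx]; simp) (by simpa using hφ) hM.ge
    [] [] (List.replicate s .tick) []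
    _ 1 (run_whileNE_nil (by simp))
  have hst : ∀ l : List (Symb P A), Function.update (fun _ => []) .R l =
      st l [] [] [] [] [] [] [] [] [] := by
    intro l
    funext k
    cases k <;> rfl
  rw [hst, hst]
  refine (h1.seq ((Run.cast h2 ?_ ?_ le_rfl).seq h3)).to rfl ?_
  · simp [hM]
  · simp
  · have e1 := encEnv_length_le (P := P) (A := A) (List.replicate M []) 0
      (by intro x hx; rw [List.eq_of_mem_replicate hx]; simp)
    simp only [List.length_replicate, List.length_reverse, encodeTS_length, hl, ← hM] at e1 ⊢
    change _ + (_ + (_ + _ + _ + 6 * n + 10)) ≤ _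
    have hs := s.2
    have hnn : n * n ≤ b * b := Nat.mul_le_mul hnb hnb
    have : 20 + 7 * M + 5 * (n * (n + 1)) + 8 * n ≤ iterTime M b := by
      unfold iterTime
      nlinarith [Nat.zero_le (M * b), Nat.zero_le (M * b * b), Nat.zero_le (b * b)]
    nlinarith

instance [Finite P] [Finite A] : Finite (Symb P A) := by
  have : Finite Variance := by
    refine Finite.of_injective (β := Fin 3)
      (fun v => match v with | .neg => 0 | .zero => 1 | .pos => 2) ?_
    intro v w h
    cases v <;> cases w <;> simp_all
  refine Finite.of_injective (β := Set P ⊕ Set A ⊕ Variance ⊕ P ⊕ A ⊕ Variance ⊕ Fin 8)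
    (fun a => match a with
      | .state L => .inl L
      | .edge E => .inr (.inl E)
      | .arr v => .inr (.inr (.inl v))
      | .prop q => .inr (.inr (.inr (.inl q)))
      | .dia a => .inr (.inr (.inr (.inr (.inl a))))
      | .lam v => .inr (.inr (.inr (.inr (.inr (.inl v)))))
      | .tick => .inr (.inr (.inr (.inr (.inr (.inr 0)))))
      | .fin => .inr (.inr (.inr (.inr (.inr (.inr 1)))))
      | .pr => .inr (.inr (.inr (.inr (.inr (.inr 2)))))
      | .var => .inr (.inr (.inr (.inr (.inr (.inr 3)))))
      | .neg => .inr (.inr (.inr (.inr (.inr (.inr 4)))))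
      | .or => .inr (.inr (.inr (.inr (.inr (.inr 5)))))
      | .app => .inr (.inr (.inr (.inr (.inr (.inr 6)))))
      | .mu => .inr (.inr (.inr (.inr (.inr (.inr 7)))))) ?_
  intro a b h
  cases a <;> cases b <;> simp_all

variable {S : Type}

/-! ### Semantic domains -/

theorem Variance.Rel.refl {α : Type} [PartialOrder α] (v : Variance) (x : α) : v.Rel x x := by
  cases v
  · exact le_refl x
  · exact ⟨le_refl x, le_refl x⟩
  · exact le_refl x

theorem Variance.Rel.swap {α : Type} [PartialOrder α] {v : Variance} {x y : α} (h : v.Rel x y) :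
    v.compl.Rel y x := by
  cases v
  · exact h
  · exact ⟨h.2, h.1⟩
  · exact h

/-- The least element of `⟦τ⟧`. -/
def bot (S : Type) : (τ : Ty) → dom S τ
  | .pr => (∅ : Set S)
  | .arr _ _ τ => ⟨fun _ => bot S τ, fun _ _ _ => le_refl (bot S τ)⟩

theorem bot_le : (τ : Ty) → (x : dom S τ) → bot S τ ≤ x
  | .pr, x => Set.empty_subset (s := (x : Set S))
  | .arr _ _ τ, f => fun x => bot_le τ (f.1 x)

theorem IsComplement.antitone : (τ : Ty) → {x x' y y' : dom S τ} → IsComplement τ x x' →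
    IsComplement τ y y' → y' ≤ x' → x ≤ y
  | .pr, x, x', y, y', hx, hy, h => by
    change Set S at x x' y y'
    change x = x'ᶜ at hx
    change y = y'ᶜ at hy
    subst hx
    subst hy
    exact Set.compl_subset_compl.2 h
  | .arr _ _ τ, _, _, _, _, hx, hy, h => fun z => IsComplement.antitone τ (hx z) (hy z) (h z)

theorem finite_dom (S : Type) [Finite S] : (τ : Ty) → Finite (dom S τ)
  | .pr => inferInstanceAs (Finite (Set S))
  | .arr σ v τ =>
    have := finite_dom S σ
    have := finite_dom S τ
    inferInstanceAs (Finite {f : dom S σ → dom S τ // ∀ x y : dom S σ, v.Rel x y → f x ≤ f y})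

instance [Finite S] (τ : Ty) : Finite (dom S τ) := finite_dom S τ

/-- Monotonicity is forgotten and all functions are counted; the exponents then satisfy the
recursion of `width`. -/
theorem card_dom_le (n : ℕ) (τ : Ty) : Nat.card (dom (Fin n) τ) ≤ 2 ^ width n τ := by
  induction τ with
  | pr =>
    change Nat.card (Set (Fin n)) ≤ 2 ^ n
    simp
  | arr σ v τ ihσ ihτ =>
    have h1 : Nat.card (dom (Fin n) (.arr σ v τ)) ≤
        Nat.card (dom (Fin n) σ → dom (Fin n) τ) :=
      Nat.card_le_card_of_injective (β := dom (Fin n) σ → dom (Fin n) τ) (fun f => f.1)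
        Subtype.val_injective
    rw [Nat.card_fun] at h1
    refine h1.trans ((Nat.pow_le_pow_left ihτ _).trans ?_)
    rw [← pow_mul, width, mul_comm]
    exact Nat.pow_le_pow_right (by omega) (Nat.mul_le_mul_right _ ihσ)

/-- A strictly monotone rank function on `⟦τ⟧`. -/
noncomputable def rank {n : ℕ} : (τ : Ty) → dom (Fin n) τ → ℕ
  | .pr, (x : Set (Fin n)) => x.ncard
  | .arr σ _ τ, f => ∑ᶠ x : dom (Fin n) σ, rank τ (f.1 x)

/-- A function has at most `2 ^ width n σ` arguments, each contributing at most `width n τ`. With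
`rank_lt` this bounds the length of strict chains. -/
theorem rank_le {n : ℕ} : (τ : Ty) → (x : dom (Fin n) τ) → rank τ x ≤ width n τ
  | .pr, (x : Set (Fin n)) => by
    change x.ncard ≤ n
    simpa using Set.ncard_le_card x
  | .arr σ v τ, f => by
    let := Fintype.ofFinite (dom (Fin n) σ)
    rw [rank, finsum_eq_sum_of_fintype, width]
    refine (Finset.sum_le_card_nsmul _ _ (width n τ) fun x _ => rank_le τ _).trans ?_
    rw [smul_eq_mul, Finset.card_univ, ← Nat.card_eq_fintype_card]
    exact Nat.mul_le_mul_right _ (card_dom_le n σ)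

theorem rank_lt {n : ℕ} : (τ : Ty) → {x y : dom (Fin n) τ} → x < y → rank τ x < rank τ y
  | .pr, (x : Set (Fin n)), (y : Set (Fin n)), h => Set.ncard_lt_ncard h
  | .arr σ v τ, f, g, h => by
    let := Fintype.ofFinite (dom (Fin n) σ)
    have hle : ∀ x, f.1 x ≤ g.1 x := h.le
    have hne : ∃ x, f.1 x ≠ g.1 x := by
      by_contra hne
      push Not at hne
      exact h.ne (Subtype.ext (funext hne))
    obtain ⟨x, hx⟩ := hne
    rw [rank, rank, finsum_eq_sum_of_fintype, finsum_eq_sum_of_fintype]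
    refine Finset.sum_lt_sum (fun y _ => ?_) ⟨x, Finset.mem_univ _, rank_lt τ ((hle x).lt_of_ne hx)⟩
    rcases (hle y).eq_or_lt with h | h
    · rw [h]
    · exact (rank_lt τ h).le

/-- A monotone function on `⟦τ⟧` reaches its least prefixed point from the least element in
`width n τ` steps. -/
theorem iterate_eq_of_isGLB {n : ℕ} {τ : Ty} {F : dom (Fin n) τ → dom (Fin n) τ}
    (hF : ∀ x y, x ≤ y → F x ≤ F y) {x : dom (Fin n) τ} (hx : IsGLB {z | F z ≤ z} x) {m : ℕ}
    (hm : width n τ ≤ m) : F^[m] (bot (Fin n) τ) = x := by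
  -- As in the Knaster–Tarski theorem: by monotonicity `F x` is a lower bound of the prefixed
  -- points. Existence of the bound `x` is assumed, so no completeness of `⟦τ⟧` is used.
  have hFx : F x ≤ x := hx.2 fun z hz => (hF _ _ (hx.1 hz)).trans hz
  have hle : ∀ i, F^[i] (bot (Fin n) τ) ≤ x := by
    intro i
    induction i with
    | zero => exact bot_le τ x
    | succ i ih => rw [Function.iterate_succ_apply']; exact (hF _ _ ih).trans hFx
  have hinc : ∀ i, F^[i] (bot (Fin n) τ) ≤ F^[i + 1] (bot (Fin n) τ) := by
    intro i
    induction i with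
    | zero => exact bot_le τ _
    | succ i ih =>
      rw [Function.iterate_succ_apply', Function.iterate_succ_apply' (n := i + 1)]
      exact hF _ _ ih
  have hfix : ∀ i, F^[i + 1] (bot (Fin n) τ) = F^[i] (bot (Fin n) τ) → ∀ m, i ≤ m →
      F^[m] (bot (Fin n) τ) = F^[i] (bot (Fin n) τ) := by
    intro i hi m him
    induction m, him using Nat.le_induction with
    | base => rfl
    | succ m _ ih => rw [Function.iterate_succ_apply', ih, ← Function.iterate_succ_apply' F, hi]
  have hrank : ∀ i, (∀ j < i, F^[j + 1] (bot (Fin n) τ) ≠ F^[j] (bot (Fin n) τ)) →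
      i ≤ rank τ (F^[i] (bot (Fin n) τ)) := by
    intro i
    induction i with
    | zero => exact fun _ => Nat.zero_le _
    | succ i ih =>
      intro h
      exact (ih fun j hj => h j (by omega)).trans_lt
        (rank_lt τ ((hinc i).lt_of_ne (h i (by omega)).symm))
  -- Otherwise the first `m + 1` steps are strict and push the rank above `width n τ`.
  have hex : ∃ i ≤ m, F^[i + 1] (bot (Fin n) τ) = F^[i] (bot (Fin n) τ) := by
    by_contra hne
    push Not at hne
    have h1 := hrank (m + 1) fun j hj => hne j (by omega)
    have h2 := rank_le τ (F^[m + 1] (bot (Fin n) τ))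
    omega
  obtain ⟨i, hi, he⟩ := hex
  rw [hfix i he m hi]
  refine le_antisymm (hle i) (hx.1 ?_)
  change F _ ≤ _
  rw [← Function.iterate_succ_apply' F, he]

/-! ### Types and monotonicity of the semantics -/

/-- The types of the variables of a context. -/
def Ctx.ty (Γ : Ctx) : ℕ → Option Ty := fun X => (Γ X).map (·.2)

@[simp] theorem Ctx.ty_compl (Γ : Ctx) : Γ.compl.ty = Γ.ty := by
  funext X
  cases h : Γ X <;> simp [Ctx.ty, Ctx.compl, h]

@[simp] theorem Ctx.ty_extend (Γ : Ctx) (X : ℕ) (v : Variance) (τ : Ty) :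
    (Γ.extend X v τ).ty = Function.update Γ.ty X (some τ) := by
  funext Y
  by_cases h : Y = X
  · subst h; simp [Ctx.ty, Ctx.extend]
  · simp [Ctx.ty, Ctx.extend, h]

theorem HasType.type_mem {U : Ty → Prop} {Γ : Ctx} {φ : Form P A} {τ : Ty}
    (h : HasType U Γ φ τ) : U τ := by
  induction h <;> assumption

theorem HasType.toWT {U : Ty → Prop} {Γ : Ctx} {φ : Form P A} {τ : Ty}
    (h : HasType U Γ φ τ) : WT U Γ.ty φ τ := by
  induction h with
  | prop => exact .prop _ _
  | var Γ X v τ h => exact .var _ _ _ (by simp [Ctx.ty, h])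
  | neg Γ φ τ _ ih => exact .neg _ _ _ (by simpa using ih)
  | or _ _ _ _ _ ih₁ ih₂ => exact .or _ _ _ ih₁ ih₂
  | dia _ _ _ _ ih => exact .dia _ _ _ ih
  | lam Γ X v σ τ φ h _ _ hU ih => exact .lam _ _ _ _ _ _ (by simp [Ctx.ty, h]) (by simpa using ih) hU
  | app_pos _ _ _ _ _ h _ _ ih₁ ih₂ => exact .app _ _ _ _ _ _ ih₁ ih₂ h.type_mem
  | app_neg _ _ _ _ _ h _ _ ih₁ ih₂ =>
    exact .app _ _ _ _ _ _ ih₁ (by simpa using ih₂) h.type_mem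
  | app_zero _ _ _ _ _ h _ _ _ ih₁ ih₂ => exact .app _ _ _ _ _ _ ih₁ ih₂ h.type_mem
  | mu Γ X τ φ h h' ih => exact .mu _ _ _ _ (by simp [Ctx.ty, h]) (by simpa using ih) h'.type_mem

/-- The environment assigns values of the right types to the variables. -/
def EnvTy (Δ : ℕ → Option Ty) (ρ : Env S) : Prop :=
  ∀ X τ, Δ X = some τ → ∃ x : dom S τ, ρ X = some ⟨τ, x⟩

theorem EnvTy.update {Δ : ℕ → Option Ty} {ρ : Env S} (h : EnvTy Δ ρ) (X : ℕ) (τ : Ty)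
    (x : dom S τ) : EnvTy (Function.update Δ X (some τ)) (ρ.update X τ x) := by
  intro Y σ hY
  by_cases hXY : Y = X
  · subst hXY
    rw [Function.update_self] at hY
    cases hY
    exact ⟨x, by simp [Env.update]⟩
  · rw [Function.update_of_ne hXY] at hY
    obtain ⟨y, hy⟩ := h Y σ hY
    exact ⟨y, by simp [Env.update, hXY, hy]⟩

/-- The clause of `Den` for applications quantifies over the argument type and the variance;
uniqueness identifies them with those of the typing derivation, see `Den.app_inv`. -/
theorem Den.type_unique {T : TS P A S} {U : Ty → Prop} {Δ : ℕ → Option Ty} {φ : Form P A} {τ : Ty}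
    (h : WT U Δ φ τ) : ∀ {ρ : Env S} {τ' : Ty} {x : dom S τ'}, EnvTy Δ ρ → Den T φ ρ τ' x →
    τ' = τ := by
  induction h with
  | prop | or | dia =>
    intro ρ τ' x _ hx
    cases τ'
    · rfl
    · exact hx.elim
  | var Δ X τ hX =>
    intro ρ τ' x hρ hx
    obtain ⟨y, hy⟩ := hρ X τ hX
    have : (some ⟨τ, y⟩ : Option ((τ : Ty) × dom S τ)) = some ⟨τ', x⟩ := hy.symm.trans hx
    cases this
    rfl
  | neg Δ φ τ _ ih =>
    rintro ρ τ' x hρ ⟨y, hy, -⟩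
    exact ih hρ hy
  | lam Δ X v σ τ φ _ _ _ ih =>
    intro ρ τ' f hρ hf
    cases τ' with
    | pr => exact hf.elim
    | arr σ' v' τ' =>
      obtain ⟨rfl, rfl, hf⟩ := hf
      -- Some argument is needed to obtain a denotation of the body; the least element always
      -- exists.
      rw [ih (hρ.update X _ _) (hf (bot S _))]
  | app Δ φ ψ σ v τ _ _ _ ih₁ _ =>
    rintro ρ τ' y hρ ⟨σ', v', f, x, hf, -, -⟩
    have := ih₁ hρ hf
    cases this
    rfl
  | mu Δ X τ φ _ _ _ _ =>
    rintro ρ τ' x hρ ⟨h, -⟩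
    exact h.symm

/-- The order of environments that belongs to the variances of a context. -/
def EnvRel (Γ : Ctx) (ρ ρ' : Env S) : Prop :=
  ∀ X v τ, Γ X = some (v, τ) → ∃ x y : dom S τ, ρ X = some ⟨τ, x⟩ ∧ ρ' X = some ⟨τ, y⟩ ∧
    Variance.Rel v x y

theorem EnvRel.compl {Γ : Ctx} {ρ ρ' : Env S} (h : EnvRel Γ ρ ρ') : EnvRel Γ.compl ρ' ρ := by
  intro X v τ hX
  simp only [Ctx.compl, Option.map_eq_some_iff, Prod.exists] at hX
  obtain ⟨v', _, hX, he⟩ := hX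
  cases he
  obtain ⟨x, y, hx, hy, hxy⟩ := h X v' _ hX
  exact ⟨y, x, hy, hx, hxy.swap⟩

theorem EnvRel.update {Γ : Ctx} {ρ ρ' : Env S} (h : EnvRel Γ ρ ρ') (X : ℕ) {v : Variance} {τ : Ty}
    {x y : dom S τ} (hxy : Variance.Rel v x y) :
    EnvRel (Γ.extend X v τ) (ρ.update X τ x) (ρ'.update X τ y) := by
  intro Y w σ hY
  by_cases hYX : Y = X
  · subst hYX
    rw [Ctx.extend, Function.update_self] at hY
    cases hY
    exact ⟨x, y, by simp [Env.update], by simp [Env.update], hxy⟩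
  · rw [Ctx.extend, Function.update_of_ne hYX] at hY
    obtain ⟨x', y', hx, hy, hr⟩ := h Y w σ hY
    exact ⟨x', y', by simp [Env.update, hYX, hx], by simp [Env.update, hYX, hy], hr⟩

theorem EnvRel.left {Γ : Ctx} {ρ ρ' : Env S} (h : EnvRel Γ ρ ρ') : EnvTy Γ.ty ρ := by
  intro X τ hX
  simp only [Ctx.ty, Option.map_eq_some_iff, Prod.exists] at hX
  obtain ⟨v, _, hX, rfl⟩ := hX
  obtain ⟨x, y, hx, -, -⟩ := h X v _ hX
  exact ⟨x, hx⟩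

theorem EnvRel.right {Γ : Ctx} {ρ ρ' : Env S} (h : EnvRel Γ ρ ρ') : EnvTy Γ.ty ρ' := by
  simpa using h.compl.left

theorem EnvTy.rel {Γ : Ctx} {ρ : Env S} (h : EnvTy Γ.ty ρ) : EnvRel Γ ρ ρ := by
  intro X v τ hX
  obtain ⟨x, hx⟩ := h X τ (by simp [Ctx.ty, hX])
  exact ⟨x, x, hx, hx, .refl v x⟩

theorem Den.app_inv {T : TS P A S} {U : Ty → Prop} {Γ : Ctx} {φ ψ : Form P A} {σ τ : Ty}
    {v : Variance} (h : HasType U Γ φ (.arr σ v τ)) {ρ : Env S} (hρ : EnvTy Γ.ty ρ) {y : dom S τ}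
    (hy : Den T (.app φ ψ) ρ τ y) : ∃ (f : dom S (.arr σ v τ)) (x : dom S σ),
      Den T φ ρ (.arr σ v τ) f ∧ Den T ψ ρ σ x ∧ y = f.1 x := by
  obtain ⟨σ', v', f, x, hf, hx, he⟩ := hy
  have := Den.type_unique h.toWT hρ hf
  cases this
  exact ⟨f, x, hf, hx, he⟩

/-- The soundness of variances. Both values are assumed to exist, as negation at function types may
lead outside of `⟦τ⟧`. It is applied to fixpoint bodies, whose variable has variance `+`. -/
theorem Den.mono {T : TS P A S} {U : Ty → Prop} {Γ : Ctx} {φ : Form P A} {τ : Ty}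
    (h : HasType U Γ φ τ) : ∀ {ρ ρ' : Env S} {x y : dom S τ}, EnvRel Γ ρ ρ' → Den T φ ρ τ x →
    Den T φ ρ' τ y → x ≤ y := by
  induction h with
  | prop Γ q =>
    intro ρ ρ' x y _ hx hy
    exact (hx.trans hy.symm).le
  | var Γ X v τ hX hv =>
    intro ρ ρ' x y hρ hx hy
    obtain ⟨x', y', hx', hy', hxy⟩ := hρ X v τ hX
    have h1 : (some ⟨τ, x⟩ : Option ((τ : Ty) × dom S τ)) = some ⟨τ, x'⟩ := hx.symm.trans hx'
    have h2 : (some ⟨τ, y⟩ : Option ((τ : Ty) × dom S τ)) = some ⟨τ, y'⟩ := hy.symm.trans hy'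
    cases h1
    cases h2
    rcases hv with rfl | rfl
    · exact hxy.1
    · exact hxy
  | neg Γ φ τ _ ih =>
    rintro ρ ρ' x y hρ ⟨x', hx', hx⟩ ⟨y', hy', hy⟩
    exact hx.antitone τ hy (ih hρ.compl hy' hx')
  | or Γ φ ψ _ _ ih₁ ih₂ =>
    rintro ρ ρ' x y hρ ⟨x₁, x₂, h₁, h₂, rfl⟩ ⟨y₁, y₂, h₁', h₂', rfl⟩
    exact Set.union_subset_union (ih₁ hρ h₁ h₁') (ih₂ hρ h₂ h₂')
  | dia Γ a φ _ ih =>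
    rintro ρ ρ' x y hρ ⟨x', hx', rfl⟩ ⟨y', hy', rfl⟩
    rintro s ⟨t, ht, hst⟩
    exact ⟨t, ih hρ hx' hy' ht, hst⟩
  | lam Γ X v σ τ φ _ _ _ _ ih =>
    rintro ρ ρ' f g hρ ⟨-, -, hf⟩ ⟨-, -, hg⟩ x
    exact ih (hρ.update X (.refl v x)) (hf x) (hg x)
  | app_pos Γ φ ψ σ τ h _ _ ih₁ ih₂ =>
    intro ρ ρ' y y' hρ hy hy'
    obtain ⟨f, x, hf, hx, rfl⟩ := hy.app_inv h hρ.left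
    obtain ⟨f', x', hf', hx', rfl⟩ := hy'.app_inv h hρ.right
    exact (f.2 x x' (ih₂ hρ hx hx')).trans (ih₁ hρ hf hf' x')
  | app_neg Γ φ ψ σ τ h _ _ ih₁ ih₂ =>
    intro ρ ρ' y y' hρ hy hy'
    obtain ⟨f, x, hf, hx, rfl⟩ := hy.app_inv h hρ.left
    obtain ⟨f', x', hf', hx', rfl⟩ := hy'.app_inv h hρ.right
    exact (f.2 x x' (ih₂ hρ.compl hx' hx)).trans (ih₁ hρ hf hf' x')
  | app_zero Γ φ ψ σ τ h _ _ _ ih₁ ih₂ ih₃ =>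
    intro ρ ρ' y y' hρ hy hy'
    obtain ⟨f, x, hf, hx, rfl⟩ := hy.app_inv h hρ.left
    obtain ⟨f', x', hf', hx', rfl⟩ := hy'.app_inv h hρ.right
    exact (f.2 x x' ⟨ih₂ hρ hx hx', ih₃ hρ.compl hx' hx⟩).trans (ih₁ hρ hf hf' x')
  | mu Γ X τ φ _ _ ih =>
    rintro ρ ρ' x y hρ ⟨-, hF, hx⟩ ⟨-, -, hy⟩
    -- Every prefixed point for `ρ'` is one for `ρ`, because the body is smaller under `ρ`.
    refine hy.2 fun z ⟨w, hw, hwz⟩ => hx.1 ?_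
    obtain ⟨u, hu⟩ := hF z
    exact ⟨u, hu, (ih (hρ.update X (v := .pos) (le_refl z)) hu hw).trans hwz⟩

/-! ### Representation of semantic values by words -/

open Classical in
/-- The word `l` represents the semantic value `x`. -/
def Rep {n : ℕ} : (τ : Ty) → dom (Fin n) τ → List Bool → Prop
  | .pr, (x : Set (Fin n)), l => l = ((List.finRange n).map fun s => decide (s ∈ x)).reverse
  | .arr σ v τ, f, l => l.length = width n (.arr σ v τ) ∧
      ∀ (x : dom (Fin n) σ) (lx : List Bool), Rep σ x lx → Rep τ (f.1 x) (sel l lx)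

theorem rep_pr {n : ℕ} {x : Set (Fin n)} {g : Fin n → Bool} (h : ∀ s, g s = true ↔ s ∈ x) :
    Rep .pr x ((List.finRange n).map g).reverse := by
  change _ = _
  congr 2
  funext s
  exact Bool.eq_iff_iff.2 ((h s).trans (@decide_eq_true_iff _ (Classical.propDecidable _)).symm)

theorem Rep.length {n : ℕ} : {τ : Ty} → {x : dom (Fin n) τ} → {l : List Bool} → Rep τ x l →
    l.length = width n τ
  | .pr, x, l, h => by
    change l = _ at h
    simp [h, width]
  | .arr _ _ _, _, _, h => h.1

theorem half_map (f : Bool → Bool) (g : List Bool) (b : Bool) :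
    half (g.map f) b = (half g b).map f := by
  cases b <;> simp [half, List.map_take, List.map_drop]

/-- Selection only looks at positions. Hence flipping all bits of a table complements the function
pointwise, which is `Rep.compl`. -/
theorem sel_map (f : Bool → Bool) (l x : List Bool) : sel (l.map f) x = (sel l x).map f := by
  have h : ∀ (y g : List Bool), y.foldl half (g.map f) = (y.foldl half g).map f := by
    intro y
    induction y with
    | nil => exact fun g => rfl
    | cons b y ih => intro g; rw [List.foldl_cons, List.foldl_cons, half_map, ih]
  rw [sel, ← List.map_reverse, h, ← List.map_reverse, sel]

theorem Rep.compl {n : ℕ} : (τ : Ty) → {x y : dom (Fin n) τ} → {l : List Bool} → Rep τ y l →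
    IsComplement τ x y → Rep τ x (l.map not)
  | .pr, x, y, l, h, hx => by
    change Set (Fin n) at x y
    change x = yᶜ at hx
    change l = _ at h
    rw [h, hx, List.map_reverse, List.map_map]
    exact rep_pr fun s => by simp
  | .arr σ v τ, f, g, l, h, hf => by
    refine ⟨by rw [List.length_map, h.1], fun x lx hx => ?_⟩
    rw [sel_map]
    exact Rep.compl τ (h.2 x lx hx) (hf x)

theorem sel_replicate (w m : ℕ) (x : List Bool) (hx : x.length = w) (b : Bool) :
    sel (List.replicate (2 ^ w * m) b) x = List.replicate m b := by
  refine List.eq_replicate_iff.2 ⟨sel_length _ _ m (by simp [hx]), fun c hc => ?_⟩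
  -- A constant word is its own image under the constant map, and selection commutes with maps.
  have h : sel ((List.replicate (2 ^ w * m) b).map fun _ => b) x =
      (sel (List.replicate (2 ^ w * m) b) x).map fun _ => b := sel_map _ _ _
  rw [List.map_replicate] at h
  rw [h] at hc
  simpa using (List.mem_map.1 hc).choose_spec.2.symm

theorem rep_bot (n : ℕ) : (τ : Ty) → Rep τ (bot (Fin n) τ) (List.replicate (width n τ) false)
  | .pr => by
    change List.replicate n false = ((List.finRange n).map fun s => _).reverse
    refine (List.eq_replicate_iff.2 ⟨by simp, fun b hb => ?_⟩).symm
    rw [List.mem_reverse, List.mem_map] at hb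
    obtain ⟨s, -, rfl⟩ := hb
    exact @decide_eq_false _ (Classical.propDecidable _) (Set.notMem_empty s)
  | .arr σ v τ => by
    refine ⟨by simp, fun x lx hx => ?_⟩
    rw [width, sel_replicate _ _ _ hx.length]
    exact rep_bot n τ

theorem digits_succ_append (w i : ℕ) : digits (w + 1) i = digits w i ++ [i.testBit w] := by
  simp [digits, List.range_succ]

/-- The binary counter of an abstraction therefore visits every possible argument word. -/
theorem exists_digits (l : List Bool) : ∃ i < 2 ^ l.length, l = digits l.length i := by
  induction l with
  | nil => exact ⟨0, by simp, rfl⟩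
  | cons b l ih =>
    obtain ⟨i, hi, hl⟩ := ih
    refine ⟨2 * i + b.toNat, ?_, ?_⟩
    · have := b.toNat_lt
      rw [List.length_cons, pow_succ]
      omega
    · have := b.toNat_lt
      rw [List.length_cons, digits_succ, show (2 * i + b.toNat) / 2 = i by omega, ← hl]
      cases b <;> simp [Nat.testBit_zero]

/-- Binary search: the highest digit of `i` decides which half of the slices is kept. The offset `a`
is generalized because the upper half starts at `a + 2 ^ w`. -/
theorem foldl_half_flatMap (G : ℕ → List Bool) (m : ℕ) (hG : ∀ j, (G j).length = m) (w i : ℕ)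
    (hi : i < 2 ^ w) (a : ℕ) :
    (digits w i).reverse.foldl half ((List.range' a (2 ^ w)).flatMap G) = G (a + i) := by
  induction w generalizing i a with
  | zero =>
    obtain rfl : i = 0 := by simpa using hi
    simp [digits]
  | succ w ih =>
    have hlen : ∀ a k, ((List.range' a k).flatMap G).length = k * m := by
      intro a k
      simp [List.length_flatMap, hG]
    have hsplit : List.range' a (2 ^ (w + 1)) =
        List.range' a (2 ^ w) ++ List.range' (a + 2 ^ w) (2 ^ w) := by
      rw [List.range'_append_1]
      congr 1
      ring
    have hmid : ((List.range' a (2 ^ (w + 1))).flatMap G).length / 2 =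
        ((List.range' a (2 ^ w)).flatMap G).length := by
      rw [hlen, hlen, pow_succ, mul_right_comm]
      omega
    rw [digits_succ_append, List.reverse_append, List.reverse_singleton, List.singleton_append,
      List.foldl_cons, half, hmid, hsplit, List.flatMap_append]
    rw [pow_succ] at hi
    rcases lt_or_ge i (2 ^ w) with h | h
    · rw [Nat.testBit_lt_two_pow h, cond_false, List.take_left' rfl, ih i h]
    · have h1 : i.testBit w = true := by
        rw [Nat.testBit_eq_decide_div_mod_eq, decide_eq_true_eq,
          Nat.div_eq_of_lt_le (k := 1) (by omega) (by omega)]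
      -- Removing the highest digit does not change the lower ones.
      have h2 : digits w i = digits w (i - 2 ^ w) := by
        refine List.map_congr_left fun j hj => ?_
        rw [List.mem_range] at hj
        conv_lhs => rw [← Nat.add_sub_of_le h]
        rw [Nat.testBit_two_pow_add_gt hj]
      rw [h1, cond_true, List.drop_left' rfl, h2, ih (i - 2 ^ w) (by omega)]
      congr 1
      omega

/-- Application after abstraction. `sel` works on the reversed table, in which index `0` comes first
and every slice is itself reversed. -/
theorem sel_flatMap (G : ℕ → List Bool) (m : ℕ) (hG : ∀ j, (G j).length = m) (w i : ℕ)
    (hi : i < 2 ^ w) : sel ((List.range (2 ^ w)).reverse.flatMap G) (digits w i) = G i := by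
  have h := foldl_half_flatMap (fun j => (G j).reverse) m (by simpa using hG) w i hi 0
  rw [sel, List.reverse_flatMap, List.reverse_reverse, List.range_eq_range']
  simp only [Function.comp_def]
  rw [h, List.reverse_reverse, zero_add]

/-! ### Renaming of variables -/

/-- Replace every variable `X` (bound or not) by `f X`. -/
def Form.rename (f : ℕ → ℕ) : Form P A → Form P A
  | .prop q => .prop q
  | .var X => .var (f X)
  | .neg φ => .neg (φ.rename f)
  | .or φ ψ => .or (φ.rename f) (ψ.rename f)
  | .dia a φ => .dia a (φ.rename f)
  | .app φ ψ => .app (φ.rename f) (ψ.rename f)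
  | .lam X v σ φ => .lam (f X) v σ (φ.rename f)
  | .mu X τ φ => .mu (f X) τ (φ.rename f)

theorem encodeFormWith_rename (f : ℕ → ℕ) (φ : Form P A) :
    encodeFormWith id (φ.rename f) = encodeFormWith f φ := by
  induction φ <;> simp_all [Form.rename, encodeFormWith]

theorem Form.vars_rename (f : ℕ → ℕ) (φ : Form P A) : (φ.rename f).vars = φ.vars.map f := by
  induction φ <;> simp_all [Form.rename, Form.vars]

theorem update_rename {V : Set ℕ} {f : ℕ → ℕ} (hf : Set.InjOn f V) {Δ Δ' : ℕ → Option Ty} {X : ℕ}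
    (hX : X ∈ V) (σ : Ty) (h : ∀ X ∈ V, Δ' (f X) = Δ X) :
    ∀ Y ∈ V, Function.update Δ' (f X) (some σ) (f Y) = Function.update Δ X (some σ) Y := by
  intro Y hY
  by_cases hYX : Y = X
  · simp [hYX]
  · rw [Function.update_of_ne hYX, Function.update_of_ne fun h => hYX (hf hY hX h), h Y hY]

/-- Free and bound variables are renamed alike; injectivity on the variables that occur rules out
capture. -/
theorem WT.rename {V : Set ℕ} {f : ℕ → ℕ} (hf : Set.InjOn f V) {U : Ty → Prop}
    {Δ : ℕ → Option Ty} {φ : Form P A} {τ : Ty} (h : WT U Δ φ τ) :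
    (∀ X ∈ φ.vars, X ∈ V) → ∀ Δ', (∀ X ∈ V, Δ' (f X) = Δ X) → WT U Δ' (φ.rename f) τ := by
  induction h with
  | prop => exact fun _ Δ' _ => .prop _ _
  | var Δ X τ hX => exact fun hV Δ' hΔ => .var _ _ _ ((hΔ X (hV X (by simp [Form.vars]))).trans hX)
  | neg Δ φ τ _ ih => exact fun hV Δ' hΔ => .neg _ _ _ (ih hV Δ' hΔ)
  | or Δ φ ψ _ _ ih₁ ih₂ =>
    exact fun hV Δ' hΔ => .or _ _ _ (ih₁ (fun X hX => hV X (by simp [Form.vars, hX])) Δ' hΔ)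
      (ih₂ (fun X hX => hV X (by simp [Form.vars, hX])) Δ' hΔ)
  | dia Δ a φ _ ih => exact fun hV Δ' hΔ => .dia _ _ _ (ih hV Δ' hΔ)
  | lam Δ X v σ τ φ hX _ hU ih =>
    intro hV Δ' hΔ
    have hXV := hV X (by simp [Form.vars])
    exact .lam _ _ _ _ _ _ ((hΔ X hXV).trans hX)
      (ih (fun Y hY => hV Y (by simp [Form.vars, hY])) _ (update_rename hf hXV σ hΔ)) hU
  | app Δ φ ψ σ v τ _ _ hU ih₁ ih₂ =>
    exact fun hV Δ' hΔ => .app _ _ _ _ _ _ (ih₁ (fun X hX => hV X (by simp [Form.vars, hX])) Δ' hΔ)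
      (ih₂ (fun X hX => hV X (by simp [Form.vars, hX])) Δ' hΔ) hU
  | mu Δ X τ φ hX _ hU ih =>
    intro hV Δ' hΔ
    have hXV := hV X (by simp [Form.vars])
    exact .mu _ _ _ _ ((hΔ X hXV).trans hX)
      (ih (fun Y hY => hV Y (by simp [Form.vars, hY])) _ (update_rename hf hXV τ hΔ)) hU

/-! ### Correctness of the evaluation -/

/-- The words `η` represent the values of the environment `ρ`, where `X` has the number `f X`. -/
def EnvRep {n : ℕ} (f : ℕ → ℕ) (Δ : ℕ → Option Ty) (ρ : Env (Fin n)) (η : List (List Bool)) :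
    Prop :=
  ∀ X τ, Δ X = some τ → ∃ x : dom (Fin n) τ, ρ X = some ⟨τ, x⟩ ∧ Rep τ x (η.getD (f X) [])

theorem EnvRep.ty {n : ℕ} {f : ℕ → ℕ} {Δ : ℕ → Option Ty} {ρ : Env (Fin n)}
    {η : List (List Bool)} (h : EnvRep f Δ ρ η) : EnvTy Δ ρ := fun X τ hX =>
  let ⟨x, hx, _⟩ := h X τ hX
  ⟨x, hx⟩

theorem EnvRep.update {n : ℕ} {V : Set ℕ} {f : ℕ → ℕ} (hf : Set.InjOn f V) {Δ : ℕ → Option Ty}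
    (hΔ : ∀ X, Δ X ≠ none → X ∈ V) {ρ : Env (Fin n)} {η : List (List Bool)} (h : EnvRep f Δ ρ η)
    {X : ℕ} (hX : X ∈ V) (hη : f X < η.length) {σ : Ty} {x : dom (Fin n) σ} {l : List Bool}
    (hx : Rep σ x l) : EnvRep f (Function.update Δ X (some σ)) (ρ.update X σ x) (η.set (f X) l) := by
  intro Y τ hY
  rw [getD_set _ _ _ _ _ hη]
  by_cases hYX : Y = X
  · subst hYX
    rw [Function.update_self] at hY
    cases hY
    exact ⟨x, by simp [Env.update], by simpa using hx⟩
  · rw [Function.update_of_ne hYX] at hY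
    obtain ⟨y, hy, hr⟩ := h Y τ hY
    rw [if_neg fun h => hYX (hf hX (hΔ Y (by simp [hY])) h).symm]
    exact ⟨y, by simp [Env.update, hYX, hy], hr⟩

theorem ne_none_update {V : Set ℕ} {Δ : ℕ → Option Ty} (hΔ : ∀ X, Δ X ≠ none → X ∈ V) {X : ℕ}
    (hX : X ∈ V) (σ : Ty) : ∀ Y, Function.update Δ X (some σ) Y ≠ none → Y ∈ V := by
  intro Y hY
  by_cases hYX : Y = X
  · rwa [hYX]
  · rw [Function.update_of_ne hYX] at hY
    exact hΔ Y hY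

open Classical in
-- The fundamental lemma of the logical relation `Rep`. Besides `EnvRep`, the lengths of the words
-- are tracked by `Conf`: the table of an abstraction also has slices for argument words that
-- represent nothing, and their lengths must be right, too.
theorem ev_correct {n : ℕ} (T : TS P A (Fin n)) {V : Set ℕ} {f : ℕ → ℕ} (hf : Set.InjOn f V)
    {U : Ty → Prop} {Γ : Ctx} {φ : Form P A} {τ : Ty} (h : HasType U Γ φ τ) :
    (∀ X ∈ φ.vars, X ∈ V) → (∀ X, Γ.ty X ≠ none → X ∈ V) →
    ∀ (ρ : Env (Fin n)) (η : List (List Bool)) (x : dom (Fin n) τ), (∀ X ∈ V, f X < η.length) →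
    (∃ Δ', (∀ X ∈ V, Δ' (f X) = Γ.ty X) ∧ Conf n Δ' η) → EnvRep f Γ.ty ρ η → Den T φ ρ τ x →
    Rep τ x (ev T (φ.rename f) η) := by
  induction h with
  | prop Γ q hU =>
    intro hV hΓ ρ η x hη hΔ hρ hx
    change Set (Fin n) at x
    change x = _ at hx
    change _ = _
    rw [hx]
    simp [Form.rename, ev, Function.comp_def]
  | var Γ X v τ hX =>
    intro hV hΓ ρ η x hη hΔ hρ hx
    obtain ⟨y, hy, hr⟩ := hρ X τ (by simp [Ctx.ty, hX])
    have h1 : (some ⟨τ, x⟩ : Option ((τ : Ty) × dom (Fin n) τ)) = some ⟨τ, y⟩ := hx.symm.trans hy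
    cases h1
    exact hr
  | neg Γ φ τ _ ih =>
    rintro hV hΓ ρ η x hη hΔ hρ ⟨y, hy, hc⟩
    exact (ih hV (by simpa using hΓ) ρ η y hη (by simpa using hΔ) (by simpa using hρ) hy).compl τ hc
  | or Γ φ ψ _ _ ih₁ ih₂ =>
    rintro hV hΓ ρ η x hη hΔ hρ ⟨y, z, hy, hz, rfl⟩
    have e1 : ev T (φ.rename f) η = _ :=
      ih₁ (fun X hX => hV X (by simp [Form.vars, hX])) hΓ ρ η y hη hΔ hρ hy
    have e2 : ev T (ψ.rename f) η = _ :=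
      ih₂ (fun X hX => hV X (by simp [Form.vars, hX])) hΓ ρ η z hη hΔ hρ hz
    rw [Form.rename, ev, e1, e2, ← List.reverse_zipWith (by simp), List.zipWith_map,
      List.zipWith_self]
    exact rep_pr fun s => by simp
  | dia Γ a φ _ ih =>
    rintro hV hΓ ρ η x hη hΔ hρ ⟨y, hy, rfl⟩
    have e1 : ev T (φ.rename f) η = _ := ih hV hΓ ρ η y hη hΔ hρ hy
    rw [Form.rename, ev, e1, List.reverse_reverse, rowsOf, List.map_map]
    refine rep_pr fun s => ?_
    rw [Function.comp_apply, rowBit, List.zip_map', List.any_map, List.any_eq_true]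
    simp [actBit]
  | lam Γ X v σ τ φ hX hφ _ hU ih =>
    rintro hV hΓ ρ η g hη hΔ hρ ⟨-, -, hg⟩
    have hXV := hV X (by simp [Form.vars])
    obtain ⟨Δ', hΔ, hc⟩ := hΔ
    have hconf := fun (lx : List Bool) (hlx : lx.length = width n σ) =>
      hc.set (hη X hXV) lx σ hlx
    have hup := update_rename hf hXV σ hΔ
    have hvφ : ∀ Y ∈ φ.vars, Y ∈ V := fun Y hY => hV Y (by simp [Form.vars, hY])
    have hlen : ∀ lx : List Bool, lx.length = width n σ →
        (ev T (φ.rename f) (η.set (f X) lx)).length = width n τ := by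
      refine fun lx hlx => ev_length T (hφ.toWT.rename hf hvφ _ (by simpa using hup)) _
        (hconf lx hlx) ?_
      intro i hi
      rw [Form.vars_rename, List.mem_map] at hi
      obtain ⟨Y, hY, rfl⟩ := hi
      simpa using hη Y (hvφ Y hY)
    have key : ∀ (x : dom (Fin n) σ) (lx : List Bool), Rep σ x lx →
        Rep τ (g.1 x) (ev T (φ.rename f) (η.set (f X) lx)) := by
      intro x lx hx
      refine ih hvφ ?_ _ _ _ (by simpa using hη) ⟨_, by simpa using hup, hconf lx hx.length⟩ ?_
        (hg x)
      · simpa using ne_none_update hΓ hXV σ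
      · simpa using hρ.update hf hΓ hXV (hη X hXV) hx
    have hG : ∀ j, (ev T (φ.rename f) (η.set (f X) (digits (width n σ) j))).length = width n τ :=
      fun j => hlen _ (by simp)
    refine ⟨?_, fun x lx hx => ?_⟩
    · simp [Form.rename, ev, List.length_flatMap, hG, width]
    · obtain ⟨j, hj, he⟩ := exists_digits lx
      rw [hx.length] at hj he
      have := key x lx hx
      rw [he] at this ⊢
      rw [Form.rename, ev, sel_flatMap _ _ hG _ _ hj]
      exact this
  | app_pos Γ φ ψ σ τ h _ _ ih₁ ih₂ =>
    intro hV hΓ ρ η y hη hΔ hρ hy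
    obtain ⟨g, x, hg, hx, rfl⟩ := hy.app_inv h hρ.ty
    exact (ih₁ (fun X hX => hV X (by simp [Form.vars, hX])) hΓ ρ η g hη hΔ hρ hg).2 x _
      (ih₂ (fun X hX => hV X (by simp [Form.vars, hX])) hΓ ρ η x hη hΔ hρ hx)
  | app_neg Γ φ ψ σ τ h _ _ ih₁ ih₂ =>
    intro hV hΓ ρ η y hη hΔ hρ hy
    obtain ⟨g, x, hg, hx, rfl⟩ := hy.app_inv h hρ.ty
    exact (ih₁ (fun X hX => hV X (by simp [Form.vars, hX])) hΓ ρ η g hη hΔ hρ hg).2 x _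
      (ih₂ (fun X hX => hV X (by simp [Form.vars, hX])) (by simpa using hΓ) ρ η x hη
        (by simpa using hΔ) (by simpa using hρ) hx)
  | app_zero Γ φ ψ σ τ h _ _ _ ih₁ ih₂ =>
    intro hV hΓ ρ η y hη hΔ hρ hy
    obtain ⟨g, x, hg, hx, rfl⟩ := hy.app_inv h hρ.ty
    exact (ih₁ (fun X hX => hV X (by simp [Form.vars, hX])) hΓ ρ η g hη hΔ hρ hg).2 x _
      (ih₂ (fun X hX => hV X (by simp [Form.vars, hX])) hΓ ρ η x hη hΔ hρ hx)
  | mu Γ X τ φ hX hφ ih =>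
    rintro hV hΓ ρ η x hη hΔ hρ ⟨-, htot, hx⟩
    have hXV := hV X (by simp [Form.vars])
    choose F hF using htot
    have hmono : ∀ y z, y ≤ z → ∀ u w, Den T φ (ρ.update X τ y) τ u →
        Den T φ (ρ.update X τ z) τ w → u ≤ w := fun y z hyz u w hu hw =>
      Den.mono hφ (hρ.ty.rel.update X (v := .pos) hyz) hu hw
    -- Monotonicity at `z ≤ z` also shows that the value of the body is unique, so the set in the
    -- semantics is that of the prefixed points of `F`.
    have hset : {z : dom (Fin n) τ | ∃ y, Den T φ (ρ.update X τ z) τ y ∧ y ≤ z} =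
        {z | F z ≤ z} := by
      ext z
      exact ⟨fun ⟨y, hy, hyz⟩ => (hmono z z le_rfl _ _ (hF z) hy).trans hyz,
        fun hz => ⟨F z, hF z, hz⟩⟩
    rw [hset] at hx
    obtain ⟨Δ', hΔ, hc⟩ := hΔ
    have hup := update_rename hf hXV τ hΔ
    -- `ev` iterates once more than necessary, which does no harm.
    rw [← iterate_eq_of_isGLB (fun y z hyz => hmono y z hyz _ _ (hF y) (hF z)) hx
      (Nat.le_succ (width n τ)), Form.rename, ev]
    suffices ∀ m, Rep τ (F^[m] (bot (Fin n) τ)) ((fun x => ev T (φ.rename f)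
        (η.set (f X) x))^[m] (List.replicate (width n τ) false)) from this _
    intro m
    induction m with
    | zero => exact rep_bot n τ
    | succ m ihm =>
      rw [Function.iterate_succ_apply', Function.iterate_succ_apply']
      refine ih (fun Y hY => hV Y (by simp [Form.vars, hY])) ?_ _ _ _ (by simpa using hη)
        ⟨_, by simpa using hup, hc.set (hη X hXV) _ τ ihm.length⟩ ?_ (hF _)
      · simpa using ne_none_update hΓ hXV τ
      · simpa using hρ.update hf hΓ hXV (hη X hXV) ihm

theorem iterations_rename (f : ℕ → ℕ) (b : ℕ) (φ : Form P A) :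
    iterations b (φ.rename f) = iterations b φ := by
  induction φ <;> simp_all [Form.rename, iterations]

theorem Form.length_vars_le (f : ℕ → ℕ) (φ : Form P A) :
    φ.vars.length < (encodeFormWith f φ).length := by
  induction φ <;> simp [Form.vars, encodeFormWith, encodeNum] <;> omega

open Classical in
/-- The time of the model checker, in terms of the length of the input formula. -/
theorem machineAux_checker_decidesWithin [Fintype (Symb P A)] {n : ℕ} (T : TS P A (Fin n))
    (s : Fin n) {U : Ty → Prop} {φ : Form P A} (h : HasType U (fun _ => none) φ .pr) {b : ℕ}
    (hnb : n ≤ b) (hU : ∀ τ, U τ → width n τ ≤ b) {t : ℝ}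
    (ht : ((iterTime (encodeForm φ).length b * (iterations b φ + 1) + 1 : ℕ) : ℝ) ≤ t) :
    DecidesWithin (machineAux checker .R isTrue) T s φ t := by
  intro x hx
  set f : ℕ → ℕ := fun X => φ.vars.dedup.idxOf X with hf
  have henc : encodeFormWith id (φ.rename f) = encodeForm φ := encodeFormWith_rename f φ
  -- The consecutive numbering of the input is a renaming that is injective on the variables of `φ`,
  -- so the lemmas on renaming apply.
  have hinj : Set.InjOn f {X | X ∈ φ.vars} := fun X hX Y _ hXY =>
    (List.idxOf_inj (List.mem_dedup.2 hX)).1 hXY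
  have hlt : ∀ X ∈ φ.vars, f X < (encodeForm φ).length := fun X hX =>
    (List.idxOf_lt_length_of_mem (List.mem_dedup.2 hX)).trans_le
      ((List.dedup_sublist _).length_le.trans (φ.length_vars_le _).le)
  have hty : Ctx.ty (fun _ => none) = fun _ => none := rfl
  have hWT : WT U (fun _ => none) (φ.rename f) .pr :=
    h.toWT.rename hinj (fun X hX => hX) _ fun X _ => rfl
  have hrun := run_checker T s hnb hU hWT (fun i hi => by
    rw [Form.vars_rename, List.mem_map] at hi
    obtain ⟨X, hX, rfl⟩ := hi
    rw [henc]
    exact hlt X hX)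
  rw [henc, iterations_rename] at hrun
  have hrep : ev T (φ.rename f) (List.replicate (encodeForm φ).length []) = _ :=
    ev_correct T hinj h (fun X hX => hX) (fun X hX => absurd rfl hX) (fun _ => none)
      (List.replicate (encodeForm φ).length []) x (by simpa using hlt)
      ⟨fun _ => none, fun X _ => rfl, fun i => by
        simp only [List.getD_eq_getElem?_getD, List.getElem?_replicate, Option.elim_none]
        split_ifs <;> rfl⟩ (fun X τ hX => by simp [hty] at hX) hx
  refine ⟨_, ht, ?_⟩
  have hout := machineAux_outputs isTrue hrun
  rw [hrep, List.reverse_reverse, isTrue_bit, List.getD_eq_getElem _ _ (by simp)] at hout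
  simp only [List.getElem_map, List.getElem_finRange] at hout
  exact hout

/-! ### The size of semantic domains -/

theorem tower_mono {x y : ℕ} (h : x ≤ y) (k : ℕ) : tower x k ≤ tower y k := by
  induction k with
  | zero => exact h
  | succ k ih => exact Nat.pow_le_pow_right (by omega) ih

theorem le_tower (x k : ℕ) : x ≤ tower x k := by
  induction k with
  | zero => exact le_rfl
  | succ k ih => exact ih.trans Nat.lt_two_pow_self.le

/-- A factor is pulled inside the tower. With `t` the tower one level below, `c * 2 ^ t ≤ 2 ^ (c - 1
+ t)`, and `c - 1 + t ≤ c * t` since `t ≥ 1`. -/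
theorem mul_tower_le {c x : ℕ} (hc : 1 ≤ c) (hx : 1 ≤ x) (k : ℕ) :
    c * tower x k ≤ tower (c * x) k := by
  induction k with
  | zero => exact le_rfl
  | succ k ih =>
    have h1 : 1 ≤ tower x k := hx.trans (le_tower x k)
    obtain ⟨d, rfl⟩ := Nat.exists_eq_add_of_le' hc
    calc (d + 1) * 2 ^ tower x k ≤ 2 ^ d * 2 ^ tower x k :=
          Nat.mul_le_mul_right _ Nat.lt_two_pow_self
      _ = 2 ^ (d + tower x k) := by rw [pow_add]
      _ ≤ 2 ^ tower ((d + 1) * x) k := Nat.pow_le_pow_right (by omega) (by nlinarith)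

theorem Ty.arity_le_mar (τ : Ty) : τ.arity ≤ τ.mar := by
  cases τ <;> simp [Ty.arity, Ty.mar]

theorem width_le_of_args {n j m w : ℕ}
    (hw : ∀ σ : Ty, σ.ord ≤ j → σ.mar ≤ m → width n σ ≤ w) (τ : Ty) (ho : τ.ord ≤ j + 1)
    (hm : τ.mar ≤ m) : width n τ ≤ (2 ^ w) ^ τ.arity * n := by
  induction τ with
  | pr => simp [width, Ty.arity]
  | arr σ v τ _ ih =>
    simp only [Ty.ord, Ty.mar, max_le_iff] at ho hm
    rw [width, Ty.arity, pow_succ', mul_assoc]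
    exact Nat.mul_le_mul (Nat.pow_le_pow_right (by omega) (hw σ (by omega) hm.2.1))
      (ih ho.2 hm.2.2)

/-- If argument types have width at most `w`, then at most `m` arguments give width at most `2 ^ (w
* m + n)`. As `n ≤ w`, the exponent is at most `(m + j + 1) * w`, and this factor moves to the
bottom of the tower, one for each order. -/
theorem width_le_tower {n m : ℕ} (hn : 1 ≤ n) (hm : 1 ≤ m) (j : ℕ) :
    ∀ σ : Ty, σ.ord ≤ j → σ.mar ≤ m → width n σ ≤ tower (n * (m + j) ^ j) j := by
  induction j with
  | zero =>
    intro σ hσ _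
    cases σ with
    | pr => simp [width, tower]
    | arr => simp [Ty.ord] at hσ
  | succ j ih =>
    intro τ ho hmar
    set w := tower (n * (m + j) ^ j) j with hw
    have hx : 1 ≤ n * (m + (j + 1)) ^ j := Nat.mul_pos hn (by positivity)
    have h1 : w ≤ tower (n * (m + (j + 1)) ^ j) j :=
      tower_mono (Nat.mul_le_mul_left _ (Nat.pow_le_pow_left (by omega) _)) j
    have h2 := mul_tower_le (show 1 ≤ m + (j + 1) by omega) hx j
    rw [mul_left_comm, ← pow_succ'] at h2
    have h3 : n ≤ w := (Nat.le_mul_of_pos_right _ (by positivity)).trans (le_tower _ _)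
    have h4 : w * m + n ≤ tower (n * (m + (j + 1)) ^ (j + 1)) j := by
      refine le_trans ?_ h2
      nlinarith
    calc width n τ ≤ (2 ^ w) ^ τ.arity * n := width_le_of_args ih τ ho hmar
      _ ≤ (2 ^ w) ^ m * 2 ^ n := Nat.mul_le_mul
          (Nat.pow_le_pow_right (by positivity) (τ.arity_le_mar.trans hmar)) Nat.lt_two_pow_self.le
      _ = 2 ^ (w * m + n) := by rw [← pow_mul, pow_add]
      _ ≤ _ := Nat.pow_le_pow_right (by omega) h4

theorem lt_tower_succ {n m : ℕ} (hm : 1 ≤ m) (j : ℕ) : n < tower (n * (m + j) ^ j) (j + 1) :=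
  ((Nat.le_mul_of_pos_right _ (by positivity)).trans (le_tower _ _)).trans_lt Nat.lt_two_pow_self

/-- At the top order the arity is kept as an exponent outside the tower, which saves one factor at
the bottom: the exponent there is `k - 1` rather than `k`. -/
theorem width_le_pow {n m : ℕ} (hn : 1 ≤ n) (hm : 1 ≤ m) (j : ℕ) (τ : Ty) (ho : τ.ord ≤ j + 1)
    (hmar : τ.mar ≤ m) : width n τ ≤ tower (n * (m + j) ^ j) (j + 1) ^ m * n :=
  (width_le_of_args (width_le_tower hn hm j) τ ho hmar).trans
    (Nat.mul_le_mul_right _ (Nat.pow_le_pow_right (by positivity) (τ.arity_le_mar.trans hmar)))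

/-- Type annotations belong to the input but are not counted by `|φ|`; their length is controlled by
the widths instead. -/
theorem encodeTy_length_lt {n : ℕ} (hn : 1 ≤ n) (τ : Ty) :
    (encodeTy τ : List (Symb P A)).length < 2 * width n τ := by
  induction τ with
  | pr => simp [encodeTy, width]; omega
  | arr σ v τ ih₁ ih₂ =>
    have h1 := width_pos hn σ
    have h2 := width_pos hn τ
    have h3 : (width n σ + 1) * width n τ ≤ 2 ^ width n σ * width n τ :=
      Nat.mul_le_mul_right _ Nat.lt_two_pow_self
    simp only [encodeTy, List.length_cons, List.length_append, width]
    nlinarith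

/-! ### Height and number of operators of a formula -/

/-- The height of a formula. -/
def Form.height : Form P A → ℕ
  | .prop _ | .var _ => 0
  | .neg φ | .dia _ φ | .lam _ _ _ φ | .mu _ _ φ => φ.height + 1
  | .or φ ψ | .app φ ψ => max φ.height ψ.height + 1

/-- The height of a formula without the negations. -/
def Form.depth : Form P A → ℕ
  | .prop _ | .var _ => 0
  | .neg φ => φ.depth
  | .dia _ φ | .lam _ _ _ φ | .mu _ _ φ => φ.depth + 1
  | .or φ ψ | .app φ ψ => max φ.depth ψ.depth + 1

/-- The number of negations at the root. -/
def Form.lead : Form P A → ℕ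
  | .neg φ => φ.lead + 1
  | _ => 0

/-- The maximal number of consecutive negations. -/
def Form.chain : Form P A → ℕ
  | .prop _ | .var _ => 0
  | .neg φ => max (φ.lead + 1) φ.chain
  | .dia _ φ | .lam _ _ _ φ | .mu _ _ φ => φ.chain
  | .or φ ψ | .app φ ψ => max φ.chain ψ.chain

/-- The number of nodes of the syntax tree. -/
def Form.nodes : Form P A → ℕ
  | .prop _ | .var _ => 1
  | .neg φ | .dia _ φ | .lam _ _ _ φ | .mu _ _ φ => φ.nodes + 1
  | .or φ ψ | .app φ ψ => φ.nodes + ψ.nodes + 1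

theorem Form.lead_le_chain (φ : Form P A) : φ.lead ≤ φ.chain := by
  cases φ <;> simp [Form.lead, Form.chain]

/-- Along a branch, each operator other than negation is followed by at most `K` negations. -/
theorem Form.height_le {K : ℕ} (φ : Form P A) (h : φ.chain ≤ K) :
    φ.height ≤ φ.lead + φ.depth * (K + 1) := by
  have step : ∀ ψ : Form P A, ψ.chain ≤ K → ψ.height ≤ ψ.lead + ψ.depth * (K + 1) →
      ψ.height + 1 ≤ (ψ.depth + 1) * (K + 1) := by
    intro ψ h1 h2
    have := ψ.lead_le_chain
    linarith
  induction φ with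
  | prop | var => simp [Form.height]
  | neg φ ih =>
    simp only [Form.chain, max_le_iff] at h
    have := ih h.2
    simp only [Form.height, Form.lead, Form.depth]
    omega
  | dia a φ ih => simpa [Form.height, Form.lead, Form.depth] using step φ h (ih h)
  | lam X v σ φ ih => simpa [Form.height, Form.lead, Form.depth] using step φ h (ih h)
  | mu X τ φ ih => simpa [Form.height, Form.lead, Form.depth] using step φ h (ih h)
  | or φ ψ ih₁ ih₂ | app φ ψ ih₁ ih₂ =>
    simp only [Form.chain, max_le_iff] at h
    have h1 := step φ h.1 (ih₁ h.1)
    have h2 := step ψ h.2 (ih₂ h.2)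
    have h3 := Nat.mul_le_mul_right (K + 1) (show φ.depth + 1 ≤ max φ.depth ψ.depth + 1 by omega)
    have h4 := Nat.mul_le_mul_right (K + 1) (show ψ.depth + 1 ≤ max φ.depth ψ.depth + 1 by omega)
    simp only [Form.height, Form.lead, Form.depth]
    omega

theorem Form.nodes_lt (φ : Form P A) : φ.nodes < 2 ^ (φ.height + 1) := by
  induction φ with
  | prop | var => simp [Form.nodes, Form.height]
  | neg φ ih | dia a φ ih | lam X v σ φ ih | mu X τ φ ih =>
    simp only [Form.nodes, Form.height]
    rw [pow_succ]
    omega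
  | or φ ψ ih₁ ih₂ | app φ ψ ih₁ ih₂ =>
    simp only [Form.nodes, Form.height]
    have h1 := Nat.pow_le_pow_right (show 0 < 2 by omega)
      (show φ.height + 1 ≤ max φ.height ψ.height + 1 by omega)
    have h2 := Nat.pow_le_pow_right (show 0 < 2 by omega)
      (show ψ.height + 1 ≤ max φ.height ψ.height + 1 by omega)
    rw [pow_succ]
    omega

theorem Form.length_vars_le_nodes (φ : Form P A) : φ.vars.length ≤ φ.nodes := by
  induction φ <;> simp [Form.vars, Form.nodes] <;> omega

/-- A negation only costs a factor `2`, never a factor `b + 1`. The separation matters: `b + 1` to a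
power quadratic in `|φ|` would bring `m * |φ|²` into the exponent of `D`, and then no constant could
be independent of `m`. -/
theorem iterations_le (b : ℕ) (φ : Form P A) :
    iterations b φ + 2 ≤ 3 * (2 ^ φ.height * (b + 1) ^ φ.depth) := by
  have pos : ∀ ψ : Form P A, 1 ≤ iterations b ψ := by
    intro ψ
    cases ψ <;> simp [iterations]
  have hb : ∀ {i j : ℕ}, i ≤ j → (b + 1) ^ i ≤ (b + 1) ^ j :=
    fun h => Nat.pow_le_pow_right (by omega) h
  have h2 : ∀ {i j : ℕ}, i ≤ j → 2 ^ i ≤ 2 ^ j := fun h => Nat.pow_le_pow_right (by omega) h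
  induction φ with
  | prop | var => simp [iterations, Form.height, Form.depth]
  | neg φ ih =>
    simp only [iterations, Form.height, Form.depth, pow_succ]
    nlinarith [pos φ]
  | dia a φ ih =>
    simp only [iterations, Form.height, Form.depth]
    have := Nat.mul_le_mul_left (2 ^ (φ.height + 1)) (hb (Nat.le_add_right φ.depth 1))
    rw [pow_succ, mul_right_comm] at this
    rw [pow_succ]
    nlinarith [pos φ]
  | lam X v σ φ ih | mu X τ φ ih =>
    simp only [iterations, Form.height, Form.depth]
    have := Nat.mul_le_mul_left (2 * (b + 1)) ih
    rw [pow_succ, pow_succ]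
    nlinarith [pos φ]
  | or φ ψ ih₁ ih₂ | app φ ψ ih₁ ih₂ =>
    simp only [iterations, Form.height, Form.depth]
    have e1 := Nat.mul_le_mul (h2 (show φ.height ≤ max φ.height ψ.height by omega))
      (hb (show φ.depth ≤ max φ.depth ψ.depth + 1 by omega))
    have e2 := Nat.mul_le_mul (h2 (show ψ.height ≤ max φ.height ψ.height by omega))
      (hb (show ψ.depth ≤ max φ.depth ψ.depth + 1 by omega))
    rw [pow_succ]
    nlinarith

theorem encodeFormWith_length_le {n b v : ℕ} (hn : 1 ≤ n) {U : Ty → Prop}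
    (hU : ∀ τ, U τ → width n τ ≤ b) {f : ℕ → ℕ} {Δ : ℕ → Option Ty} {φ : Form P A} {τ : Ty}
    (h : WT U Δ φ τ) : (∀ X ∈ φ.vars, f X ≤ v) →
    (encodeFormWith f φ).length ≤ φ.nodes * (v + 2 * b + 2) := by
  induction h with
  | prop => intro _; simp [encodeFormWith, Form.nodes]
  | var Δ X =>
    intro hf
    have := hf X (by simp [Form.vars])
    simp [encodeFormWith, encodeNum, Form.nodes]
    omega
  | neg _ _ _ _ ih | dia _ _ _ _ ih =>
    intro hf
    have := ih hf
    simp only [encodeFormWith, List.length_cons, Form.nodes]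
    linarith
  | or _ _ _ _ _ ih₁ ih₂ | app _ _ _ _ _ _ _ _ _ ih₁ ih₂ =>
    intro hf
    have h1 := ih₁ fun X hX => hf X (by simp [Form.vars, hX])
    have h2 := ih₂ fun X hX => hf X (by simp [Form.vars, hX])
    simp only [encodeFormWith, List.length_cons, List.length_append, Form.nodes]
    linarith
  | lam Δ X w σ τ φ _ _ hτ ih =>
    intro hf
    have h1 := ih fun X hX => hf X (by simp [Form.vars, hX])
    have h2 := hf X (by simp [Form.vars])
    have h3 := encodeTy_length_lt (P := P) (A := A) hn σ
    have h4 : width n σ ≤ b := Nat.lt_two_pow_self.le.trans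
      ((Nat.le_mul_of_pos_right _ (width_pos hn τ)).trans (hU _ hτ))
    simp only [encodeFormWith, encodeNum, List.length_cons, List.length_append, Form.nodes,
      List.length_replicate, List.length_nil]
    linarith
  | mu Δ X τ φ _ _ hτ ih =>
    intro hf
    have h1 := ih fun X hX => hf X (by simp [Form.vars, hX])
    have h2 := hf X (by simp [Form.vars])
    have h3 := encodeTy_length_lt (P := P) (A := A) hn τ
    have h4 := hU _ hτ
    simp only [encodeFormWith, encodeNum, List.length_cons, List.length_append, Form.nodes,
      List.length_replicate, List.length_nil]
    linarith

/-! ### The Fischer-Ladner closure -/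

theorem Form.depth_substNeg (X : ℕ) (φ : Form P A) : (φ.substNeg X).depth = φ.depth := by
  induction φ with
  | var Y => simp only [Form.substNeg]; split_ifs <;> rfl
  | lam Y v σ φ ih => simp only [Form.substNeg, Form.depth]; split_ifs <;> simp [ih]
  | mu Y τ φ ih => simp only [Form.substNeg, Form.depth]; split_ifs <;> simp [ih]
  | _ => simp_all [Form.substNeg, Form.depth]

theorem Form.lead_le_substNeg (X : ℕ) (φ : Form P A) : φ.lead ≤ (φ.substNeg X).lead := by
  induction φ with
  | neg φ ih => simpa [Form.substNeg, Form.lead] using ih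
  | _ => exact Nat.zero_le _

/-- Substitution only inserts negations. So a bound for the substituted body in the closure of a
negated fixpoint bounds the body itself. -/
theorem Form.chain_le_substNeg (X : ℕ) (φ : Form P A) : φ.chain ≤ (φ.substNeg X).chain := by
  induction φ with
  | prop | var => exact Nat.zero_le _
  | neg φ ih =>
    have := φ.lead_le_substNeg X
    simp only [Form.substNeg, Form.chain]
    omega
  | lam Y v σ φ ih => simp only [Form.substNeg, Form.chain]; split_ifs <;> simp [ih]
  | mu Y τ φ ih => simp only [Form.substNeg, Form.chain]; split_ifs <;> simp [ih]
  | or _ _ ih₁ ih₂ | app _ _ ih₁ ih₂ => exact max_le_max ih₁ ih₂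
  | dia _ _ ih => exact ih

/-- The formulas that the rules of the Fischer-Ladner closure derive from a formula. -/
def Form.succs : Form P A → List (Form P A)
  | .prop _ | .var _ => []
  | .or φ ψ => [φ, ψ]
  | .dia _ φ | .lam _ _ _ φ | .mu _ _ φ => [φ]
  | .app φ ψ => [φ, ψ, .neg ψ]
  | .neg (.prop q) => [.prop q]
  | .neg (.var X) => [.var X]
  | .neg (.or φ ψ) => [.neg φ, .neg ψ]
  | .neg (.dia _ φ) | .neg (.lam _ _ _ φ) => [.neg φ]
  | .neg (.mu X _ φ) => [.neg (φ.substNeg X)]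
  | .neg (.app φ ψ) => [.neg φ, ψ, .neg ψ]
  | .neg (.neg φ) => [φ]

theorem FL.reflTransGen {φ ψ : Form P A} (h : FL φ ψ) :
    Relation.ReflTransGen (fun φ ψ => ψ ∈ φ.succs) φ ψ := by
  induction h with
  | base => exact .refl
  | _ => exact Relation.ReflTransGen.tail (by assumption) (by simp [Form.succs])

theorem Form.succs_lt {φ ψ : Form P A} (h : ψ ∈ φ.succs) :
    ψ.depth < φ.depth ∨ ψ.depth = φ.depth ∧ ψ.lead < φ.lead := by
  cases φ with
  | neg φ =>
    cases φ <;> simp only [Form.succs, List.mem_cons, List.not_mem_nil, or_false] at h <;>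
      rcases h with rfl | rfl | rfl <;>
      simp [Form.depth, Form.lead, Form.depth_substNeg]
  | _ =>
    simp only [Form.succs, List.mem_cons, List.not_mem_nil, or_false] at h <;>
      rcases h with rfl | rfl | rfl <;>
      simp [Form.depth]

theorem finite_reflTransGen_succs (φ : Form P A) :
    {ψ | Relation.ReflTransGen (fun φ ψ => ψ ∈ φ.succs) φ ψ}.Finite := by
  refine ((Set.finite_singleton φ).union (Set.Finite.biUnion φ.succs.finite_toSet
    fun χ hχ => finite_reflTransGen_succs χ)).subset fun ψ hψ => ?_
  rcases Relation.ReflTransGen.cases_head hψ with rfl | ⟨χ, h1, h2⟩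
  · exact .inl rfl
  · exact .inr (Set.mem_biUnion h1 h2)
termination_by (φ.depth, φ.lead)
decreasing_by
  rcases Form.succs_lt hχ with h | ⟨h1, h2⟩
  · exact Prod.Lex.left _ _ h
  · rw [← h1]
    exact Prod.Lex.right _ h2

/-- Needed because `Set.ncard` is `0` on infinite sets, so that lower bounds for the size would
fail. Each rule has finitely many results and decreases depth and leading negations
lexicographically; the substitution in the rule for negated fixpoints does not change the depth. -/
theorem FL.finite (φ : Form P A) : {ψ | FL φ ψ}.Finite :=
  (finite_reflTransGen_succs φ).subset fun _ h => h.reflTransGen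

/-- Closure formulas are told apart by a numerical invariant; this gives both lower bounds for `|φ|`
below. -/
theorem Form.size_gt_of_values (φ : Form P A) (f : Form P A → ℕ) (g : ℕ → ℕ) (m : ℕ)
    (hg : Set.InjOn g (Set.Iic m)) (h : ∀ i ≤ m, ∃ ψ, FL φ ψ ∧ f ψ = g i) : m < φ.size := by
  have h1 : (g '' Set.Iic m).ncard ≤ (f '' {ψ | FL φ ψ}).ncard := by
    refine Set.ncard_le_ncard ?_ ((FL.finite φ).image f)
    rintro _ ⟨i, hi, rfl⟩
    exact h i hi
  rw [hg.ncard_image, Set.ncard_eq_toFinset_card', Set.toFinset_Iic,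
    Nat.card_Iic] at h1
  exact h1.trans (Set.ncard_image_le (FL.finite φ))

/-- Descending to the deeper operand lowers the depth by exactly one. Negations, which do not count,
are carried along or cancelled in pairs. -/
theorem FL.exists_depth {φ₀ : Form P A} {d : ℕ} (φ : Form P A) :
    FL φ₀ φ ∨ FL φ₀ (.neg φ) → φ.depth = d + 1 → ∃ ψ, FL φ₀ ψ ∧ ψ.depth = d := by
  induction φ with
  | prop | var => intro _ h; simp [Form.depth] at h
  | neg φ ih =>
    rintro (h | h) hd
    · exact ih (.inr h) hd
    · exact ih (.inl (.neg_neg _ h)) hd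
  | dia a φ =>
    rintro (h | h) hd
    · exact ⟨φ, .dia _ _ h, by simpa [Form.depth] using hd⟩
    · exact ⟨.neg φ, .neg_dia _ _ h, by simpa [Form.depth] using hd⟩
  | lam X v σ φ =>
    rintro (h | h) hd
    · exact ⟨φ, .lam _ _ _ _ h, by simpa [Form.depth] using hd⟩
    · exact ⟨.neg φ, .neg_lam _ _ _ _ h, by simpa [Form.depth] using hd⟩
  | mu X τ φ =>
    rintro (h | h) hd
    · exact ⟨φ, .mu _ _ _ h, by simpa [Form.depth] using hd⟩
    · exact ⟨_, .neg_mu _ _ _ h, by simpa [Form.depth, Form.depth_substNeg] using hd⟩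
  | or φ ψ =>
    intro h hd
    simp only [Form.depth, add_left_inj] at hd
    rcases max_choice φ.depth ψ.depth with he | he <;> rw [he] at hd <;> rcases h with h | h
    · exact ⟨φ, .or_left _ _ h, hd⟩
    · exact ⟨.neg φ, .neg_or_left _ _ h, hd⟩
    · exact ⟨ψ, .or_right _ _ h, hd⟩
    · exact ⟨.neg ψ, .neg_or_right _ _ h, hd⟩
  | app φ ψ =>
    intro h hd
    simp only [Form.depth, add_left_inj] at hd
    rcases max_choice φ.depth ψ.depth with he | he <;> rw [he] at hd <;> rcases h with h | h
    · exact ⟨φ, .app_fun _ _ h, hd⟩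
    · exact ⟨.neg φ, .neg_app_fun _ _ h, hd⟩
    · exact ⟨ψ, .app_arg _ _ h, hd⟩
    · exact ⟨ψ, .neg_app_arg _ _ h, hd⟩

theorem Form.depth_lt_size (φ : Form P A) : φ.depth < φ.size := by
  refine φ.size_gt_of_values Form.depth (fun i => φ.depth - i) φ.depth ?_ ?_
  · intro i hi j hj h
    simp only [Set.mem_Iic] at hi hj h
    omega
  · intro i
    induction i with
    | zero => exact fun _ => ⟨φ, .base, rfl⟩
    | succ i ih =>
      intro hi
      obtain ⟨ψ, h1, h2⟩ := ih (by omega)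
      exact FL.exists_depth ψ (.inl h1) (by omega)

/-- Double negations are removed two at a time, so the closure contains formulas with `l, l - 2, l -
4, …` leading negations. Only every second number is reached, hence the factor `2`. -/
theorem Form.lead_lt_size {φ₀ φ : Form P A} (h : FL φ₀ φ) : φ.lead < 2 * φ₀.size := by
  suffices φ.lead / 2 < φ₀.size by omega
  refine φ₀.size_gt_of_values Form.lead (fun i => φ.lead - 2 * i) (φ.lead / 2) ?_ ?_
  · intro i hi j hj h
    simp only [Set.mem_Iic] at hi hj h
    omega
  · intro i
    induction i with
    | zero => exact fun _ => ⟨φ, h, rfl⟩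
    | succ i ih =>
      intro hi
      obtain ⟨ψ, h1, h2⟩ := ih (by omega)
      match ψ, h1, h2 with
      | .neg (.neg ψ), h1, h2 =>
        refine ⟨ψ, .neg_neg _ h1, ?_⟩
        simp only [Form.lead] at h2
        omega
      | .neg (.prop _), _, h2 | .neg (.var _), _, h2 | .neg (.or _ _), _, h2
      | .neg (.dia _ _), _, h2 | .neg (.lam _ _ _ _), _, h2 | .neg (.mu _ _ _), _, h2
      | .neg (.app _ _), _, h2 | .prop _, _, h2 | .var _, _, h2 | .or _ _, _, h2
      | .dia _ _, _, h2 | .lam _ _ _ _, _, h2 | .mu _ _ _, _, h2 | .app _ _, _, h2 =>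
        simp only [Form.lead] at h2
        omega

/-- Up to substitutions of negated variables, every subformula or its negation is in the closure, so
each chain of negations appears at the root of some closure formula, possibly prolonged. -/
theorem FL.chain_le {φ₀ : Form P A} (φ : Form P A) (h : FL φ₀ φ ∨ FL φ₀ (.neg φ)) :
    φ.chain ≤ 2 * φ₀.size := by
  match φ with
  | .prop _ | .var _ => exact Nat.zero_le _
  | .neg φ =>
    refine max_le ?_ ?_
    · rcases h with h | h
      · exact (Form.lead_lt_size h).le
      · have := Form.lead_lt_size h
        simp only [Form.lead] at this
        omega
    · refine FL.chain_le φ ?_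
      rcases h with h | h
      · exact .inr h
      · exact .inl (.neg_neg _ h)
  | .dia a φ => exact FL.chain_le φ (h.imp (.dia _ _) (.neg_dia _ _))
  | .lam X v σ φ => exact FL.chain_le φ (h.imp (.lam _ _ _ _) (.neg_lam _ _ _ _))
  | .mu X τ φ =>
    rcases h with h | h
    · exact FL.chain_le φ (.inl (.mu _ _ _ h))
    · exact (φ.chain_le_substNeg X).trans (FL.chain_le _ (.inr (.neg_mu _ _ _ h)))
  | .or φ ψ =>
    exact max_le (FL.chain_le φ (h.imp (.or_left _ _) (.neg_or_left _ _)))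
      (FL.chain_le ψ (h.imp (.or_right _ _) (.neg_or_right _ _)))
  | .app φ ψ =>
    exact max_le (FL.chain_le φ (h.imp (.app_fun _ _) (.neg_app_fun _ _)))
      (FL.chain_le ψ (.inl (h.elim (.app_arg _ _) (.neg_app_arg _ _))))
termination_by (φ.depth, φ.lead)
decreasing_by
  all_goals first
    | exact Prod.Lex.right _ (Nat.lt_succ_self _)
    | exact Prod.Lex.left _ _ (by simp only [Form.depth, Form.depth_substNeg]; omega)

theorem Form.height_le_size (φ : Form P A) : φ.height ≤ φ.size * (2 * φ.size + 1) := by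
  have h1 := FL.chain_le φ (.inl (.base (φ₀ := φ)))
  have h2 := φ.height_le h1
  have h3 := φ.lead_le_chain
  have h4 := Nat.mul_le_mul_right (2 * φ.size + 1) φ.depth_lt_size
  linarith

/-! ### The time bound -/

/-- Everything is estimated by powers of `D`: `2 ≤ D` absorbs constants and powers of two, and `n <
D` gives `b + 1 ≤ D ^ (m + 1)`. Only `(b + 1) ^ d` multiplies `m` by `N`. -/
theorem checker_time_le {D b n m N h d M : ℕ} (hD : 2 ≤ D) (hb : b = D ^ m * n) (hn : n < D)
    (hh : h ≤ N * (2 * N + 1)) (hd : d ≤ N) (hN : 1 ≤ N) {I nd : ℕ}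
    (hI : I + 2 ≤ 3 * (2 ^ h * (b + 1) ^ d)) (hnd : nd < 2 ^ (h + 1))
    (hM : M ≤ nd * (nd + 2 * b + 2)) :
    iterTime M b * (I + 1) + 1 ≤ D ^ (40 * N ^ 2 + 4 * m * N) := by
  have hp : ∀ {i j : ℕ}, i ≤ j → D ^ i ≤ D ^ j := fun h => Nat.pow_le_pow_right (by omega) h
  have h2p : ∀ i, 2 ^ i ≤ D ^ i := fun i => Nat.pow_le_pow_left hD i
  have hb1 : b + 1 ≤ D ^ (m + 1) := by
    rw [hb, pow_succ]
    have := Nat.mul_le_mul_left (D ^ m) (Nat.succ_le_of_lt hn)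
    have := Nat.one_le_pow m D (by omega)
    rw [Nat.mul_succ] at *
    omega
  have hx : nd ≤ D ^ (h + 1) := hnd.le.trans (h2p _)
  have h4 : 4 ≤ D ^ 2 := h2p 2
  have e1 : nd + 2 * b + 2 ≤ D ^ (h + m + 4) := by
    have a1 : nd ≤ D ^ (h + m + 2) := hx.trans (hp (by omega))
    have a2 : b + 1 ≤ D ^ (h + m + 2) := hb1.trans (hp (by omega))
    rw [show h + m + 4 = h + m + 2 + 2 by ring, pow_add D (h + m + 2)]
    have := Nat.mul_le_mul_left (D ^ (h + m + 2)) h4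
    omega
  have e2 : M + 1 ≤ D ^ (2 * h + m + 6) := by
    have := Nat.mul_le_mul hx e1
    rw [← pow_add] at this
    have a3 : 1 ≤ D ^ (h + 1 + (h + m + 4)) := Nat.one_le_pow _ _ (by omega)
    rw [show 2 * h + m + 6 = h + 1 + (h + m + 4) + 1 by ring, pow_succ]
    have a4 := Nat.mul_le_mul_left (D ^ (h + 1 + (h + m + 4))) hD
    omega
  have e3 : I + 1 ≤ D ^ (2 + h + (m + 1) * N) := by
    have a1 : (b + 1) ^ d ≤ D ^ ((m + 1) * N) := by
      rw [pow_mul]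
      exact (Nat.pow_le_pow_left hb1 d).trans (Nat.pow_le_pow_right (by positivity) hd)
    have a2 := Nat.mul_le_mul (show 3 ≤ D ^ 2 by omega) (Nat.mul_le_mul (h2p h) a1)
    rw [← pow_add, ← pow_add, ← add_assoc] at a2
    omega
  have e4 : iterTime M b ≤ D ^ (7 + (2 * h + m + 6) + (m + 1) * 2) := by
    unfold iterTime
    rw [pow_add, pow_add, pow_mul D (m + 1)]
    exact Nat.mul_le_mul (Nat.mul_le_mul ((show 100 ≤ 2 ^ 7 by norm_num).trans (h2p 7)) e2)
      (Nat.pow_le_pow_left hb1 2)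
  have e5 := Nat.mul_le_mul e4 e3
  rw [← pow_add] at e5
  set E := 7 + (2 * h + m + 6) + (m + 1) * 2 + (2 + h + (m + 1) * N) with hE
  have e6 : iterTime M b * (I + 1) + 1 ≤ D ^ (E + 1) := by
    have a1 : 1 ≤ D ^ E := Nat.one_le_pow _ _ (by omega)
    have a2 := Nat.mul_le_mul_left (D ^ E) hD
    rw [pow_succ]
    omega
  refine e6.trans (hp ?_)
  -- The exponent is `18 + 3h + 3m + (m + 1)N`. With `h ≤ N(2N + 1)` and `N ≥ 1` this is at most
  -- `28N² + 4mN`, so `40` leaves room.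
  have : m ≤ m * N := Nat.le_mul_of_pos_right _ hN
  nlinarith

/-- The power of the tower suffices alone; the other factor is at least `1`, as its logarithm is
nonnegative. -/
theorem le_timeBound {C k m n N E : ℕ} (hn : 1 ≤ n) (hN : 1 ≤ N) (hD : 1 ≤ tower (n * (m + k - 1) ^ (k - 1)) k)
    (hE : E ≤ C * N ^ 2) :
    ((tower (n * (m + k - 1) ^ (k - 1)) k ^ E : ℕ) : ℝ) ≤ timeBound C k m n N := by
  unfold timeBound
  have h1 : (1 : ℝ) ≤ (2 : ℝ) ^ ((C : ℝ) * (N : ℝ) ^ k * Real.logb 2 ((n : ℝ) * (N : ℝ))) := by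
    refine Real.one_le_rpow (by norm_num) (mul_nonneg (by positivity) ?_)
    refine Real.logb_nonneg (by norm_num) ?_
    exact_mod_cast Nat.mul_le_mul hn hN
  have hD' : (1 : ℝ) ≤ (tower (n * (m + k - 1) ^ (k - 1)) k : ℝ) := by exact_mod_cast hD
  rw [Nat.cast_pow]
  exact (pow_le_pow_right₀ hD' hE).trans (le_mul_of_one_le_left (by positivity) h1)

theorem decidesWithin_of_mem_fragment [Fintype (Symb P A)] {n k m C : ℕ} (hk : 1 ≤ k) (hm : 1 ≤ m)
    (T : TS P A (Fin n)) (s : Fin n) {φ : Form P A} (hφ : φ ∈ Fragment P A k m)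
    (hC : 40 * φ.size ^ 2 + 4 * m * φ.size ≤ C * φ.size ^ 2) :
    DecidesWithin (machineAux checker .R isTrue) T s φ (timeBound C k m n φ.size) := by
  have hn : 1 ≤ n := s.pos
  have hN : 1 ≤ φ.size := Nat.lt_of_le_of_lt (Nat.zero_le _) φ.depth_lt_size
  have hnD : n < tower (n * (m + k - 1) ^ (k - 1)) k := by
    have := lt_tower_succ (n := n) hm (k - 1)
    rwa [show k - 1 + 1 = k by omega, show m + (k - 1) = m + k - 1 by omega] at this
  have hU : ∀ τ : Ty, τ.ord ≤ k ∧ τ.mar ≤ m →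
      width n τ ≤ tower (n * (m + k - 1) ^ (k - 1)) k ^ m * n := by
    intro τ hτ
    have := width_le_pow hn hm (k - 1) τ (by omega) hτ.2
    rwa [show k - 1 + 1 = k by omega, show m + (k - 1) = m + k - 1 by omega] at this
  refine machineAux_checker_decidesWithin T s hφ
    (Nat.le_mul_of_pos_left _ (Nat.pow_pos (by omega))) hU
    (le_trans (Nat.cast_le.2 (checker_time_le (by omega) rfl hnD φ.height_le_size
      φ.depth_lt_size.le hN (iterations_le _ φ) φ.nodes_lt ?_)) (le_timeBound hn hN (by omega) hC))
  refine encodeFormWith_length_le hn hU hφ.toWT fun X hX => ?_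
  exact (List.idxOf_lt_length_of_mem (List.mem_dedup.2 hX)).le.trans
    ((List.dedup_sublist _).length_le.trans φ.length_vars_le_nodes)

end HFL

/-- One Turing machine solves the model checking problem for all fragments `HFL(k,m)` within the
stated time. The constant depends on `k` and `m` at most, and it does not depend on them for the
formulas with `k, m ≤ |φ|`. -/
theorem mainTheorem3 (P A : Type) [Finite P] [Finite A] :
    ∃ M : Turing.TM2ComputableAux (HFL.Symb P A) Bool,
      (∀ k m : ℕ, 1 ≤ k → 1 ≤ m → ∃ C : ℕ,
        ∀ (n : ℕ) (T : HFL.TS P A (Fin n)) (s : Fin n), ∀ φ ∈ HFL.Fragment P A k m,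
          HFL.DecidesWithin M T s φ (HFL.timeBound C k m n φ.size)) ∧
      (∃ C : ℕ, ∀ k m : ℕ, 1 ≤ k → 1 ≤ m →
        ∀ (n : ℕ) (T : HFL.TS P A (Fin n)) (s : Fin n), ∀ φ ∈ HFL.Fragment P A k m,
          k ≤ φ.size → m ≤ φ.size →
          HFL.DecidesWithin M T s φ (HFL.timeBound C k m n φ.size)) := by
  let := Fintype.ofFinite (HFL.Symb P A)
  -- The exponent `40N² + 4mN` is at most `(40 + 4m)N²` in general, and at most `44N²` if `m ≤ N`.
  refine ⟨HFL.machineAux HFL.checker .R HFL.isTrue, fun k m hk hm => ⟨40 + 4 * m, ?_⟩, 44, ?_⟩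
  · intro n T s φ hφ
    refine HFL.decidesWithin_of_mem_fragment hk hm T s hφ ?_
    have : φ.size ≤ φ.size ^ 2 := Nat.le_self_pow (by omega) _
    nlinarith
  · intro k m hk hm n T s φ hφ _ hmφ
    refine HFL.decidesWithin_of_mem_fragment hk hm T s hφ ?_
    nlinarith
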